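/- \textbf{Theorem.} There is a universal constant $C>0$ such that the following holds. Let $d$ be a dimension, let $T,h>0$, let $\pi$ be a probability measure on $\mathbb{R}^d$, and let $\mu_t,\mu'_t:\mathbb{R}^d\to\mathbb{R}^d$ be time-dependent vector fields ($(t,x)\mapsto\mu_t(x)$ measurable). Let $(y_t)_{t\in[0,T]}$ and $(y'_t)_{t\in[0,T]}$ be processes with $y_0,y'_0\sim\pi$ such that $$\mathrm{d}y_t=\mu_t(y_t)\,\mathrm{d}t,\qquad \mathrm{d}y'_t=\mu'_{kh}(y'_{kh})\,\mathrm{d}t,\quad k=\lfloor t/h\rfloor ,$$ that is, $y_t=y_0+\int_0^t\mu_s(y_s)\,\mathrm{d}s$ for $0\le t\le T$, and $y'_t=y'_{kh}+(t-kh)\,\mu'_{kh}(y'_{kh})$ for all integers $k\ge 0$ and $kh\le t\le (k+1)h$, $t\le T$ (the piecewise-linear interpolation of the scheme $y'_{(k+1)h}=y'_{kh}+h\,\mu'_{kh}(y'_{kh})$). Let $\pi_t,\pi'_t$ denote the laws of $y_t,y'_t$. Suppose there are $L_t,L'_t,M\ge 1$ and $\zeta_t>0$, with $L_t$, $L'_t$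 and $\zeta_t^2$ integrable over $[0,T]$, such that for all $0\le t\le T$, with $k=\lfloor t/h\rfloor$: \begin{enumerate} \item $\pi_t$ has a positive differentiable density with respect to Lebesgue measure, and $\nabla\ln\pi_t$ and $\mu_t$ are $L_t$-Lipschitz; \item $\mu_t$ and $\mu'_{kh}$ are differentiable, and $\nabla\mu_t$ and $\nabla\mu'_{kh}$ are $M$-Lipschitz in operator norm; \item $\mu'_{kh}$ is $L'_t$-Lipschitz; \item $\mathbb{E}\|\mu_t(y'_t)-\mu'_{kh}(y'_{kh})\|^2\le\zeta_t^2$; \item $h\le 1/(2L'_t)$. \end{enumerate} Put $L'=\sup_{0\le t\le T}L'_t$, $\Lambda=\exp\bigl(\int_0^TL_t\,\mathrm{d}t\bigr)$, $\Lambda'=\exp\bigl(\int_0^TL'_t\,\mathrm{d}t\bigr)$ and $\zeta=\bigl(\int_0^T\zeta_t^2\,\mathrm{d}t\bigr)^{1/2}$. Then $$\mathrm{KL}(\pi'_T\,\|\,\pi_T)\le C\Bigl(\Lambda^{C}L'^{1/2}\zeta^2+(\Lambda^{C}+\Lambda'^{C})\bigl(L_0'^{1/2}d^{1/2}+MdT^{1/2}\bigr)\,\zeta\,T^{1/2}\Bigr).$$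 In particular, $\mathrm{KL}(\pi'_T\,\|\,\pi_T)$ is finite. -/

import Mathlib

open MeasureTheory Set
open scoped NNReal ENNReal

/-- The Euclidean space `ℝ^d` with its Euclidean norm and Lebesgue measure. -/
abbrev Euc (d : ℕ) : Type := EuclideanSpace ℝ (Fin d)

/-- The score `∇ ln ν` exists and is `K`-Lipschitz: the measure `ν` has an everywhere positive,
differentiable density `p` with respect to Lebesgue measure, and `∇ ln p` is `K`-Lipschitz. -/
def HasLipschitzScore {d : ℕ} (ν : Measure (Euc d)) (K : ℝ≥0) : Prop :=
  ∃ p : Euc d → ℝ, (∀ x, 0 < p x) ∧ Differentiable ℝ p ∧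
    ν = volume.withDensity (fun x => ENNReal.ofReal (p x)) ∧
    LipschitzWith K (gradient (fun x => Real.log (p x)))

/-- The vector field `f` is differentiable and its Jacobian `∇ f` is `K`-Lipschitz in
operator norm. -/
def HasLipschitzJacobian {d : ℕ} (f : Euc d → Euc d) (K : ℝ≥0) : Prop :=
  Differentiable ℝ f ∧ LipschitzWith K (fderiv ℝ f)

/-- The last grid time `k h`, `k = ⌊t / h⌋`, not after `t` (for `t ≥ 0`, `h > 0`). -/
noncomputable def gridTime (h t : ℝ) : ℝ := (⌊t / h⌋₊ : ℝ) * h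

/-- `(y_t)`, `0 ≤ t ≤ T`, is a process whose paths solve the ODE `dy_t = μ_t(y_t) dt`, in the
integrated sense `y_t = y_0 + ∫_0^t μ_s(y_s) ds`, with `y_0` of law `π₀`. -/
structure IsODEProcess {Ω : Type*} [MeasurableSpace Ω] (P : Measure Ω) {d : ℕ}
    (π₀ : Measure (Euc d)) (T : ℝ) (μ : ℝ → Euc d → Euc d) (y : ℝ → Ω → Euc d) : Prop where
  measurable : ∀ t ∈ Icc 0 T, Measurable (y t)
  init : P.map (y 0) = π₀
  integrable : ∀ᵐ ω ∂P, IntervalIntegrable (fun s => μ s (y s ω)) volume 0 T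
  solves : ∀ᵐ ω ∂P, ∀ t ∈ Icc 0 T, y t ω = y 0 ω + ∫ s in (0 : ℝ)..t, μ s (y s ω)

/-- `(y'_t)`, `0 ≤ t ≤ T`, is the piecewise linear interpolation, with step size `h`, of the
scheme `y'_{(k+1)h} = y'_{kh} + h μ'_{kh}(y'_{kh})`, with `y'_0` of law `π₀`.  The intervals
`[kh, (k+1)h]` are closed, so that the update at the grid times is included. -/
structure IsInterpolatedScheme {Ω : Type*} [MeasurableSpace Ω] (P : Measure Ω) {d : ℕ}
    (π₀ : Measure (Euc d)) (T h : ℝ) (μ' : ℝ → Euc d → Euc d) (y' : ℝ → Ω → Euc d) : Prop where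
  measurable : ∀ t ∈ Icc 0 T, Measurable (y' t)
  init : P.map (y' 0) = π₀
  step : ∀ᵐ ω ∂P, ∀ k : ℕ, ∀ t ∈ Icc ((k : ℝ) * h) (((k : ℝ) + 1) * h), t ≤ T →
    y' t ω = y' (k * h) ω + (t - k * h) • μ' (k * h) (y' (k * h) ω)

/-- The assumptions on the two processes.  The scheme evaluates `μ'` only at grid times, and its
drift at time `t` is `μ'_{kh}` with `k = ⌊t / h⌋`; `L'_t` is a Lipschitz constant of that drift. -/
structure GenericAssumption {Ω : Type*} [MeasurableSpace Ω] (P : Measure Ω) {d : ℕ}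
    (T h : ℝ) (μ μ' : ℝ → Euc d → Euc d) (y y' : ℝ → Ω → Euc d)
    (L L' ζ : ℝ → ℝ) (M : ℝ) : Prop where
  one_le_L : ∀ t ∈ Icc 0 T, 1 ≤ L t
  one_le_L' : ∀ t ∈ Icc 0 T, 1 ≤ L' t
  one_le_M : 1 ≤ M
  zeta_pos : ∀ t ∈ Icc 0 T, 0 < ζ t
  integrable_L : IntervalIntegrable L volume 0 T
  integrable_L' : IntervalIntegrable L' volume 0 T
  integrable_zeta_sq : IntervalIntegrable (fun t => ζ t ^ 2) volume 0 T
  score_lipschitz : ∀ t ∈ Icc 0 T, HasLipschitzScore (P.map (y t)) (L t).toNNReal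
  drift_lipschitz : ∀ t ∈ Icc 0 T, LipschitzWith (L t).toNNReal (μ t)
  drift_jacobian : ∀ t ∈ Icc 0 T, HasLipschitzJacobian (μ t) M.toNNReal
  drift'_lipschitz : ∀ t ∈ Icc 0 T, LipschitzWith (L' t).toNNReal (μ' (gridTime h t))
  drift'_jacobian : ∀ t ∈ Icc 0 T, HasLipschitzJacobian (μ' (gridTime h t)) M.toNNReal
  drift_error : ∀ t ∈ Icc 0 T,
    ∫⁻ ω, ‖μ t (y' t ω) - μ' (gridTime h t) (y' (gridTime h t) ω)‖ₑ ^ 2 ∂P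
      ≤ ENNReal.ofReal (ζ t ^ 2)
  small_step : ∀ t ∈ Icc 0 T, h ≤ 1 / (2 * L' t)

/-- `exp (∫_0^T L_t dt)`. -/
noncomputable def expIntegral (T : ℝ) (L : ℝ → ℝ) : ℝ := Real.exp (∫ t in (0 : ℝ)..T, L t)

/-- `ζ`, where `ζ² = ∫_0^T ζ_t² dt`. -/
noncomputable def totalError (T : ℝ) (ζ : ℝ → ℝ) : ℝ := √(∫ t in (0 : ℝ)..T, ζ t ^ 2)

/-!
The proof never differentiates the relative entropy in time. Pick a time `r` at which the Lipschitz
constant `ℓ = L_r` of the score is at most its mean over `[0, T]`, and let `ν` be the law of `y_r`.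
The flow `Φ` of `μ` carries `ν` to the law of `y_T`, and the law of `y'_T` back to `H_# ν`, where
`H = Φ_{T → r} ∘ F ∘ Φ_{r → 0}` and `F` is the map `y'_0 ↦ y'_T`. By the data processing
inequality it is enough to bound `KL(H_# ν ‖ ν)` for a map `H` close to the identity.

Write `G = H - id`. The change of variables formula expresses this entropy as the `ν`-mean of
`log p(x) - log |det ∇H(x)| - log p(H x)`. Integration by parts cancels the first-order terms,
`⟨∇ log p, G⟩` against `tr ∇G`, and leaves `ℓ 𝔼|G|²` together with the second-order error of
`log |det|`, which is bounded by the squared Frobenius norm of `∇G` and, where `∇H` is nearly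
singular, by a logarithm of its least singular value (`trc_sub_log_abs_det_le`,
`IsLogSmoothDensity.klDiv_map_le`).

The stability of the flow bounds `D = 𝔼|G|²` by `ζ² T`, up to powers of `exp (∫ L)`
(`IsFlow.lintegral_enorm_sub_sq_le`). The remaining quantity is controlled by the interpolation
inequality `𝔼‖∇G‖_F² ≤ 2 ℓ D + 7 d m √D`, with `m` a Lipschitz constant of `∇G`
(`IsLogSmoothDensity.integral_frobSq_fderiv_le`). It rests on a weak form of Bochner's inequality
for the divergence `δ a = div a + ⟨∇ log p, a⟩`, which needs no second derivative of `log p`: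
since `x ↦ x + ε a(x)` transports at most unit mass, the second-order term in `ε` has a sign
(`IsLogSmoothDensity.integral_divergence_sq_le`).

No existence theory for differential equations is required. The score condition makes the law of
`y_t` positive on open sets, so the values of the given solutions are dense at every time, and the
flow is the continuous extension of `y_s ↦ y_t`. Regularity passes through this extension in the
form of the inequality `FourPoint`, which says without derivatives that a map and its derivative are
Lipschitz; differentiability is recovered from Rademacher's theorem (`FourPoint.differentiable`).
-/

/-! ### Maps with Lipschitz derivative, through four-point differences -/

/-- The four-point condition with constants `a` and `m`. It is a derivative-free way of saying
that `f` is `a`-Lipschitz and has an `m`-Lipschitz derivative; unlike the latter it is a closed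
condition on finitely many values, so it passes to limits and to extensions by density. -/
def FourPoint {E F : Type*} [NormedAddCommGroup E] [NormedAddCommGroup F]
    (f : E → F) (a m : ℝ) : Prop :=
  ∀ x y z w, ‖f x - f y - f z + f w‖ ≤ a * ‖x - y - z + w‖ + m * ‖y - w‖ * ‖z - w‖

namespace FourPoint

variable {E F G : Type*} [NormedAddCommGroup E] [NormedAddCommGroup F] [NormedAddCommGroup G]

theorem norm_sub_le {f : E → F} {a m : ℝ} (hf : FourPoint f a m) (x y : E) :
    ‖f x - f y‖ ≤ a * ‖x - y‖ := by
  simpa using hf x y y y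

theorem lipschitzWith {f : E → F} {a m : ℝ} (hf : FourPoint f a m) :
    LipschitzWith a.toNNReal f := by
  refine LipschitzWith.of_dist_le_mul fun x y => ?_
  rw [dist_eq_norm, dist_eq_norm]
  exact (hf.norm_sub_le x y).trans (by gcongr; exact Real.le_coe_toNNReal a)

theorem continuous {f : E → F} {a m : ℝ} (hf : FourPoint f a m) : Continuous f :=
  hf.lipschitzWith.continuous

theorem comp {g : F → G} {f : E → F} {a m b n : ℝ} (hg : FourPoint g b n) (hf : FourPoint f a m)
    (hb : 0 ≤ b) (hn : 0 ≤ n) : FourPoint (g ∘ f) (b * a) (b * m + n * a ^ 2) := by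
  intro x y z w
  have h1 := hf x y z w
  have h2 := hf.norm_sub_le y w
  have h3 := hf.norm_sub_le z w
  calc ‖g (f x) - g (f y) - g (f z) + g (f w)‖
      ≤ b * ‖f x - f y - f z + f w‖ + n * ‖f y - f w‖ * ‖f z - f w‖ := hg _ _ _ _
    _ ≤ b * (a * ‖x - y - z + w‖ + m * ‖y - w‖ * ‖z - w‖)
        + n * (a * ‖y - w‖) * (a * ‖z - w‖) := by
          gcongr
          exact mul_nonneg hn ((norm_nonneg _).trans h2)
    _ = _ := by ring

theorem id : FourPoint (fun x : E => x) 1 0 := by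
  intro x y z w; simp

theorem mono {f : E → F} {a m b n : ℝ} (hf : FourPoint f a m) (hab : a ≤ b) (hmn : m ≤ n) :
    FourPoint f b n := by
  intro x y z w
  refine (hf x y z w).trans ?_
  gcongr

theorem add {f g : E → F} {a m b n : ℝ} (hf : FourPoint f a m) (hg : FourPoint g b n) :
    FourPoint (fun x => f x + g x) (a + b) (m + n) := by
  intro x y z w
  have e : f x + g x - (f y + g y) - (f z + g z) + (f w + g w)
      = (f x - f y - f z + f w) + (g x - g y - g z + g w) := by abel
  rw [e]
  refine (norm_add_le _ _).trans ((add_le_add (hf x y z w) (hg x y z w)).trans (le_of_eq ?_))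
  ring

theorem of_lipschitz_fderiv [NormedSpace ℝ E] [NormedSpace ℝ F] {f : E → F} {a m : ℝ}
    (ha : ∀ x y, ‖f x - f y‖ ≤ a * ‖x - y‖) (hd : Differentiable ℝ f)
    (hm : ∀ x y, ‖fderiv ℝ f x - fderiv ℝ f y‖ ≤ m * ‖x - y‖) : FourPoint f a m := by
  intro x y z w
  -- `u` completes `y, z, w` to a parallelogram
  set u := y + z - w with hu
  have h1 : ‖f x - f u‖ ≤ a * ‖x - y - z + w‖ := by
    have := ha x u
    rwa [hu, show x - (y + z - w) = x - y - z + w by abel] at this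
  have h2 : ‖(f u - f z) - (f y - f w)‖ ≤ m * ‖z - w‖ * ‖y - w‖ := by
    let φ : E → F := fun s => f (s + (z - w)) - f s
    have hφ : ∀ s, HasFDerivAt φ (fderiv ℝ f (s + (z - w)) - fderiv ℝ f s) s := fun s =>
      ((hasFDerivAt_comp_add_right (z - w)).2 (hd _).hasFDerivAt).sub (hd s).hasFDerivAt
    have key : ‖φ y - φ w‖ ≤ m * ‖z - w‖ * ‖y - w‖ := by
      refine Convex.norm_image_sub_le_of_norm_hasFDerivWithin_le (s := univ)
        (f' := fun s => fderiv ℝ f (s + (z - w)) - fderiv ℝ f s)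
        (fun s _ => (hφ s).hasFDerivWithinAt) (fun s _ => ?_) convex_univ (mem_univ _) (mem_univ _)
      simpa using hm (s + (z - w)) s
    have e : (f u - f z) - (f y - f w) = φ y - φ w := by
      simp only [φ, hu]
      rw [show w + (z - w) = z by abel, show y + (z - w) = y + z - w by abel]
      abel
    rwa [e]
  have e : f x - f y - f z + f w = (f x - f u) + ((f u - f z) - (f y - f w)) := by abel
  rw [e]
  refine (norm_add_le _ _).trans ((add_le_add h1 h2).trans (le_of_eq (by ring)))

/-- Telescoping compares an increment of `f` at `x` with the derivative of `f` at any other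
point `y`. -/
theorem norm_sub_sub_fderiv_le [NormedSpace ℝ E] [NormedSpace ℝ F] {f : E → F} {a m : ℝ}
    (hf : FourPoint f a m) (hm : 0 ≤ m) {y : E} {A : E →L[ℝ] F} (hA : HasFDerivAt f A y)
    (x v : E) : ‖f (x + v) - f x - A v‖ ≤ m * ‖v‖ * (‖x - y‖ + ‖v‖) := by
  have key : ∀ n : ℕ, 0 < n → ‖f (x + v) - f x - (n : ℝ) • (f (y + (n : ℝ)⁻¹ • v) - f y)‖
      ≤ m * ‖v‖ * (‖x - y‖ + ‖v‖) := by
    intro n hn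
    have hn' : (0 : ℝ) < n := by exact_mod_cast hn
    let g : ℕ → F := fun k => f (x + ((k : ℝ) * (n : ℝ)⁻¹) • v)
    have h0 : f (x + v) - f x = ∑ k ∈ Finset.range n, (g (k + 1) - g k) := by
      rw [Finset.sum_range_sub]
      simp [g, hn'.ne']
    have h1 : (n : ℝ) • (f (y + (n : ℝ)⁻¹ • v) - f y)
        = ∑ k ∈ Finset.range n, (f (y + (n : ℝ)⁻¹ • v) - f y) := by
      rw [Finset.sum_const, Finset.card_range, Nat.cast_smul_eq_nsmul]
    rw [h0, h1, ← Finset.sum_sub_distrib]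
    have hterm : ∀ k ∈ Finset.range n, ‖(g (k + 1) - g k) - (f (y + (n : ℝ)⁻¹ • v) - f y)‖
        ≤ m * ((n : ℝ)⁻¹ * ‖v‖) * (‖x - y‖ + ‖v‖) := by
      intro k hk
      have hk' : (k : ℝ) * (n : ℝ)⁻¹ ≤ 1 := by
        rw [← div_eq_mul_inv, div_le_one hn']
        exact_mod_cast (Finset.mem_range.1 hk).le
      have h4 := hf (x + (((k + 1 : ℕ) : ℝ) * (n : ℝ)⁻¹) • v) (x + ((k : ℝ) * (n : ℝ)⁻¹) • v)
        (y + (n : ℝ)⁻¹ • v) y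
      have e1 : x + (((k + 1 : ℕ) : ℝ) * (n : ℝ)⁻¹) • v - (x + ((k : ℝ) * (n : ℝ)⁻¹) • v)
          - (y + (n : ℝ)⁻¹ • v) + y = 0 := by
        push_cast
        module
      have e2 : (g (k + 1) - g k) - (f (y + (n : ℝ)⁻¹ • v) - f y)
          = g (k + 1) - g k - f (y + (n : ℝ)⁻¹ • v) + f y := by abel
      rw [e1, norm_zero, mul_zero, zero_add] at h4
      rw [e2]
      refine h4.trans ?_
      have e3 : ‖y + (n : ℝ)⁻¹ • v - y‖ = (n : ℝ)⁻¹ * ‖v‖ := by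
        rw [add_sub_cancel_left, norm_smul, Real.norm_of_nonneg (by positivity)]
      have e4 : ‖x + ((k : ℝ) * (n : ℝ)⁻¹) • v - y‖ ≤ ‖x - y‖ + ‖v‖ := by
        rw [show x + ((k : ℝ) * (n : ℝ)⁻¹) • v - y = (x - y) + ((k : ℝ) * (n : ℝ)⁻¹) • v by abel]
        refine (norm_add_le _ _).trans ?_
        rw [norm_smul, Real.norm_of_nonneg (by positivity)]
        gcongr
        exact mul_le_of_le_one_left (norm_nonneg _) hk'
      rw [e3]
      calc m * ‖x + ((k : ℝ) * (n : ℝ)⁻¹) • v - y‖ * ((n : ℝ)⁻¹ * ‖v‖)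
          ≤ m * (‖x - y‖ + ‖v‖) * ((n : ℝ)⁻¹ * ‖v‖) := by gcongr
        _ = _ := by ring
    refine (norm_sum_le_of_le _ hterm).trans (le_of_eq ?_)
    rw [Finset.sum_const, Finset.card_range, nsmul_eq_mul]
    field_simp
  have hlim : Filter.Tendsto (fun n : ℕ => (n : ℝ) • (f (y + (n : ℝ)⁻¹ • v) - f y)) Filter.atTop
      (nhds (A v)) := (hA.lim_real v).comp tendsto_natCast_atTop_atTop
  refine le_of_tendsto (((tendsto_const_nhds (x := f (x + v) - f x)).sub hlim).norm) ?_
  filter_upwards [Filter.eventually_gt_atTop 0] with n hn using key n hn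

variable [NormedSpace ℝ E] [NormedSpace ℝ F] {f : E → F} {a m : ℝ}

theorem norm_fderiv_le (hf : FourPoint f a m) (ha : 0 ≤ a) (x : E) : ‖fderiv ℝ f x‖ ≤ a := by
  have := norm_fderiv_le_of_lipschitz ℝ hf.lipschitzWith (x₀ := x)
  rwa [Real.coe_toNNReal a ha] at this

theorem norm_sub_le_of_hasFDerivAt (hf : FourPoint f a m) (hm : 0 ≤ m) {x y : E}
    {A B : E →L[ℝ] F} (hA : HasFDerivAt f A x) (hB : HasFDerivAt f B y) :
    ‖A - B‖ ≤ m * ‖x - y‖ := by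
  refine ContinuousLinearMap.opNorm_le_bound _ (by positivity) fun v => ?_
  -- the bound at increments `v / n`, multiplied by `n`
  have hlim : Filter.Tendsto (fun c : ℝ => c • (f (x + c⁻¹ • v) - f x) - B v) Filter.atTop
      (nhds (A v - B v)) := (hA.lim_real v).sub tendsto_const_nhds
  have hlim2 : Filter.Tendsto (fun c : ℝ => m * ‖v‖ * (‖x - y‖ + c⁻¹ * ‖v‖)) Filter.atTop
      (nhds (m * ‖v‖ * (‖x - y‖ + 0 * ‖v‖))) :=
    (tendsto_const_nhds.add (tendsto_inv_atTop_zero.mul_const _)).const_mul _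
  have := le_of_tendsto_of_tendsto hlim.norm hlim2 (by
    filter_upwards [Filter.eventually_gt_atTop 0] with c hc
    have h := hf.norm_sub_sub_fderiv_le hm hB x (c⁻¹ • v)
    rw [norm_smul, Real.norm_of_nonneg (inv_nonneg.2 hc.le), map_smul] at h
    have e : c • (f (x + c⁻¹ • v) - f x) - B v
        = c • (f (x + c⁻¹ • v) - f x - c⁻¹ • B v) := by
      rw [smul_sub c (_ - _), smul_smul, mul_inv_cancel₀ hc.ne', one_smul]
    rw [e, norm_smul, Real.norm_of_nonneg hc.le]
    refine (mul_le_mul_of_nonneg_left h hc.le).trans (le_of_eq ?_)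
    field_simp)
  rw [zero_mul, add_zero] at this
  simpa [mul_right_comm] using this

/-- A map satisfying the four-point condition is differentiable at almost every point by
Rademacher's theorem, and the derivatives at nearby points of differentiability converge to a
derivative at the remaining ones. -/
theorem differentiable [FiniteDimensional ℝ E] [FiniteDimensional ℝ F] (hf : FourPoint f a m)
    (hm : 0 ≤ m) : Differentiable ℝ f := by
  intro x
  borelize E
  have hdense : Dense {y | DifferentiableAt ℝ f y} :=
    Measure.dense_of_ae (hf.lipschitzWith.ae_differentiableAt (μ := Measure.addHaar))
  obtain ⟨y, hy, hyx⟩ := mem_closure_iff_seq_limit.1 (hdense x)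
  have hcauchy : CauchySeq fun n => fderiv ℝ f (y n) := by
    refine Metric.cauchySeq_iff.2 fun ε hε => ?_
    obtain ⟨N, hN⟩ := Metric.cauchySeq_iff.1 hyx.cauchySeq (ε / (m + 1)) (by positivity)
    refine ⟨N, fun k hk l hl => ?_⟩
    have h := hN k hk l hl
    rw [dist_eq_norm] at h ⊢
    rw [lt_div_iff₀ (by positivity)] at h
    refine (hf.norm_sub_le_of_hasFDerivAt hm (hy k).hasFDerivAt (hy l).hasFDerivAt).trans_lt ?_
    nlinarith [norm_nonneg (y k - y l)]
  obtain ⟨A, hA⟩ := cauchySeq_tendsto_of_complete hcauchy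
  have hbound : ∀ v, ‖f (x + v) - f x - A v‖ ≤ m * ‖v‖ * ‖v‖ := by
    intro v
    have h1 : Filter.Tendsto (fun n => f (x + v) - f x - fderiv ℝ f (y n) v) Filter.atTop
        (nhds (f (x + v) - f x - A v)) :=
      tendsto_const_nhds.sub (((ContinuousLinearMap.apply ℝ F v).continuous.tendsto A).comp hA)
    have h2 : Filter.Tendsto (fun n => m * ‖v‖ * (‖x - y n‖ + ‖v‖)) Filter.atTop
        (nhds (m * ‖v‖ * (‖x - x‖ + ‖v‖))) :=
      ((tendsto_const_nhds.sub hyx).norm.add tendsto_const_nhds).const_mul _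
    have := le_of_tendsto_of_tendsto h1.norm h2 (Filter.Eventually.of_forall fun n =>
      hf.norm_sub_sub_fderiv_le hm (hy n).hasFDerivAt x v)
    simpa using this
  refine (HasFDerivAt.differentiableAt (f' := A) ?_)
  rw [hasFDerivAt_iff_isLittleO_nhds_zero]
  refine Asymptotics.IsLittleO.of_bound fun c hc => ?_
  have : ∀ᶠ v : E in nhds 0, ‖v‖ < c / (m + 1) := by
    have := Metric.ball_mem_nhds (0 : E) (ε := c / (m + 1)) (by positivity)
    filter_upwards [this] with v hv
    simpa using hv
  filter_upwards [this] with v hv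
  refine (hbound v).trans ?_
  rw [lt_div_iff₀ (by positivity)] at hv
  gcongr
  nlinarith [norm_nonneg v]

theorem norm_fderiv_sub_le [FiniteDimensional ℝ E] [FiniteDimensional ℝ F] (hf : FourPoint f a m)
    (hm : 0 ≤ m) (x y : E) : ‖fderiv ℝ f x - fderiv ℝ f y‖ ≤ m * ‖x - y‖ :=
  hf.norm_sub_le_of_hasFDerivAt hm (hf.differentiable hm x).hasFDerivAt
    (hf.differentiable hm y).hasFDerivAt

theorem continuous_fderiv [FiniteDimensional ℝ E] [FiniteDimensional ℝ F] (hf : FourPoint f a m)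
    (hm : 0 ≤ m) : Continuous (fderiv ℝ f) :=
  (LipschitzWith.of_dist_le_mul (K := m.toNNReal) fun x y => by
    rw [dist_eq_norm, dist_eq_norm, Real.coe_toNNReal m hm]
    exact hf.norm_fderiv_sub_le hm x y).continuous

end FourPoint

/-- A correspondence `y i ↦ z i` with dense source that satisfies the four-point inequality
extends to the whole space. -/
theorem FourPoint.exists_extension {ι E F : Type*} [NormedAddCommGroup E]
    [NormedAddCommGroup F] [NormedSpace ℝ F] [FiniteDimensional ℝ F] {y : ι → E} {z : ι → F}
    {a m : ℝ} (hy : DenseRange y)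
    (h : ∀ i j k l, ‖z i - z j - z k + z l‖
      ≤ a * ‖y i - y j - y k + y l‖ + m * ‖y j - y l‖ * ‖y k - y l‖) :
    ∃ f : E → F, FourPoint f a m ∧ ∀ i, f (y i) = z i := by
  have hlip : ∀ i j, ‖z i - z j‖ ≤ a * ‖y i - y j‖ := fun i j => by simpa using h i j j j
  classical
  let f₀ : E → F := fun x => if hx : ∃ i, y i = x then z hx.choose else 0
  have hf₀ : ∀ i, f₀ (y i) = z i := by
    intro i
    have hx : ∃ j, y j = y i := ⟨i, rfl⟩
    have h1 := hlip hx.choose i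
    rw [hx.choose_spec, sub_self, norm_zero, mul_zero] at h1
    simp only [f₀, dif_pos hx]
    exact sub_eq_zero.1 (norm_le_zero_iff.1 h1)
  have hlo : LipschitzOnWith a.toNNReal f₀ (range y) := by
    refine LipschitzOnWith.of_dist_le_mul ?_
    rintro _ ⟨i, rfl⟩ _ ⟨j, rfl⟩
    rw [hf₀, hf₀, dist_eq_norm, dist_eq_norm]
    exact (hlip i j).trans (by gcongr; exact Real.le_coe_toNNReal a)
  obtain ⟨f, hf, hff⟩ := hlo.extend_finite_dimension
  have hfy : ∀ i, f (y i) = z i := fun i => by rw [← hff ⟨i, rfl⟩, hf₀]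
  have hc := hf.continuous
  refine ⟨f, ?_, hfy⟩
  have hd : DenseRange (fun q : (ι × ι) × (ι × ι) => ((y q.1.1, y q.1.2), (y q.2.1, y q.2.2))) :=
    (hy.prodMap hy).prodMap (hy.prodMap hy)
  have key : ∀ q : (E × E) × (E × E), ‖f q.1.1 - f q.1.2 - f q.2.1 + f q.2.2‖
      ≤ a * ‖q.1.1 - q.1.2 - q.2.1 + q.2.2‖ + m * ‖q.1.2 - q.2.2‖ * ‖q.2.1 - q.2.2‖ := by
    intro q
    refine hd.induction_on (p := fun q : (E × E) × (E × E) => ‖f q.1.1 - f q.1.2 - f q.2.1 + f q.2.2‖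
      ≤ a * ‖q.1.1 - q.1.2 - q.2.1 + q.2.2‖ + m * ‖q.1.2 - q.2.2‖ * ‖q.2.1 - q.2.2‖) q ?_ ?_
    · exact isClosed_le (by fun_prop) (by fun_prop)
    · intro i
      simp only [hfy]
      exact h _ _ _ _
  exact fun x y z w => key ((x, y), (z, w))

/-! ### Grönwall's inequality with an integrable rate -/

theorem AbsolutelyContinuousOnInterval.exp {f : ℝ → ℝ} {a b : ℝ}
    (hf : AbsolutelyContinuousOnInterval f a b) :
    AbsolutelyContinuousOnInterval (fun x => Real.exp (f x)) a b := by
  obtain ⟨C, hC⟩ := hf.exists_bound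
  rw [absolutelyContinuousOnInterval_iff] at hf ⊢
  intro ε hε
  obtain ⟨δ, hδ, h⟩ := hf (ε / Real.exp C) (by positivity)
  refine ⟨δ, hδ, fun I hI hlt => ?_⟩
  have h1 := h I hI hlt
  rw [lt_div_iff₀ (Real.exp_pos _), Finset.sum_mul] at h1
  refine lt_of_le_of_lt (Finset.sum_le_sum fun i hi => ?_) h1
  have hx := hC _ (hI.1 i hi).1
  have hy := hC _ (hI.1 i hi).2
  generalize f (I.2 i).1 = x at *
  generalize f (I.2 i).2 = y at *
  have : ‖Real.exp y - Real.exp x‖ ≤ Real.exp C * ‖y - x‖ := by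
    refine (convex_Icc (-C) C).norm_image_sub_le_of_norm_deriv_le (f := Real.exp)
      (fun u _ => Real.differentiableAt_exp) (fun u hu => ?_) ?_ ?_
    · rw [Real.deriv_exp, Real.norm_of_nonneg (Real.exp_pos _).le]
      exact Real.exp_le_exp.2 hu.2
    · exact abs_le.1 hx
    · exact abs_le.1 hy
  rw [dist_comm, dist_comm x, dist_eq_norm, dist_eq_norm, mul_comm]
  exact this

theorem integral_mul_exp_integral {L : ℝ → ℝ} {a b : ℝ}
    (hL : IntervalIntegrable L volume a b) :
    ∫ t in a..b, L t * Real.exp (∫ s in a..t, L s) = Real.exp (∫ s in a..b, L s) - 1 := by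
  have hac := hL.absolutelyContinuousOnInterval_intervalIntegral (c := a) (by simp)
  have h := hac.exp.integral_deriv_eq_sub
  rw [intervalIntegral.integral_same, Real.exp_zero] at h
  rw [← h]
  refine intervalIntegral.integral_congr_ae ?_
  filter_upwards [hL.ae_hasDerivAt_integral] with x hx hxab
  have := (hx (uIoc_subset_uIcc hxab) a (by simp)).exp.deriv
  rw [this, mul_comm]

/-- Grönwall's inequality in integral form. At a maximum point `t` of `φ exp (-∫ L)`, with maximal
value `A`, the hypothesis reads `A exp (∫_a^t L) ≤ c + A (exp (∫_a^t L) - 1)`. -/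
theorem le_mul_exp_of_le_add_integral {L φ : ℝ → ℝ} {a b c : ℝ} (hab : a ≤ b)
    (hL : IntervalIntegrable L volume a b) (hL0 : ∀ t ∈ Icc a b, 0 ≤ L t)
    (hφ : ContinuousOn φ (Icc a b))
    (h : ∀ t ∈ Icc a b, φ t ≤ c + ∫ s in a..t, L s * φ s) :
    ∀ t ∈ Icc a b, φ t ≤ c * Real.exp (∫ s in a..t, L s) := by
  have hI : ContinuousOn (fun t => ∫ s in a..t, L s) (Icc a b) := by
    have := (hL.absolutelyContinuousOnInterval_intervalIntegral (c := a) (by simp)).continuousOn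
    rwa [uIcc_of_le hab] at this
  have hE : ContinuousOn (fun t => Real.exp (∫ s in a..t, L s)) (Icc a b) :=
    Real.continuous_exp.comp_continuousOn hI
  obtain ⟨t₀, ht₀, hmax⟩ := isCompact_Icc.exists_isMaxOn (nonempty_Icc.2 hab)
    (hφ.mul (Real.continuous_exp.comp_continuousOn hI.neg))
  set A := φ t₀ * Real.exp (-∫ s in a..t₀, L s) with hA
  have hle : ∀ t ∈ Icc a b, φ t ≤ A * Real.exp (∫ s in a..t, L s) := by
    intro t ht
    have : φ t * Real.exp (-∫ s in a..t, L s) ≤ A := hmax ht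
    calc φ t = φ t * Real.exp (-∫ s in a..t, L s) * Real.exp (∫ s in a..t, L s) := by
          rw [mul_assoc, ← Real.exp_add, neg_add_cancel, Real.exp_zero, mul_one]
      _ ≤ _ := by gcongr
  have hsub : uIcc a t₀ ⊆ uIcc a b := by
    rw [uIcc_of_le hab, uIcc_of_le ht₀.1]; exact Icc_subset_Icc_right ht₀.2
  have hsub' : uIcc a t₀ ⊆ Icc a b := by rwa [uIcc_of_le hab] at hsub
  have hLt := hL.mono_set hsub
  have hint : ∫ s in a..t₀, L s * φ s ≤ ∫ s in a..t₀, A * (L s * Real.exp (∫ u in a..s, L u)) := by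
    refine intervalIntegral.integral_mono_on ht₀.1 (hLt.mul_continuousOn (hφ.mono hsub'))
      ((hLt.mul_continuousOn (hE.mono hsub')).const_mul A) fun s hs => ?_
    have hs' : s ∈ Icc a b := ⟨hs.1, hs.2.trans ht₀.2⟩
    calc L s * φ s ≤ L s * (A * Real.exp (∫ u in a..s, L u)) :=
          mul_le_mul_of_nonneg_left (hle s hs') (hL0 s hs')
      _ = _ := by ring
  rw [intervalIntegral.integral_const_mul, integral_mul_exp_integral hLt] at hint
  have hAc : A ≤ c := by
    have h1 := h t₀ ht₀
    have h2 : φ t₀ = A * Real.exp (∫ s in a..t₀, L s) := by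
      rw [hA, mul_assoc, ← Real.exp_add, neg_add_cancel, Real.exp_zero, mul_one]
    rw [h2] at h1
    nlinarith
  intro t ht
  exact (hle t ht).trans (by gcongr)

/-! ### The logarithm of a Jacobian determinant -/

/-- The squared Frobenius norm of an endomorphism of `ℝ^d`. -/
noncomputable def frobSq {d : ℕ} (A : Euc d →L[ℝ] Euc d) : ℝ :=
  ∑ i, ‖A (EuclideanSpace.basisFun (Fin d) ℝ i)‖ ^ 2

/-- The trace of an endomorphism of `ℝ^d`, in the standard basis. -/
noncomputable def trc {d : ℕ} (A : Euc d →L[ℝ] Euc d) : ℝ :=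
  ∑ i, inner ℝ (EuclideanSpace.basisFun (Fin d) ℝ i) (A (EuclideanSpace.basisFun (Fin d) ℝ i))

section LinearAlgebra

variable {d : ℕ}

theorem frobSq_nonneg (A : Euc d →L[ℝ] Euc d) : 0 ≤ frobSq A :=
  Finset.sum_nonneg fun _ _ => sq_nonneg _

theorem norm_basisFun (i : Fin d) : ‖EuclideanSpace.basisFun (Fin d) ℝ i‖ = 1 :=
  (EuclideanSpace.basisFun (Fin d) ℝ).norm_eq_one i

theorem frobSq_le (A : Euc d →L[ℝ] Euc d) : frobSq A ≤ d * ‖A‖ ^ 2 := by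
  have : ∀ i ∈ Finset.univ, ‖A (EuclideanSpace.basisFun (Fin d) ℝ i)‖ ^ 2 ≤ ‖A‖ ^ 2 := by
    intro i _
    have := A.le_opNorm (EuclideanSpace.basisFun (Fin d) ℝ i)
    rw [norm_basisFun, mul_one] at this
    gcongr
  refine (Finset.sum_le_card_nsmul _ _ _ this).trans (le_of_eq ?_)
  simp

theorem continuous_frobSq : Continuous (frobSq (d := d)) := by
  unfold frobSq; fun_prop

theorem continuous_trc : Continuous (trc (d := d)) := by
  unfold trc; fun_prop

theorem abs_trc_le (A : Euc d →L[ℝ] Euc d) : |trc A| ≤ d * ‖A‖ := by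
  have : ∀ i ∈ Finset.univ, ‖inner ℝ (EuclideanSpace.basisFun (Fin d) ℝ i)
      (A (EuclideanSpace.basisFun (Fin d) ℝ i))‖ ≤ ‖A‖ := by
    intro i _
    refine (norm_inner_le_norm _ _).trans ?_
    have := A.le_opNorm (EuclideanSpace.basisFun (Fin d) ℝ i)
    rw [norm_basisFun, mul_one] at this
    rwa [norm_basisFun, one_mul]
  rw [← Real.norm_eq_abs]
  refine (norm_sum_le _ _).trans ?_
  simpa using Finset.sum_le_card_nsmul _ _ _ this

theorem trc_eq_trace (A : Euc d →L[ℝ] Euc d) :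
    trc A = LinearMap.trace ℝ (Euc d) (A : Euc d →ₗ[ℝ] Euc d) := by
  rw [LinearMap.trace_eq_sum_inner _ (EuclideanSpace.basisFun (Fin d) ℝ)]
  rfl

theorem trc_eq_sum_inner (A : Euc d →L[ℝ] Euc d) (b : OrthonormalBasis (Fin d) ℝ (Euc d)) :
    trc A = ∑ i, inner ℝ (b i) (A (b i)) := by
  rw [trc_eq_trace, LinearMap.trace_eq_sum_inner _ b]
  rfl

theorem trc_smul (c : ℝ) (A : Euc d →L[ℝ] Euc d) : trc (c • A) = c * trc A := by
  simp [trc, inner_smul_right, Finset.mul_sum]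

theorem frobSq_smul (c : ℝ) (A : Euc d →L[ℝ] Euc d) : frobSq (c • A) = c ^ 2 * frobSq A := by
  simp [frobSq, norm_smul, mul_pow, Finset.mul_sum]

theorem frobSq_eq_sum (A : Euc d →L[ℝ] Euc d) (b : OrthonormalBasis (Fin d) ℝ (Euc d)) :
    frobSq A = ∑ i, ‖A (b i)‖ ^ 2 := by
  have h : ∀ c : OrthonormalBasis (Fin d) ℝ (Euc d),
      trc (ContinuousLinearMap.adjoint A ∘L A) = ∑ i, ‖A (c i)‖ ^ 2 := by
    intro c
    rw [trc_eq_sum_inner _ c]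
    refine Finset.sum_congr rfl fun i _ => ?_
    rw [ContinuousLinearMap.comp_apply, ContinuousLinearMap.adjoint_inner_right,
      real_inner_self_eq_norm_sq]
  rw [← h b, h (EuclideanSpace.basisFun (Fin d) ℝ)]
  rfl

/-- Singular values and right singular vectors of an endomorphism of `ℝ^d`. -/
theorem exists_orthonormalBasis_abs_det_eq_prod (A : Euc d →L[ℝ] Euc d) :
    ∃ b : OrthonormalBasis (Fin d) ℝ (Euc d), |A.det| = ∏ i, ‖A (b i)‖ := by
  let T : Euc d →ₗ[ℝ] Euc d :=
    LinearMap.adjoint (A : Euc d →ₗ[ℝ] Euc d) ∘ₗ (A : Euc d →ₗ[ℝ] Euc d)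
  have hT : T.IsSymmetric := LinearMap.isSymmetric_adjoint_mul_self _
  have hn : Module.finrank ℝ (Euc d) = d := by simp
  refine ⟨hT.eigenvectorBasis hn, ?_⟩
  have hσ : ∀ i, hT.eigenvalues hn i = ‖A (hT.eigenvectorBasis hn i)‖ ^ 2 := by
    intro i
    have h1 : inner ℝ (hT.eigenvectorBasis hn i) (T (hT.eigenvectorBasis hn i))
        = ‖A (hT.eigenvectorBasis hn i)‖ ^ 2 := by
      simp only [T, LinearMap.comp_apply, LinearMap.adjoint_inner_right]
      exact real_inner_self_eq_norm_sq _
    rw [hT.apply_eigenvectorBasis hn i, inner_smul_right, real_inner_self_eq_norm_sq,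
      (hT.eigenvectorBasis hn).norm_eq_one] at h1
    simpa using h1
  have hdet : A.det ^ 2 = (∏ i, ‖A (hT.eigenvectorBasis hn i)‖) ^ 2 := by
    have h2 := hT.det_eq_prod_eigenvalues hn
    simp only [hσ] at h2
    rw [← Finset.prod_pow]
    have h3 : LinearMap.det T = A.det ^ 2 := by
      have h4 := (A : Euc d →ₗ[ℝ] Euc d).normDet_sq
      rw [LinearMap.normDet_eq_abs_det, sq_abs] at h4
      exact h4.symm
    rw [← h3, h2]
    simp
  have hpos := Finset.prod_nonneg (s := Finset.univ)
    fun i _ => norm_nonneg (A (hT.eigenvectorBasis hn i))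
  rw [← abs_of_nonneg hpos]
  exact (sq_eq_sq_iff_abs_eq_abs _ _).1 hdet

theorem sub_one_sub_log_le {σ κ : ℝ} (hκ : 0 < κ) (hκ1 : κ ≤ 1) (hσ : κ ≤ σ) :
    σ - 1 - Real.log σ ≤ 2 * (σ - 1) ^ 2 + -Real.log κ * min 1 (4 * (σ - 1) ^ 2) := by
  have hσ0 : 0 < σ := hκ.trans_le hσ
  have hlκ : 0 ≤ -Real.log κ := by
    have := Real.log_nonpos hκ.le hκ1; linarith
  rcases le_total (1 / 2) σ with h | h
  · have h1 := Real.one_sub_inv_le_log_of_pos hσ0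
    have h2 : σ - 1 - (1 - σ⁻¹) ≤ 2 * (σ - 1) ^ 2 := by
      have : σ - 1 - (1 - σ⁻¹) = (σ - 1) ^ 2 * σ⁻¹ := by field_simp
      rw [this, mul_comm 2]
      gcongr
      rw [inv_le_comm₀ hσ0 two_pos]
      simpa using h
    have : 0 ≤ -Real.log κ * min 1 (4 * (σ - 1) ^ 2) := by positivity
    linarith
  · have h1 : Real.log κ ≤ Real.log σ := Real.log_le_log hκ hσ
    have h2 : min 1 (4 * (σ - 1) ^ 2) = 1 := min_eq_left (by nlinarith)
    rw [h2]
    nlinarith [sq_nonneg (σ - 1)]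

/-- If all singular values of `A` are at least `κ`, then `log |det A|` is at least `tr (A - 1)` up
to a quadratic error. Indeed `tr A` is at most the sum of the singular values `σ`, and
`∑ (σ - 1) ^ 2` is at most the squared Frobenius norm of `A - 1`. Singular values below `1 / 2`
cost up to `-log κ` each, and there are at most `d` and at most `4 ‖A - 1‖²` of them. -/
theorem trc_sub_log_abs_det_le (A : Euc d →L[ℝ] Euc d) {κ : ℝ} (hκ : 0 < κ) (hκ1 : κ ≤ 1)
    (hA : ∀ v, κ * ‖v‖ ≤ ‖A v‖) :
    trc (A - 1) - Real.log |A.det|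
      ≤ 2 * frobSq (A - 1) + -Real.log κ * min (d : ℝ) (4 * frobSq (A - 1)) := by
  obtain ⟨b, hb⟩ := exists_orthonormalBasis_abs_det_eq_prod A
  have hlκ : 0 ≤ -Real.log κ := by
    have := Real.log_nonpos hκ.le hκ1; linarith
  have hσ : ∀ i, κ ≤ ‖A (b i)‖ := fun i => by simpa using hA (b i)
  have hlog : Real.log |A.det| = ∑ i, Real.log ‖A (b i)‖ := by
    rw [hb, Real.log_prod]
    exact fun i _ => (hκ.trans_le (hσ i)).ne'
  have htr : trc (A - 1) ≤ ∑ i, (‖A (b i)‖ - 1) := by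
    rw [trc_eq_sum_inner _ b]
    refine Finset.sum_le_sum fun i _ => ?_
    have h1 : inner ℝ (b i) ((A - 1) (b i)) = inner ℝ (b i) (A (b i)) - 1 := by
      simp [inner_sub_right]
    have h2 : inner ℝ (b i) (A (b i)) ≤ ‖A (b i)‖ := by
      simpa using real_inner_le_norm (b i) (A (b i))
    linarith
  have hfrob : ∑ i, (‖A (b i)‖ - 1) ^ 2 ≤ frobSq (A - 1) := by
    rw [frobSq_eq_sum _ b]
    refine Finset.sum_le_sum fun i _ => ?_
    have h1 := abs_norm_sub_norm_le (A (b i)) (b i)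
    rw [b.norm_eq_one] at h1
    have h2 : (A - 1) (b i) = A (b i) - b i := by simp
    rw [h2, ← sq_abs]
    gcongr
  have hmin : ∑ i, min 1 (4 * (‖A (b i)‖ - 1) ^ 2) ≤ min (d : ℝ) (4 * frobSq (A - 1)) := by
    refine le_min ?_ ?_
    · refine (Finset.sum_le_sum fun i _ => min_le_left _ _).trans ?_
      simp
    · refine (Finset.sum_le_sum fun i _ => min_le_right _ _).trans ?_
      rw [← Finset.mul_sum]
      gcongr
  calc trc (A - 1) - Real.log |A.det|
      ≤ ∑ i, (‖A (b i)‖ - 1 - Real.log ‖A (b i)‖) := by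
        rw [hlog, Finset.sum_sub_distrib]; gcongr
    _ ≤ ∑ i, (2 * (‖A (b i)‖ - 1) ^ 2
        + -Real.log κ * min 1 (4 * (‖A (b i)‖ - 1) ^ 2)) :=
        Finset.sum_le_sum fun i _ => sub_one_sub_log_le hκ hκ1 (hσ i)
    _ = 2 * ∑ i, (‖A (b i)‖ - 1) ^ 2
        + -Real.log κ * ∑ i, min 1 (4 * (‖A (b i)‖ - 1) ^ 2) := by
        rw [Finset.sum_add_distrib, ← Finset.mul_sum, ← Finset.mul_sum]
    _ ≤ _ := by gcongr

theorem trc_sub_five_mul_frobSq_le (N : Euc d →L[ℝ] Euc d) (hN : ‖N‖ ≤ 1 / 2) :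
    trc N - 5 * frobSq N ≤ Real.log |(1 + N).det| := by
  have h := trc_sub_log_abs_det_le (1 + N) (κ := 1 / 2) (by norm_num) (by norm_num) (fun v => by
    have h1 : ‖N v‖ ≤ 1 / 2 * ‖v‖ := (N.le_opNorm v).trans (by gcongr)
    have h2 := norm_sub_le (v + N v) (N v)
    rw [add_sub_cancel_right] at h2
    have h3 : (1 + N) v = v + N v := by simp
    rw [h3]
    linarith)
  rw [add_sub_cancel_left] at h
  have hl : -Real.log (1 / 2) ≤ 3 / 4 := by
    rw [one_div, Real.log_inv, neg_neg]; linarith [Real.log_two_lt_d9]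
  have h4 : -Real.log (1 / 2) * min (d : ℝ) (4 * frobSq N) ≤ 3 / 4 * (4 * frobSq N) := by
    have := frobSq_nonneg N
    exact mul_le_mul hl (min_le_right _ _) (by positivity) (by norm_num)
  linarith

theorem det_ne_zero_of_le (A : Euc d →L[ℝ] Euc d) {κ : ℝ} (hκ : 0 < κ)
    (hA : ∀ v, κ * ‖v‖ ≤ ‖A v‖) : A.det ≠ 0 := by
  obtain ⟨b, hb⟩ := exists_orthonormalBasis_abs_det_eq_prod A
  have : 0 < |A.det| := by
    rw [hb]
    exact Finset.prod_pos fun i _ => hκ.trans_le (by simpa using hA (b i))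
  exact abs_pos.1 this

/-- Two-sided bounds on the singular values bound `log |det A|`. -/
theorem abs_log_abs_det_le (A : Euc d →L[ℝ] Euc d) {κ a : ℝ} (hκ : 0 < κ)
    (hA : ∀ v, κ * ‖v‖ ≤ ‖A v‖) (ha : ‖A‖ ≤ a) :
    abs (Real.log (abs A.det)) ≤ d * (|Real.log κ| + |Real.log a|) := by
  obtain ⟨b, hb⟩ := exists_orthonormalBasis_abs_det_eq_prod A
  have hσ : ∀ i, κ ≤ ‖A (b i)‖ := fun i => by simpa using hA (b i)
  rw [hb, Real.log_prod fun i _ => (hκ.trans_le (hσ i)).ne', ← Real.norm_eq_abs]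
  refine (norm_sum_le _ _).trans ?_
  have : ∀ i ∈ Finset.univ, ‖Real.log ‖A (b i)‖‖ ≤ |Real.log κ| + |Real.log a| := by
    intro i _
    have h1 := Real.log_le_log hκ (hσ i)
    have h2 : ‖A (b i)‖ ≤ a := by
      have := A.le_opNorm (b i)
      rw [b.norm_eq_one, mul_one] at this
      exact this.trans ha
    have h3 := Real.log_le_log (hκ.trans_le (hσ i)) h2
    rw [Real.norm_eq_abs, abs_le]
    constructor
    · linarith [neg_abs_le (Real.log κ), abs_nonneg (Real.log a)]
    · linarith [le_abs_self (Real.log a), abs_nonneg (Real.log κ)]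
  refine (Finset.sum_le_card_nsmul _ _ _ this).trans (le_of_eq ?_)
  rw [Finset.card_univ, Fintype.card_fin, nsmul_eq_mul]

end LinearAlgebra

/-! ### Probability densities with a Lipschitz score -/

/-- `p` is a positive differentiable density of the measure `ν`, and `∇ log p` is
`ℓ`-Lipschitz. -/
structure IsLogSmoothDensity {d : ℕ} (ν : Measure (Euc d)) (p : Euc d → ℝ) (ℓ : ℝ) : Prop where
  pos : ∀ x, 0 < p x
  differentiable : Differentiable ℝ p
  eq_withDensity : ν = volume.withDensity (fun x => ENNReal.ofReal (p x))
  nonneg : 0 ≤ ℓ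
  norm_gradient_sub_le : ∀ x y, ‖gradient (fun z => Real.log (p z)) x - gradient (fun z => Real.log (p z)) y‖
    ≤ ℓ * ‖x - y‖

/-- The score `∇ log p` of the density `p`. -/
noncomputable def score {d : ℕ} (p : Euc d → ℝ) (x : Euc d) : Euc d :=
  gradient (fun z => Real.log (p z)) x

theorem HasLipschitzScore.exists_isLogSmoothDensity {d : ℕ} {ν : Measure (Euc d)} {ℓ : ℝ}
    (hℓ : 0 ≤ ℓ) (h : HasLipschitzScore ν ℓ.toNNReal) : ∃ p, IsLogSmoothDensity ν p ℓ := by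
  obtain ⟨p, hpos, hd, hν, hl⟩ := h
  refine ⟨p, hpos, hd, hν, hℓ, fun x y => ?_⟩
  have := hl.norm_sub_le x y
  rwa [Real.coe_toNNReal ℓ hℓ] at this

namespace IsLogSmoothDensity

variable {d : ℕ} {ν : Measure (Euc d)} {p : Euc d → ℝ} {ℓ : ℝ}

theorem hasFDerivAt_log (h : IsLogSmoothDensity ν p ℓ) (x : Euc d) :
    HasFDerivAt (fun z => Real.log (p z)) (innerSL ℝ (score p x)) x := by
  have : DifferentiableAt ℝ (fun z => Real.log (p z)) x := (h.differentiable x).log (h.pos x).ne'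
  exact this.hasGradientAt.hasFDerivAt

theorem hasFDerivAt (h : IsLogSmoothDensity ν p ℓ) (x : Euc d) :
    HasFDerivAt p (p x • innerSL ℝ (score p x)) x := by
  have := (h.hasFDerivAt_log x).exp
  simpa only [Real.exp_log (h.pos _)] using this

theorem continuous (h : IsLogSmoothDensity ν p ℓ) : Continuous p := h.differentiable.continuous

theorem continuous_score (h : IsLogSmoothDensity ν p ℓ) : Continuous (score p) :=
  (LipschitzWith.of_dist_le_mul (K := ℓ.toNNReal) fun x y => by
    rw [dist_eq_norm, dist_eq_norm, Real.coe_toNNReal ℓ h.nonneg]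
    exact h.norm_gradient_sub_le x y).continuous

/-- First-order Taylor expansion of `log p`. -/
theorem abs_log_sub_le (h : IsLogSmoothDensity ν p ℓ) (x v : Euc d) :
    |Real.log (p (x + v)) - Real.log (p x) - inner ℝ (score p x) v| ≤ ℓ * ‖v‖ ^ 2 := by
  let φ : Euc d → ℝ := fun z => Real.log (p z) - innerSL ℝ (score p x) z
  have hφ : ∀ z, HasFDerivAt φ (innerSL ℝ (score p z) - innerSL ℝ (score p x)) z := fun z =>
    (h.hasFDerivAt_log z).sub (innerSL ℝ (score p x)).hasFDerivAt
  have key : ‖φ (x + v) - φ x‖ ≤ (ℓ * ‖v‖) * ‖x + v - x‖ := by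
    refine Convex.norm_image_sub_le_of_norm_hasFDerivWithin_le (s := Metric.closedBall x ‖v‖)
      (f' := fun z => innerSL ℝ (score p z) - innerSL ℝ (score p x))
      (fun z _ => (hφ z).hasFDerivWithinAt) (fun z hz => ?_) (convex_closedBall _ _)
      (by simp) (by simp)
    rw [← map_sub, innerSL_apply_norm]
    refine (h.norm_gradient_sub_le z x).trans ?_
    have := h.nonneg
    gcongr
    simpa [dist_eq_norm] using hz
  rw [add_sub_cancel_left, Real.norm_eq_abs] at key
  have e : φ (x + v) - φ x
      = Real.log (p (x + v)) - Real.log (p x) - inner ℝ (score p x) v := by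
    simp only [φ, innerSL_apply_apply, inner_add_right]
    ring
  rw [e] at key
  linarith [key, show ℓ * ‖v‖ * ‖v‖ = ℓ * ‖v‖ ^ 2 by ring]

theorem mul_exp_le (h : IsLogSmoothDensity ν p ℓ) (x v : Euc d) :
    p x * Real.exp (inner ℝ (score p x) v - ℓ * ‖v‖ ^ 2) ≤ p (x + v) := by
  have h1 := (abs_le.1 (h.abs_log_sub_le x v)).1
  calc p x * Real.exp (inner ℝ (score p x) v - ℓ * ‖v‖ ^ 2)
      = Real.exp (Real.log (p x) + (inner ℝ (score p x) v - ℓ * ‖v‖ ^ 2)) := by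
        rw [Real.exp_add, Real.exp_log (h.pos x)]
    _ ≤ Real.exp (Real.log (p (x + v))) := by gcongr; linarith
    _ = _ := Real.exp_log (h.pos _)

theorem lintegral_eq (h : IsLogSmoothDensity ν p ℓ) (f : Euc d → ℝ≥0∞) :
    ∫⁻ x, f x ∂ν = ∫⁻ x, ENNReal.ofReal (p x) * f x := by
  rw [h.eq_withDensity, lintegral_withDensity_eq_lintegral_mul_non_measurable]
  · rfl
  · exact h.continuous.measurable.ennreal_ofReal
  · exact Filter.Eventually.of_forall fun x => ENNReal.ofReal_lt_top

theorem integrable_iff (h : IsLogSmoothDensity ν p ℓ) {f : Euc d → ℝ} :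
    Integrable f ν ↔ Integrable (fun x => p x * f x) := by
  rw [h.eq_withDensity, integrable_withDensity_iff_integrable_smul']
  · simp only [ENNReal.toReal_ofReal (h.pos _).le, smul_eq_mul]
  · exact h.continuous.measurable.ennreal_ofReal
  · exact Filter.Eventually.of_forall fun x => ENNReal.ofReal_lt_top

theorem integral_eq (h : IsLogSmoothDensity ν p ℓ) (f : Euc d → ℝ) :
    ∫ x, f x ∂ν = ∫ x, p x * f x := by
  rw [h.eq_withDensity, integral_withDensity_eq_integral_toReal_smul]
  · simp only [ENNReal.toReal_ofReal (h.pos _).le, smul_eq_mul]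
  · exact h.continuous.measurable.ennreal_ofReal
  · exact Filter.Eventually.of_forall fun x => ENNReal.ofReal_lt_top

theorem isOpenPosMeasure (h : IsLogSmoothDensity ν p ℓ) : ν.IsOpenPosMeasure := by
  have hac : (volume : Measure (Euc d)) ≪ ν := by
    rw [h.eq_withDensity]
    refine withDensity_absolutelyContinuous' h.continuous.measurable.ennreal_ofReal.aemeasurable ?_
    exact Filter.Eventually.of_forall fun x => (ENNReal.ofReal_pos.2 (h.pos x)).ne'
  exact hac.isOpenPosMeasure

/-- The score is subgaussian: compare `p` with its translate by `v`. -/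
theorem lintegral_exp_inner_score_le [IsProbabilityMeasure ν] (h : IsLogSmoothDensity ν p ℓ)
    (v : Euc d) : ∫⁻ x, ENNReal.ofReal (Real.exp (inner ℝ (score p x) v - ℓ * ‖v‖ ^ 2)) ∂ν ≤ 1 := by
  have h1 : ∫⁻ x, ENNReal.ofReal (p x) = 1 := by
    have := h.lintegral_eq (fun _ => 1)
    simpa using this.symm
  rw [h.lintegral_eq, ← h1, ← lintegral_add_right_eq_self (fun x => ENNReal.ofReal (p x)) v]
  refine lintegral_mono fun x => ?_
  rw [← ENNReal.ofReal_mul (h.pos x).le]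
  exact ENNReal.ofReal_le_ofReal (h.mul_exp_le x v)

theorem integrable_exp_inner_score [IsProbabilityMeasure ν] (h : IsLogSmoothDensity ν p ℓ)
    (v : Euc d) : Integrable (fun x => Real.exp (inner ℝ (score p x) v)) ν := by
  have hc := h.continuous_score
  have h1 : Integrable (fun x => Real.exp (inner ℝ (score p x) v - ℓ * ‖v‖ ^ 2)) ν := by
    refine ⟨Continuous.aestronglyMeasurable (by fun_prop), ?_⟩
    rw [hasFiniteIntegral_iff_ofReal (Filter.Eventually.of_forall fun x => (Real.exp_pos _).le)]
    exact (h.lintegral_exp_inner_score_le v).trans_lt ENNReal.one_lt_top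
  refine (h1.mul_const (Real.exp (ℓ * ‖v‖ ^ 2))).congr (Filter.Eventually.of_forall fun x => ?_)
  simp only
  rw [← Real.exp_add, sub_add_cancel]

theorem memLp_score [IsProbabilityMeasure ν] (h : IsLogSmoothDensity ν p ℓ) (q : ℝ≥0) :
    MemLp (score p) q ν := by
  have hi : ∀ v : Euc d, MemLp (fun x => inner ℝ (score p x) v) q ν := by
    intro v
    refine ProbabilityTheory.memLp_of_mem_interior_integrableExpSet ?_ q
    have : ProbabilityTheory.integrableExpSet (fun x => inner ℝ (score p x) v) ν = univ := by
      refine eq_univ_of_forall fun t => ?_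
      change Integrable (fun x => Real.exp (t * inner ℝ (score p x) v)) ν
      have := h.integrable_exp_inner_score (t • v)
      simpa only [inner_smul_right] using this
    rw [this, interior_univ]
    exact mem_univ _
  have e : score p = fun x => ∑ i, inner ℝ (score p x) (EuclideanSpace.basisFun (Fin d) ℝ i) •
      EuclideanSpace.basisFun (Fin d) ℝ i := by
    funext x
    conv_lhs => rw [← (EuclideanSpace.basisFun (Fin d) ℝ).sum_repr' (score p x)]
    simp only [real_inner_comm]
  rw [e]
  exact memLp_finsetSum _ fun i _ =>
    (ContinuousLinearMap.toSpanSingleton ℝ (EuclideanSpace.basisFun (Fin d) ℝ i)).comp_memLp' (hi _)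

/-- Integration by parts against a density with Lipschitz score. -/
theorem integral_fderiv_eq (h : IsLogSmoothDensity ν p ℓ) {u : Euc d → ℝ} (v : Euc d)
    (hu : Differentiable ℝ u) (hi : Integrable u ν) (hi' : Integrable (fun x => fderiv ℝ u x v) ν)
    (his : Integrable (fun x => u x * inner ℝ (score p x) v) ν) :
    ∫ x, fderiv ℝ u x v ∂ν = -∫ x, u x * inner ℝ (score p x) v ∂ν := by
  have hp : ∀ x, fderiv ℝ p x v = p x * inner ℝ (score p x) v := fun x => by
    rw [(h.hasFDerivAt x).fderiv]; simp
  rw [h.integral_eq, h.integral_eq]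
  rw [h.integrable_iff] at hi hi' his
  have e : ∀ x, p x * (u x * inner ℝ (score p x) v) = fderiv ℝ p x v * u x := fun x => by
    rw [hp]; ring
  simp only [e] at his ⊢
  exact integral_mul_fderiv_eq_neg_fderiv_mul_of_integrable his hi' hi
    (fun x _ => h.differentiable x) (fun x _ => hu x)

end IsLogSmoothDensity

/-! ### The divergence with respect to a density -/

theorem Real.one_add_add_sq_sub_cube_le_exp (z : ℝ) : 1 + z + z ^ 2 / 2 - |z| ^ 3 ≤ Real.exp z := by
  rcases le_total 0 z with h | h
  · have := Real.quadratic_le_exp_of_nonneg h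
    have h3 : 0 ≤ |z| ^ 3 := by positivity
    linarith
  rcases le_total (-1) z with h1 | h1
  · have := Real.exp_bound (x := z) (abs_le.2 ⟨h1, by linarith⟩) (n := 3) (by norm_num)
    have h2 := (abs_le.1 this).1
    simp [Finset.sum_range_succ, Nat.factorial] at h2
    have h3 : 0 ≤ |z| ^ 3 := by positivity
    linarith
  · have h2 := Real.exp_pos z
    rw [abs_of_nonpos h]
    nlinarith [sq_nonneg z, mul_nonneg (sq_nonneg z) (by linarith : 0 ≤ -z - 1)]

namespace IsLogSmoothDensity

variable {d : ℕ} {ν : Measure (Euc d)} {p : Euc d → ℝ} {ℓ : ℝ}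

/-- The divergence theorem: `div a + ⟨∇ log p, a⟩` has mean zero. -/
theorem integral_trc_fderiv_eq [IsProbabilityMeasure ν] (h : IsLogSmoothDensity ν p ℓ)
    {a : Euc d → Euc d} (ha : Differentiable ℝ a) (ha2 : MemLp a 2 ν)
    (hi : ∀ i, Integrable (fun x => inner ℝ (EuclideanSpace.basisFun (Fin d) ℝ i)
      (fderiv ℝ a x (EuclideanSpace.basisFun (Fin d) ℝ i))) ν) :
    ∫ x, trc (fderiv ℝ a x) ∂ν = -∫ x, inner ℝ (score p x) (a x) ∂ν := by
  set e := EuclideanSpace.basisFun (Fin d) ℝ with he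
  have hs2 : MemLp (score p) 2 ν := h.memLp_score 2
  have hai : ∀ i, MemLp (fun x => inner ℝ (e i) (a x)) 2 ν := fun i =>
    (innerSL ℝ (e i)).comp_memLp' ha2
  have hsi : ∀ i, MemLp (fun x => inner ℝ (score p x) (e i)) 2 ν := fun i => by
    have := (innerSL ℝ (e i)).comp_memLp' hs2
    simpa only [Function.comp_def, innerSL_apply_apply, real_inner_comm] using this
  have hprod : ∀ i, Integrable (fun x => inner ℝ (e i) (a x) * inner ℝ (score p x) (e i)) ν :=
    fun i => (hai i).integrable_mul (hsi i)
  have hd : ∀ i x, HasFDerivAt (fun x => inner ℝ (e i) (a x))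
      ((innerSL ℝ (e i)).comp (fderiv ℝ a x)) x := fun i x =>
    (innerSL ℝ (e i)).hasFDerivAt.comp x (ha x).hasFDerivAt
  have hparts : ∀ i, ∫ x, inner ℝ (e i) (fderiv ℝ a x (e i)) ∂ν
      = -∫ x, inner ℝ (e i) (a x) * inner ℝ (score p x) (e i) ∂ν := by
    intro i
    have hf : ∀ x, fderiv ℝ (fun x => inner ℝ (e i) (a x)) x (e i)
        = inner ℝ (e i) (fderiv ℝ a x (e i)) := fun x => by
      rw [(hd i x).fderiv]; rfl
    have := h.integral_fderiv_eq (u := fun x => inner ℝ (e i) (a x)) (e i)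
      (fun x => (hd i x).differentiableAt) ((hai i).integrable (by norm_num))
      (by simpa only [hf] using hi i) (hprod i)
    simpa only [hf] using this
  have hsum : ∀ x, inner ℝ (score p x) (a x)
      = ∑ i, inner ℝ (e i) (a x) * inner ℝ (score p x) (e i) := fun x => by
    rw [← e.sum_inner_mul_inner (score p x) (a x)]
    exact Finset.sum_congr rfl fun i _ => mul_comm _ _
  simp only [hsum]
  unfold trc
  rw [integral_finsetSum _ (fun i _ => hi i), integral_finsetSum _ (fun i _ => hprod i),
    ← Finset.sum_neg_distrib]
  exact Finset.sum_congr rfl fun i _ => hparts i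

/-- Integration by parts of the product of a function and a vector field. -/
theorem integral_fderiv_apply_eq [IsProbabilityMeasure ν] (h : IsLogSmoothDensity ν p ℓ)
    {g : Euc d → ℝ} {a : Euc d → Euc d} {A B C : ℝ} (hg : Differentiable ℝ g) (hg2 : MemLp g 2 ν)
    (hgc : Continuous (fderiv ℝ g)) (hgC : ∀ x, ‖fderiv ℝ g x‖ ≤ C) (ha : Differentiable ℝ a)
    (haA : ∀ x, ‖a x‖ ≤ A) (hac : Continuous (fderiv ℝ a)) (haB : ∀ x, ‖fderiv ℝ a x‖ ≤ B) :
    ∫ x, fderiv ℝ g x (a x) ∂ν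
      = -∫ x, g x * (trc (fderiv ℝ a x) + inner ℝ (score p x) (a x)) ∂ν := by
  set e := EuclideanSpace.basisFun (Fin d) ℝ with he
  have hac0 := ha.continuous
  have hgc0 := hg.continuous
  have hsc := h.continuous_score
  have haf : MemLp a ∞ ν := memLp_top_of_bound hac0.aestronglyMeasurable A
    (Filter.Eventually.of_forall haA)
  have hg1 : Integrable g ν := hg2.integrable (by norm_num)
  have hb2 : MemLp (fun x => g x • a x) 2 ν := haf.smul hg2
  have hd : ∀ x, HasFDerivAt (fun x => g x • a x)
      (g x • fderiv ℝ a x + (fderiv ℝ g x).smulRight (a x)) x := fun x =>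
    (hg x).hasFDerivAt.smul (ha x).hasFDerivAt
  have hda : Integrable (fun x => fderiv ℝ g x (a x)) ν := by
    refine Integrable.of_bound (C := C * A) (by fun_prop) (Filter.Eventually.of_forall fun x => ?_)
    refine ((fderiv ℝ g x).le_opNorm _).trans ?_
    exact mul_le_mul (hgC x) (haA x) (norm_nonneg _) ((norm_nonneg _).trans (hgC x))
  have htr : Integrable (fun x => g x * trc (fderiv ℝ a x)) ν := by
    refine hg1.mul_bdd (c := d * B) (continuous_trc.comp hac).aestronglyMeasurable
      (Filter.Eventually.of_forall fun x => ?_)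
    exact (abs_trc_le _).trans (by gcongr; exact haB x)
  have htrc : ∀ x, trc (fderiv ℝ (fun x => g x • a x) x)
      = g x * trc (fderiv ℝ a x) + fderiv ℝ g x (a x) := by
    intro x
    rw [(hd x).fderiv]
    have h2 : trc ((fderiv ℝ g x).smulRight (a x)) = fderiv ℝ g x (a x) := by
      have h3 : ∑ i, inner ℝ (e i) (a x) • e i = a x := e.sum_repr' (a x)
      conv_rhs => rw [← h3, map_sum]
      simp only [trc, ContinuousLinearMap.smulRight_apply, inner_smul_right, map_smul,
        smul_eq_mul, ← he]
      exact Finset.sum_congr rfl fun i _ => mul_comm _ _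
    rw [← h2, ← trc_smul]
    simp [trc, inner_add_right, Finset.sum_add_distrib]
  have hmain := h.integral_trc_fderiv_eq (a := fun x => g x • a x)
    (fun x => (hd x).differentiableAt) hb2 (fun i => by
      have hfe : ∀ x, inner ℝ (e i) (fderiv ℝ (fun x => g x • a x) x (e i))
          = g x * inner ℝ (e i) (fderiv ℝ a x (e i))
            + fderiv ℝ g x (e i) * inner ℝ (e i) (a x) := fun x => by
        rw [(hd x).fderiv]
        simp [inner_add_right, inner_smul_right]
      simp only [← he, hfe]
      refine Integrable.add ?_ ?_
      · refine hg1.mul_bdd (c := B) (by fun_prop) (Filter.Eventually.of_forall fun x => ?_)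
        refine (norm_inner_le_norm _ _).trans ?_
        have := (fderiv ℝ a x).le_opNorm (e i)
        rw [e.norm_eq_one, mul_one] at this
        rw [e.norm_eq_one, one_mul]
        exact this.trans (haB x)
      · refine Integrable.of_bound (C := C * A) (by fun_prop)
          (Filter.Eventually.of_forall fun x => ?_)
        rw [norm_mul]
        have h1 := (fderiv ℝ g x).le_opNorm (e i)
        rw [e.norm_eq_one, mul_one] at h1
        have h2 := norm_inner_le_norm (𝕜 := ℝ) (e i) (a x)
        rw [e.norm_eq_one, one_mul] at h2
        exact mul_le_mul (h1.trans (hgC x)) (h2.trans (haA x)) (norm_nonneg _)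
          ((norm_nonneg _).trans (hgC x)))
  simp only [htrc] at hmain
  have hgs : Integrable (fun x => g x * inner ℝ (score p x) (a x)) ν := by
    have h1 : Integrable (fun x => g x * ‖score p x‖) ν := by
      have hs2 : MemLp (score p) 2 ν := h.memLp_score 2
      exact hg2.integrable_mul hs2.norm
    refine (h1.norm.mul_const A).mono' (by fun_prop) (Filter.Eventually.of_forall fun x => ?_)
    rw [norm_mul, norm_mul, norm_norm, mul_assoc]
    gcongr
    exact (norm_inner_le_norm _ _).trans (by gcongr; exact haA x)
  rw [integral_add htr hda] at hmain
  simp only [mul_add]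
  rw [integral_add htr hgs]
  simp only [inner_smul_right] at hmain
  linarith

/-- The mass transported by `x ↦ x + ε a(x)` is at most one. -/
theorem lintegral_exp_divergence_le [IsProbabilityMeasure ν] (h : IsLogSmoothDensity ν p ℓ)
    {a : Euc d → Euc d} {B ε : ℝ} (ha : Differentiable ℝ a) (haB : ∀ x, ‖fderiv ℝ a x‖ ≤ B)
    (hε : 0 ≤ ε) (hεB : ε * B ≤ 1 / 2) :
    ∫⁻ x, ENNReal.ofReal (Real.exp (ε * (trc (fderiv ℝ a x) + inner ℝ (score p x) (a x))
      - ε ^ 2 * (ℓ * ‖a x‖ ^ 2 + 5 * frobSq (fderiv ℝ a x)))) ∂ν ≤ 1 := by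
  have h1 : ∫⁻ x, ENNReal.ofReal (p x) = 1 := by
    have := h.lintegral_eq (fun _ => 1)
    simpa using this.symm
  have hd : ∀ x, HasFDerivAt (fun x => x + ε • a x) (1 + ε • fderiv ℝ a x) x := fun x =>
    (hasFDerivAt_id x).add ((ha x).hasFDerivAt.const_smul ε)
  have hinj : Function.Injective (fun x => x + ε • a x) := by
    intro x y hxy
    have hl : ‖a x - a y‖ ≤ B * ‖x - y‖ :=
      Convex.norm_image_sub_le_of_norm_fderiv_le (s := univ) (fun z _ => ha z)
        (fun z _ => haB z) convex_univ (mem_univ _) (mem_univ _)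
    have e : x - y = -(ε • (a x - a y)) := by
      simp only at hxy
      rw [smul_sub, neg_sub, sub_eq_sub_iff_add_eq_add, hxy, add_comm]
    have h2 : ‖x - y‖ = ε * ‖a x - a y‖ := by
      conv_lhs => rw [e]
      rw [norm_neg, norm_smul, Real.norm_of_nonneg hε]
    have h3 : ‖x - y‖ ≤ 1 / 2 * ‖x - y‖ := by
      calc ‖x - y‖ = ε * ‖a x - a y‖ := h2
        _ ≤ ε * (B * ‖x - y‖) := by gcongr
        _ = (ε * B) * ‖x - y‖ := by ring
        _ ≤ _ := by gcongr
    have : ‖x - y‖ = 0 := by linarith [norm_nonneg (x - y)]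
    exact sub_eq_zero.1 (norm_eq_zero.1 this)
  rw [h.lintegral_eq, ← h1]
  have hcv := lintegral_image_eq_lintegral_abs_det_fderiv_mul volume MeasurableSet.univ
    (fun x _ => (hd x).hasFDerivWithinAt) hinj.injOn (fun x => ENNReal.ofReal (p x))
  rw [Measure.restrict_univ] at hcv
  calc _ ≤ ∫⁻ x, ENNReal.ofReal |(1 + ε • fderiv ℝ a x).det| * ENNReal.ofReal (p (x + ε • a x)) := by
        refine lintegral_mono fun x => ?_
        rw [← ENNReal.ofReal_mul (h.pos x).le, ← ENNReal.ofReal_mul (abs_nonneg _)]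
        refine ENNReal.ofReal_le_ofReal ?_
        have h2 := h.mul_exp_le x (ε • a x)
        rw [inner_smul_right, norm_smul, Real.norm_of_nonneg hε] at h2
        have hN : ‖ε • fderiv ℝ a x‖ ≤ 1 / 2 := by
          rw [norm_smul, Real.norm_of_nonneg hε]
          exact (mul_le_mul_of_nonneg_left (haB x) hε).trans hεB
        have h3 := trc_sub_five_mul_frobSq_le (ε • fderiv ℝ a x) hN
        rw [trc_smul, frobSq_smul] at h3
        have hdet : 0 < |(1 + ε • fderiv ℝ a x).det| := by
          refine abs_pos.2 (det_ne_zero_of_le _ (κ := 1 / 2) (by norm_num) fun v => ?_)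
          have h1 : ‖(ε • fderiv ℝ a x) v‖ ≤ 1 / 2 * ‖v‖ :=
            (ContinuousLinearMap.le_opNorm _ v).trans (by gcongr)
          have h2 := norm_sub_le (v + (ε • fderiv ℝ a x) v) ((ε • fderiv ℝ a x) v)
          rw [add_sub_cancel_right] at h2
          have h3 : (1 + ε • fderiv ℝ a x) v = v + (ε • fderiv ℝ a x) v := by simp
          rw [h3]
          linarith
        rw [Real.le_log_iff_exp_le hdet] at h3
        calc _ = Real.exp (ε * trc (fderiv ℝ a x) - 5 * (ε ^ 2 * frobSq (fderiv ℝ a x)))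
              * (p x * Real.exp (ε * inner ℝ (score p x) (a x) - ℓ * (ε * ‖a x‖) ^ 2)) := by
              rw [mul_left_comm, ← Real.exp_add]
              ring_nf
          _ ≤ _ := mul_le_mul h3 h2 (by have := h.pos x; positivity) (abs_nonneg _)
    _ = ∫⁻ x in (fun x => x + ε • a x) '' univ, ENNReal.ofReal (p x) := hcv.symm
    _ ≤ _ := setLIntegral_le_lintegral _ _

/-- A weak form of Bochner's inequality. The mass transported by `x ↦ x + ε a(x)` is at most `1`
for all small `ε`, and the divergence has mean zero, so the second-order term in `ε` of a lower
bound for this mass must be nonpositive. -/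
theorem integral_divergence_sq_le [IsProbabilityMeasure ν] (h : IsLogSmoothDensity ν p ℓ)
    {a : Euc d → Euc d} {A B : ℝ} (ha : Differentiable ℝ a) (haA : ∀ x, ‖a x‖ ≤ A)
    (hac : Continuous (fderiv ℝ a)) (haB : ∀ x, ‖fderiv ℝ a x‖ ≤ B) :
    ∫ x, (trc (fderiv ℝ a x) + inner ℝ (score p x) (a x)) ^ 2 ∂ν
      ≤ 2 * ∫ x, (ℓ * ‖a x‖ ^ 2 + 5 * frobSq (fderiv ℝ a x)) ∂ν := by
  have hA0 : 0 ≤ A := (norm_nonneg _).trans (haA 0)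
  have hB0 : 0 ≤ B := (norm_nonneg _).trans (haB 0)
  have hℓ := h.nonneg
  have hac0 := ha.continuous
  have hsc := h.continuous_score
  have htc := continuous_trc.comp hac
  have hfc := continuous_frobSq.comp hac
  set D : Euc d → ℝ := fun x => trc (fderiv ℝ a x) + inner ℝ (score p x) (a x) with hD
  set R : Euc d → ℝ := fun x => ℓ * ‖a x‖ ^ 2 + 5 * frobSq (fderiv ℝ a x) with hR
  have hDc : Continuous D := htc.add (by fun_prop)
  have hRc : Continuous R := (by fun_prop : Continuous fun x => ℓ * ‖a x‖ ^ 2).add (hfc.const_mul 5)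
  set R₀ : ℝ := ℓ * A ^ 2 + 5 * (d * B ^ 2) with hR₀
  have hR0 : ∀ x, 0 ≤ R x := fun x => by
    have := frobSq_nonneg (fderiv ℝ a x)
    simp only [hR]; positivity
  have hRR : ∀ x, R x ≤ R₀ := fun x => by
    have h1 := (frobSq_le (fderiv ℝ a x)).trans
      (mul_le_mul_of_nonneg_left (pow_le_pow_left₀ (norm_nonneg _) (haB x) 2) (Nat.cast_nonneg d))
    have h2 := mul_le_mul_of_nonneg_left (pow_le_pow_left₀ (norm_nonneg _) (haA x) 2) hℓ
    simp only [hR, hR₀]; linarith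
  have hR₀0 : 0 ≤ R₀ := by positivity
  have haf : MemLp a ∞ ν := memLp_top_of_bound hac0.aestronglyMeasurable A
    (Filter.Eventually.of_forall haA)
  have htf : MemLp (fun x => trc (fderiv ℝ a x)) ∞ ν :=
    memLp_top_of_bound htc.aestronglyMeasurable (d * B) (Filter.Eventually.of_forall fun x =>
      (abs_trc_le _).trans (by gcongr; exact haB x))
  have hD3 : MemLp D (3 : ℝ≥0) ν := by
    refine (htf.mono_exponent le_top).add ?_
    refine ((h.memLp_score 3).norm.const_mul A).mono (by fun_prop)
      (Filter.Eventually.of_forall fun x => ?_)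
    rw [norm_mul, norm_norm, Real.norm_of_nonneg hA0, mul_comm]
    exact (norm_inner_le_norm _ _).trans (by gcongr; exact haA x)
  have hD2 : MemLp D 2 ν := hD3.mono_exponent (by norm_cast)
  have hD1 : Integrable D ν := hD2.integrable (by norm_num)
  have hDsq : Integrable (fun x => D x ^ 2) ν := hD2.integrable_sq
  have hR1 : Integrable R ν := Integrable.of_bound hRc.aestronglyMeasurable (C := R₀)
    (Filter.Eventually.of_forall fun x => by
      rw [Real.norm_of_nonneg (hR0 x)]; exact hRR x)
  have hcube : Integrable (fun x => (|D x| + R₀) ^ 3) ν := by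
    have h1 : MemLp (fun x => |D x| + R₀) (3 : ℝ≥0) ν := hD3.norm.add (memLp_const R₀)
    have h2 := h1.integrable_norm_rpow (by norm_num) (by norm_num)
    refine h2.congr (Filter.Eventually.of_forall fun x => ?_)
    have : 0 ≤ |D x| + R₀ := by positivity
    simp only [ENNReal.coe_toReal, NNReal.coe_ofNat, Real.norm_of_nonneg this]
    norm_cast
  have hmean : ∫ x, D x ∂ν = 0 := by
    have hdiv := h.integral_trc_fderiv_eq ha (haf.mono_exponent le_top) (fun i => by
      refine Integrable.of_bound (C := B) (by fun_prop) (Filter.Eventually.of_forall fun x => ?_)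
      refine (norm_inner_le_norm _ _).trans ?_
      have := (fderiv ℝ a x).le_opNorm (EuclideanSpace.basisFun (Fin d) ℝ i)
      rw [norm_basisFun, mul_one] at this
      rw [norm_basisFun, one_mul]
      exact this.trans (haB x))
    have htr1 : Integrable (fun x => trc (fderiv ℝ a x)) ν := htf.integrable (by simp)
    have hin : Integrable (fun x => inner ℝ (score p x) (a x)) ν := by
      refine (hD1.sub htr1).congr (Filter.Eventually.of_forall fun x => ?_)
      simp [hD]
    simp only [hD]
    rw [integral_add htr1 hin, hdiv]
    ring
  -- `K` collects the third-order terms; it is finite since the score has a third moment.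
  set K : ℝ := 2 * (R₀ * ∫ x, |D x| ∂ν) + 2 * ∫ x, (|D x| + R₀) ^ 3 ∂ν with hK
  have hKε : ∀ ε : ℝ, 0 < ε → ε ≤ 1 → ε * B ≤ 1 / 2 →
      ∫ x, D x ^ 2 ∂ν ≤ 2 * ∫ x, R x ∂ν + ε * K := by
    intro ε hε hε1 hεB
    have hz := h.lintegral_exp_divergence_le ha haB hε.le hεB
    have hlow : ∀ x, 1 + (ε * D x - ε ^ 2 * R x) + ε ^ 2 / 2 * D x ^ 2 - ε ^ 3 * (R₀ * |D x|)
        - ε ^ 3 * (|D x| + R₀) ^ 3 ≤ Real.exp (ε * D x - ε ^ 2 * R x) := by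
      intro x
      have h1 := Real.one_add_add_sq_sub_cube_le_exp (ε * D x - ε ^ 2 * R x)
      have h2 : |ε * D x - ε ^ 2 * R x| ≤ ε * (|D x| + R₀) := by
        refine (abs_sub _ _).trans ?_
        rw [abs_mul, abs_mul, abs_of_pos hε, abs_of_pos (pow_pos hε 2), abs_of_nonneg (hR0 x)]
        have : ε ^ 2 * R x ≤ ε * R₀ := by
          have h3 : ε ^ 2 ≤ ε := by nlinarith
          exact mul_le_mul h3 (hRR x) (hR0 x) hε.le
        linarith
      have h3 : |ε * D x - ε ^ 2 * R x| ^ 3 ≤ ε ^ 3 * (|D x| + R₀) ^ 3 := by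
        rw [← mul_pow]
        exact pow_le_pow_left₀ (abs_nonneg _) h2 3
      have h4 : ε ^ 2 / 2 * D x ^ 2 - ε ^ 3 * (R₀ * |D x|)
          ≤ (ε * D x - ε ^ 2 * R x) ^ 2 / 2 := by
        have h5 : D x * R x ≤ R₀ * |D x| := by
          calc D x * R x ≤ |D x| * R x := mul_le_mul_of_nonneg_right (le_abs_self _) (hR0 x)
            _ ≤ |D x| * R₀ := mul_le_mul_of_nonneg_left (hRR x) (abs_nonneg _)
            _ = _ := mul_comm _ _
        have h6 := mul_le_mul_of_nonneg_left h5 (pow_pos hε 3).le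
        nlinarith [sq_nonneg (ε ^ 2 * R x)]
      linarith
    have hcontE : Continuous fun x => Real.exp (ε * D x - ε ^ 2 * R x) := by fun_prop
    have hEint : Integrable (fun x => Real.exp (ε * D x - ε ^ 2 * R x)) ν := by
      refine ⟨hcontE.aestronglyMeasurable, ?_⟩
      rw [hasFiniteIntegral_iff_ofReal (Filter.Eventually.of_forall fun x => (Real.exp_pos _).le)]
      exact hz.trans_lt ENNReal.one_lt_top
    have hE1 : ∫ x, Real.exp (ε * D x - ε ^ 2 * R x) ∂ν ≤ 1 := by
      rw [integral_eq_lintegral_of_nonneg_ae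
        (Filter.Eventually.of_forall fun x => (Real.exp_pos _).le) hcontE.aestronglyMeasurable]
      exact ENNReal.toReal_le_of_le_ofReal zero_le_one (by simpa using hz)
    have i1 : Integrable (fun x => ε * D x - ε ^ 2 * R x) ν :=
      (hD1.const_mul ε).sub (hR1.const_mul (ε ^ 2))
    have i2 : Integrable (fun x => 1 + (ε * D x - ε ^ 2 * R x)) ν := (integrable_const 1).add i1
    have i3 : Integrable (fun x => ε ^ 2 / 2 * D x ^ 2) ν := hDsq.const_mul _
    have i4 : Integrable (fun x => ε ^ 3 * (R₀ * |D x|)) ν := (hD1.abs.const_mul R₀).const_mul _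
    have i5 : Integrable (fun x => ε ^ 3 * (|D x| + R₀) ^ 3) ν := hcube.const_mul _
    have i6 : Integrable (fun x => 1 + (ε * D x - ε ^ 2 * R x) + ε ^ 2 / 2 * D x ^ 2) ν :=
      i2.add i3
    have i7 : Integrable (fun x => 1 + (ε * D x - ε ^ 2 * R x) + ε ^ 2 / 2 * D x ^ 2
        - ε ^ 3 * (R₀ * |D x|)) ν := i6.sub i4
    have hmono := (integral_mono (i7.sub i5) hEint hlow).trans hE1
    have e1 : ∫ x, (1 + (ε * D x - ε ^ 2 * R x) + ε ^ 2 / 2 * D x ^ 2 - ε ^ 3 * (R₀ * |D x|)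
        - ε ^ 3 * (|D x| + R₀) ^ 3) ∂ν = 1 + (ε * ∫ x, D x ∂ν - ε ^ 2 * ∫ x, R x ∂ν)
        + ε ^ 2 / 2 * ∫ x, D x ^ 2 ∂ν - ε ^ 3 * (R₀ * ∫ x, |D x| ∂ν)
        - ε ^ 3 * ∫ x, (|D x| + R₀) ^ 3 ∂ν := by
      rw [integral_sub i7 i5, integral_sub i6 i4, integral_add i2 i3,
        integral_add (integrable_const 1) i1, integral_sub (hD1.const_mul ε) (hR1.const_mul _)]
      simp only [integral_const_mul, integral_const, probReal_univ, smul_eq_mul, mul_one]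
    change ∫ x, (1 + (ε * D x - ε ^ 2 * R x) + ε ^ 2 / 2 * D x ^ 2 - ε ^ 3 * (R₀ * |D x|)
        - ε ^ 3 * (|D x| + R₀) ^ 3) ∂ν ≤ 1 at hmono
    rw [e1, hmean] at hmono
    have h7 : ε ^ 2 * (∫ x, D x ^ 2 ∂ν) ≤ ε ^ 2 * (2 * ∫ x, R x ∂ν + ε * K) := by
      rw [hK]; nlinarith
    exact le_of_mul_le_mul_left h7 (pow_pos hε 2)
  have hKn : 0 ≤ K := by
    have h1 : 0 ≤ ∫ x, |D x| ∂ν := integral_nonneg fun x => abs_nonneg _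
    have h2 : 0 ≤ ∫ x, (|D x| + R₀) ^ 3 ∂ν := integral_nonneg fun x => by positivity
    rw [hK]; positivity
  refine le_of_forall_pos_le_add fun δ hδ => ?_
  have hmin : 0 < min (min 1 (1 / (2 * (B + 1)))) (δ / (K + 1)) := by positivity
  set ε := min (min 1 (1 / (2 * (B + 1)))) (δ / (K + 1)) with hε
  have he1 : ε ≤ 1 := (min_le_left _ _).trans (min_le_left _ _)
  have he2 : ε ≤ 1 / (2 * (B + 1)) := (min_le_left _ _).trans (min_le_right _ _)
  have he3 : ε ≤ δ / (K + 1) := min_le_right _ _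
  rw [le_div_iff₀ (by positivity)] at he2 he3
  have := hKε ε hmin he1 (by nlinarith)
  nlinarith

end IsLogSmoothDensity

/-! ### An interpolation inequality -/

theorem exists_smooth_approx {d : ℕ} {V : Type*} [NormedAddCommGroup V] [NormedSpace ℝ V]
    [CompleteSpace V] {A : Euc d → V} {m : ℝ} (hm : 0 ≤ m) (hA : ∀ x y, ‖A x - A y‖ ≤ m * ‖x - y‖)
    {δ : ℝ} (hδ : 0 < δ) :
    ∃ A' : Euc d → V, Differentiable ℝ A' ∧ Continuous (fderiv ℝ A') ∧
      (∀ x, ‖A' x - A x‖ ≤ m * δ) ∧ ∀ x, ‖fderiv ℝ A' x‖ ≤ m := by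
  have hAc : Continuous A := (LipschitzWith.of_dist_le_mul (K := m.toNNReal) fun x y => by
    rw [dist_eq_norm, dist_eq_norm, Real.coe_toNNReal m hm]
    exact hA x y).continuous
  let φ : ContDiffBump (0 : Euc d) := ⟨δ / 2, δ, by positivity, by linarith⟩
  have hl : LocallyIntegrable A volume := hAc.locallyIntegrable
  set A' := convolution (φ.normed volume) A (ContinuousLinearMap.lsmul ℝ ℝ) volume with hA'
  have hsm : ContDiff ℝ 1 A' :=
    φ.hasCompactSupport_normed.contDiff_convolution_left (n := 1) _ φ.contDiff_normed hl
  have hex : ConvolutionExists (φ.normed volume) A (ContinuousLinearMap.lsmul ℝ ℝ) volume :=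
    φ.hasCompactSupport_normed.convolutionExists_left _ φ.continuous_normed hl
  refine ⟨A', hsm.differentiable (by norm_num), hsm.continuous_fderiv (by norm_num), fun x => ?_,
    fun x => ?_⟩
  · rw [← dist_eq_norm]
    refine φ.dist_normed_convolution_le hAc.aestronglyMeasurable fun y hy => ?_
    rw [dist_eq_norm]
    refine (hA y x).trans ?_
    gcongr
    rw [← dist_eq_norm]
    exact (Metric.mem_ball.1 hy).le
  · have hlip : LipschitzWith m.toNNReal A' := by
      refine LipschitzWith.of_dist_le_mul fun x y => ?_
      rw [dist_eq_norm, dist_eq_norm, Real.coe_toNNReal m hm]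
      have e : A' x - A' y = ∫ t, φ.normed volume t • (A (x - t) - A (y - t)) := by
        simp only [hA', convolution, smul_sub]
        exact (integral_sub (hex x) (hex y)).symm
      rw [e]
      calc _ ≤ ∫ t, φ.normed volume t * (m * ‖x - y‖) := by
            refine norm_integral_le_of_norm_le (φ.integrable_normed.mul_const _)
              (Filter.Eventually.of_forall fun t => ?_)
            rw [norm_smul, Real.norm_of_nonneg (φ.nonneg_normed t)]
            refine mul_le_mul_of_nonneg_left ?_ (φ.nonneg_normed t)
            simpa using hA (x - t) (y - t)
        _ = _ := by rw [integral_mul_const, φ.integral_normed, one_mul]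
    have := norm_fderiv_le_of_lipschitz ℝ hlip (x₀ := x)
    rwa [Real.coe_toNNReal m hm] at this

theorem frobSq_adjoint {d : ℕ} (A : Euc d →L[ℝ] Euc d) :
    frobSq (ContinuousLinearMap.adjoint A) = frobSq A := by
  have h : ∀ B : Euc d →L[ℝ] Euc d, trc (ContinuousLinearMap.adjoint B ∘L B) = frobSq B := by
    intro B
    refine Finset.sum_congr rfl fun i _ => ?_
    rw [ContinuousLinearMap.comp_apply, ContinuousLinearMap.adjoint_inner_right,
      real_inner_self_eq_norm_sq]
  rw [← h, ← h, ContinuousLinearMap.adjoint_adjoint, trc_eq_trace, trc_eq_trace]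
  exact LinearMap.trace_comp_comm' _ _

theorem frobSq_le_add {d : ℕ} {A B : Euc d →L[ℝ] Euc d} {η b : ℝ} (hη : ‖B - A‖ ≤ η)
    (hb : ‖A‖ ≤ b) : frobSq B ≤ frobSq A + d * (2 * b * η + η ^ 2) := by
  have hη0 : 0 ≤ η := (norm_nonneg _).trans hη
  have : ∀ i ∈ Finset.univ, ‖B (EuclideanSpace.basisFun (Fin d) ℝ i)‖ ^ 2
      ≤ ‖A (EuclideanSpace.basisFun (Fin d) ℝ i)‖ ^ 2 + (2 * b * η + η ^ 2) := by
    intro i _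
    set e := EuclideanSpace.basisFun (Fin d) ℝ i
    have he : ‖e‖ = 1 := norm_basisFun i
    have h1 : ‖A e‖ ≤ b := by
      have := A.le_opNorm e
      rw [he, mul_one] at this
      exact this.trans hb
    have h2 : ‖B e‖ ≤ ‖A e‖ + η := by
      have h3 := (B - A).le_opNorm e
      rw [he, mul_one] at h3
      have h4 : B e = A e + (B - A) e := by simp
      rw [h4]
      exact (norm_add_le _ _).trans (by linarith)
    nlinarith [norm_nonneg (B e), norm_nonneg (A e)]
  refine (Finset.sum_le_sum this).trans (le_of_eq ?_)
  rw [Finset.sum_add_distrib, Finset.sum_const, Finset.card_univ, Fintype.card_fin, nsmul_eq_mul]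
  rfl

/-- An inequality with a free parameter, optimized. -/
theorem le_two_mul_of_forall_le {X u w : ℝ} (hu : 0 ≤ u) (hw : 0 ≤ w)
    (h : ∀ t : ℝ, 0 < t → X ≤ t * u ^ 2 + w ^ 2 / t) : X ≤ 2 * u * w := by
  refine le_of_forall_pos_le_add fun η hη => ?_
  set θ := η / (u + w + 1) with hθ
  have hθ0 : 0 < θ := by positivity
  have h1 := h ((w + θ) / (u + θ)) (by positivity)
  have h2 : (w + θ) / (u + θ) * u ^ 2 ≤ (w + θ) * u := by
    rw [div_mul_eq_mul_div, div_le_iff₀ (by positivity)]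
    nlinarith [mul_nonneg (by positivity : 0 ≤ w + θ) (mul_nonneg hu hθ0.le)]
  have h3 : w ^ 2 / ((w + θ) / (u + θ)) ≤ w * (u + θ) := by
    rw [div_div_eq_mul_div, div_le_iff₀ (by positivity)]
    nlinarith [mul_nonneg (by positivity : 0 ≤ u + θ) (mul_nonneg hw hθ0.le)]
  have h4 : θ * (u + w + 1) = η := by rw [hθ]; field_simp
  nlinarith

namespace IsLogSmoothDensity

variable {d : ℕ} {ν : Measure (Euc d)} {p : Euc d → ℝ} {ℓ : ℝ}

/-- One step of the interpolation inequality, with the Jacobian of `G` tested against a smooth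
matrix field `A`; in the application the column `A e_j` approximates the gradient of the `j`-th
component of `G`. Each column is handled by parts and by the weak Bochner inequality, with Young's
inequality of weight `c` in between. -/
theorem integral_sum_inner_le [IsProbabilityMeasure ν] (h : IsLogSmoothDensity ν p ℓ)
    {G : Euc d → Euc d} {A : Euc d → (Euc d →L[ℝ] Euc d)} {a b m c : ℝ} (hG : Differentiable ℝ G)
    (hG2 : MemLp G 2 ν) (hGc : Continuous (fderiv ℝ G)) (hGb : ∀ x, ‖fderiv ℝ G x‖ ≤ b)
    (hA : Differentiable ℝ A) (hAa : ∀ x, ‖A x‖ ≤ a) (hAc : Continuous (fderiv ℝ A))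
    (hAm : ∀ x, ‖fderiv ℝ A x‖ ≤ m) (hc : 0 < c) :
    ∫ x, (∑ j, inner ℝ (EuclideanSpace.basisFun (Fin d) ℝ j)
        (fderiv ℝ G x (A x (EuclideanSpace.basisFun (Fin d) ℝ j)))) ∂ν
      ≤ c / 2 * ∫ x, ‖G x‖ ^ 2 ∂ν + (ℓ * ∫ x, frobSq (A x) ∂ν + 5 * (d * m) ^ 2) / c := by
  set e := EuclideanSpace.basisFun (Fin d) ℝ with he
  have hA0 := hA.continuous
  have hG0 := hG.continuous
  have hsc := h.continuous_score
  have hm0 : 0 ≤ m := (norm_nonneg (fderiv ℝ A 0)).trans (hAm 0)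
  have ha0 : 0 ≤ a := (norm_nonneg _).trans (hAa 0)
  have hℓ := h.nonneg
  have hen : ∀ j, ‖e j‖ = 1 := e.norm_eq_one
  let g : Fin d → Euc d → ℝ := fun j x => inner ℝ (e j) (G x)
  let α : Fin d → Euc d → Euc d := fun j x => A x (e j)
  have hg : ∀ j x, HasFDerivAt (g j) ((innerSL ℝ (e j)).comp (fderiv ℝ G x)) x := fun j x =>
    (innerSL ℝ (e j)).hasFDerivAt.comp x (hG x).hasFDerivAt
  have hα : ∀ j x, HasFDerivAt (α j)
      ((ContinuousLinearMap.apply ℝ (Euc d) (e j)).comp (fderiv ℝ A x)) x := fun j x =>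
    (ContinuousLinearMap.apply ℝ (Euc d) (e j)).hasFDerivAt.comp x (hA x).hasFDerivAt
  have hgf : ∀ j, fderiv ℝ (g j) = fun x => (innerSL ℝ (e j)).comp (fderiv ℝ G x) := fun j =>
    funext fun x => (hg j x).fderiv
  have hαf : ∀ j, fderiv ℝ (α j)
      = fun x => (ContinuousLinearMap.apply ℝ (Euc d) (e j)).comp (fderiv ℝ A x) := fun j =>
    funext fun x => (hα j x).fderiv
  have hαv : ∀ j x v, fderiv ℝ (α j) x v = fderiv ℝ A x v (e j) := fun j x v => by
    rw [hαf]; rfl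
  have hg2 : ∀ j, MemLp (g j) 2 ν := fun j => (innerSL ℝ (e j)).comp_memLp' hG2
  have hgc : ∀ j, Continuous (fderiv ℝ (g j)) := fun j => by rw [hgf]; fun_prop
  have hαc : ∀ j, Continuous (fderiv ℝ (α j)) := fun j => by rw [hαf]; fun_prop
  have hgb : ∀ j x, ‖fderiv ℝ (g j) x‖ ≤ b := fun j x => by
    rw [hgf]
    refine (ContinuousLinearMap.opNorm_comp_le _ _).trans ?_
    rw [innerSL_apply_norm, hen, one_mul]
    exact hGb x
  have hαa : ∀ j x, ‖α j x‖ ≤ a := fun j x => by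
    have := (A x).le_opNorm (e j)
    rw [hen, mul_one] at this
    exact this.trans (hAa x)
  have hαm : ∀ j x, ‖fderiv ℝ (α j) x‖ ≤ m := fun j x => by
    refine ContinuousLinearMap.opNorm_le_bound _ hm0 fun v => ?_
    rw [hαv]
    have h1 := (fderiv ℝ A x v).le_opNorm (e j)
    rw [hen, mul_one] at h1
    exact h1.trans (((fderiv ℝ A x).le_opNorm v).trans (by gcongr; exact hAm x))
  set D : Fin d → Euc d → ℝ := fun j x =>
    trc (fderiv ℝ (α j) x) + inner ℝ (score p x) (α j x) with hD
  have hαd : ∀ j, Differentiable ℝ (α j) := fun j x => (hα j x).differentiableAt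
  have hD2 : ∀ j, MemLp (D j) 2 ν := by
    intro j
    have h1 : MemLp (fun x => trc (fderiv ℝ (α j) x)) 2 ν :=
      (memLp_top_of_bound (continuous_trc.comp (hαc j)).aestronglyMeasurable (d * m)
        (Filter.Eventually.of_forall fun x =>
          (abs_trc_le _).trans (by gcongr; exact hαm j x))).mono_exponent le_top
    have hs2 : MemLp (score p) 2 ν := h.memLp_score 2
    refine h1.add ((hs2.norm.const_mul a).mono ?_ (Filter.Eventually.of_forall fun x => ?_))
    · have := (hαd j).continuous
      fun_prop
    · rw [norm_mul, norm_norm, Real.norm_of_nonneg ha0, mul_comm]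
      exact (norm_inner_le_norm _ _).trans (by gcongr; exact hαa j x)
  have hparts : ∀ j, ∫ x, inner ℝ (e j) (fderiv ℝ G x (A x (e j))) ∂ν
      ≤ c / 2 * ∫ x, g j x ^ 2 ∂ν + (∫ x, (ℓ * ‖α j x‖ ^ 2 + 5 * frobSq (fderiv ℝ (α j) x)) ∂ν) / c
      := by
    intro j
    have h1 := h.integral_fderiv_apply_eq (fun x => (hg j x).differentiableAt) (hg2 j) (hgc j)
      (hgb j) (hαd j) (hαa j) (hαc j) (hαm j)
    have h2 := h.integral_divergence_sq_le (hαd j) (hαa j) (hαc j) (hαm j)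
    have h3 : ∀ x, fderiv ℝ (g j) x (α j x) = inner ℝ (e j) (fderiv ℝ G x (A x (e j))) := by
      intro x; rw [hgf]; rfl
    simp only [h3] at h1
    rw [h1, ← integral_neg]
    have h4 : ∫ x, -(g j x * D j x) ∂ν ≤ ∫ x, (c / 2 * g j x ^ 2 + 1 / (2 * c) * D j x ^ 2) ∂ν := by
      refine integral_mono ((hg2 j).integrable_mul (hD2 j)).neg
        (((hg2 j).integrable_sq.const_mul _).add ((hD2 j).integrable_sq.const_mul _)) fun x => ?_
      have : c / 2 * g j x ^ 2 + 1 / (2 * c) * D j x ^ 2 + g j x * D j x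
          = (c * g j x + D j x) ^ 2 / (2 * c) := by field_simp; ring
      have h5 : 0 ≤ (c * g j x + D j x) ^ 2 / (2 * c) := by positivity
      simp only
      linarith
    rw [integral_add ((hg2 j).integrable_sq.const_mul _) ((hD2 j).integrable_sq.const_mul _),
      integral_const_mul, integral_const_mul] at h4
    refine h4.trans ?_
    have h6 : 1 / (2 * c) * ∫ x, D j x ^ 2 ∂ν
        ≤ 1 / (2 * c) * (2 * ∫ x, (ℓ * ‖α j x‖ ^ 2 + 5 * frobSq (fderiv ℝ (α j) x)) ∂ν) := by
      gcongr
    have h7 : 1 / (2 * c) * (2 * ∫ x, (ℓ * ‖α j x‖ ^ 2 + 5 * frobSq (fderiv ℝ (α j) x)) ∂ν)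
        = (∫ x, (ℓ * ‖α j x‖ ^ 2 + 5 * frobSq (fderiv ℝ (α j) x)) ∂ν) / c := by field_simp
    linarith
  have hi1 : ∀ j, Integrable (fun x => inner ℝ (e j) (fderiv ℝ G x (A x (e j)))) ν := fun j => by
    refine Integrable.of_bound (C := b * a) (by fun_prop) (Filter.Eventually.of_forall fun x => ?_)
    refine (norm_inner_le_norm _ _).trans ?_
    rw [hen, one_mul]
    refine ((fderiv ℝ G x).le_opNorm _).trans ?_
    exact mul_le_mul (hGb x) (hαa j x) (norm_nonneg _) ((norm_nonneg _).trans (hGb x))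
  have hi2 : ∀ j, Integrable (fun x => ‖α j x‖ ^ 2) ν := fun j => by
    have := (hαd j).continuous
    refine Integrable.of_bound (C := a ^ 2) (by fun_prop) (Filter.Eventually.of_forall fun x => ?_)
    rw [norm_pow, norm_norm]
    have := hαa j x
    gcongr
  have hfb : ∀ j x, frobSq (fderiv ℝ (α j) x) ≤ d * m ^ 2 := fun j x =>
    (frobSq_le _).trans (by gcongr; exact hαm j x)
  have hi3 : ∀ j, Integrable (fun x => frobSq (fderiv ℝ (α j) x)) ν := fun j => by
    refine Integrable.of_bound (C := d * m ^ 2)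
      (continuous_frobSq.comp (hαc j)).aestronglyMeasurable (Filter.Eventually.of_forall fun x => ?_)
    rw [Real.norm_of_nonneg (frobSq_nonneg _)]
    exact hfb j x
  have hfrob : ∀ x, ∑ j, frobSq (fderiv ℝ (α j) x) ≤ (d * m) ^ 2 := by
    intro x
    have h1 : ∀ j ∈ Finset.univ, frobSq (fderiv ℝ (α j) x) ≤ d * m ^ 2 := fun j _ => hfb j x
    refine (Finset.sum_le_card_nsmul _ _ _ h1).trans (le_of_eq ?_)
    rw [Finset.card_univ, Fintype.card_fin, nsmul_eq_mul]
    ring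
  rw [integral_finsetSum _ fun j _ => hi1 j]
  refine (Finset.sum_le_sum fun j _ => hparts j).trans ?_
  rw [Finset.sum_add_distrib, ← Finset.mul_sum, ← Finset.sum_div,
    ← integral_finsetSum _ fun j _ => (hg2 j).integrable_sq]
  have hGn : ∀ x, ∑ j, g j x ^ 2 = ‖G x‖ ^ 2 := fun x => by
    rw [← e.sum_sq_norm_inner_right (G x)]
    exact Finset.sum_congr rfl fun j _ => by rw [Real.norm_eq_abs, sq_abs]
  simp only [hGn]
  gcongr
  have hsum : ∀ j, ∫ x, (ℓ * ‖α j x‖ ^ 2 + 5 * frobSq (fderiv ℝ (α j) x)) ∂ν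
      = ℓ * ∫ x, ‖α j x‖ ^ 2 ∂ν + 5 * ∫ x, frobSq (fderiv ℝ (α j) x) ∂ν := fun j => by
    rw [integral_add ((hi2 j).const_mul _) ((hi3 j).const_mul _), integral_const_mul,
      integral_const_mul]
  simp only [hsum]
  rw [Finset.sum_add_distrib, ← Finset.mul_sum, ← Finset.mul_sum,
    ← integral_finsetSum _ fun j _ => hi2 j, ← integral_finsetSum _ fun j _ => hi3 j]
  have h8 : ∫ x, ∑ j, frobSq (fderiv ℝ (α j) x) ∂ν ≤ (d * m) ^ 2 := by
    have := integral_mono (integrable_finsetSum _ fun j _ => hi3 j)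
      (integrable_const (μ := ν) ((d * m : ℝ) ^ 2)) hfrob
    simpa using this
  have h9 : ∫ x, ∑ j, ‖α j x‖ ^ 2 ∂ν = ∫ x, frobSq (A x) ∂ν := rfl
  rw [h9]
  linarith

/-- The Jacobian of `G` is controlled in mean square by `G` and the Lipschitz constant `m` of its
Jacobian. The bound is free of the dimension apart from the factor `d * m`, which bounds the
Frobenius norm of the second derivative. -/
theorem integral_frobSq_fderiv_le [IsProbabilityMeasure ν] (h : IsLogSmoothDensity ν p ℓ)
    {G : Euc d → Euc d} {b m : ℝ} (hG : Differentiable ℝ G)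
    (hG2 : MemLp G 2 ν) (hGb : ∀ x, ‖fderiv ℝ G x‖ ≤ b) (hm : 0 ≤ m)
    (hGm : ∀ x y, ‖fderiv ℝ G x - fderiv ℝ G y‖ ≤ m * ‖x - y‖) :
    ∫ x, frobSq (fderiv ℝ G x) ∂ν
      ≤ 2 * ℓ * ∫ x, ‖G x‖ ^ 2 ∂ν + 7 * (d * m) * √(∫ x, ‖G x‖ ^ 2 ∂ν) := by
  set e := EuclideanSpace.basisFun (Fin d) ℝ with he
  have hen : ∀ j, ‖e j‖ = 1 := e.norm_eq_one
  have hℓ := h.nonneg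
  have hb0 : 0 ≤ b := (norm_nonneg _).trans (hGb 0)
  have hGc : Continuous (fderiv ℝ G) := (LipschitzWith.of_dist_le_mul (K := m.toNNReal)
    fun x y => by
      rw [dist_eq_norm, dist_eq_norm, Real.coe_toNNReal m hm]
      exact hGm x y).continuous
  set Q := ∫ x, frobSq (fderiv ℝ G x) ∂ν with hQ
  set N := ∫ x, ‖G x‖ ^ 2 ∂ν with hN
  have hN0 : 0 ≤ N := integral_nonneg fun x => by positivity
  -- The natural test field is the adjoint Jacobian; it is only Lipschitz, hence has to be smoothed
  -- at a scale `δ` that tends to `0`.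
  let A₀ : Euc d → (Euc d →L[ℝ] Euc d) := fun x => ContinuousLinearMap.adjoint (fderiv ℝ G x)
  have hA₀m : ∀ x y, ‖A₀ x - A₀ y‖ ≤ m * ‖x - y‖ := fun x y => by
    simp only [A₀]
    rw [← map_sub, LinearIsometryEquiv.norm_map]
    exact hGm x y
  have hA₀b : ∀ x, ‖A₀ x‖ ≤ b := fun x => by
    simp only [A₀]
    rw [LinearIsometryEquiv.norm_map]
    exact hGb x
  have hfi : Integrable (fun x => frobSq (fderiv ℝ G x)) ν := by
    refine Integrable.of_bound (C := d * b ^ 2)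
      (continuous_frobSq.comp hGc).aestronglyMeasurable (Filter.Eventually.of_forall fun x => ?_)
    rw [Real.norm_of_nonneg (frobSq_nonneg _)]
    exact (frobSq_le _).trans (by gcongr; exact hGb x)
  have hstep : ∀ c : ℝ, 0 < c → Q ≤ c / 2 * N + (ℓ * Q + 5 * (d * m) ^ 2) / c := by
    intro c hc
    have hδ : ∀ δ : ℝ, 0 < δ → δ ≤ 1 → Q ≤ c / 2 * N + (ℓ * Q + 5 * (d * m) ^ 2) / c
        + δ * (d * (b * m) + ℓ * (d * (2 * b * m + m ^ 2)) / c) := by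
      intro δ hδ hδ1
      obtain ⟨A, hAd, hAc, hAA, hAm⟩ := exists_smooth_approx hm hA₀m hδ
      have hA0 := hAd.continuous
      have hAb : ∀ x, ‖A x‖ ≤ b + m * δ := fun x => by
        have := norm_add_le (A x - A₀ x) (A₀ x)
        rw [sub_add_cancel] at this
        linarith [hAA x, hA₀b x]
      have key := h.integral_sum_inner_le hG hG2 hGc hGb hAd hAb hAc hAm hc
      have h1 : ∀ x, frobSq (fderiv ℝ G x) - d * (b * (m * δ))
          ≤ ∑ j, inner ℝ (e j) (fderiv ℝ G x (A x (e j))) := by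
        intro x
        rw [← frobSq_adjoint]
        have h2 : ∀ j ∈ Finset.univ, ‖A₀ x (e j)‖ ^ 2 - b * (m * δ)
            ≤ inner ℝ (e j) (fderiv ℝ G x (A x (e j))) := by
          intro j _
          have h3 : A x (e j) = A₀ x (e j) + (A x - A₀ x) (e j) := by simp
          have h4 : inner ℝ (e j) (fderiv ℝ G x (A₀ x (e j))) = ‖A₀ x (e j)‖ ^ 2 := by
            rw [← real_inner_self_eq_norm_sq]
            exact (ContinuousLinearMap.adjoint_inner_left _ _ _).symm
          rw [h3, map_add, inner_add_right, h4]
          have h5 : ‖fderiv ℝ G x ((A x - A₀ x) (e j))‖ ≤ b * (m * δ) := by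
            refine ((fderiv ℝ G x).le_opNorm _).trans ?_
            have h6 := (A x - A₀ x).le_opNorm (e j)
            rw [hen, mul_one] at h6
            exact mul_le_mul (hGb x) (h6.trans (hAA x)) (norm_nonneg _) hb0
          have h7 := abs_real_inner_le_norm (e j) (fderiv ℝ G x ((A x - A₀ x) (e j)))
          rw [hen, one_mul] at h7
          linarith [neg_abs_le (inner ℝ (e j) (fderiv ℝ G x ((A x - A₀ x) (e j))))]
        refine le_trans (le_of_eq ?_) (Finset.sum_le_sum h2)
        rw [Finset.sum_sub_distrib, Finset.sum_const, Finset.card_univ, Fintype.card_fin,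
          nsmul_eq_mul]
        rfl
      have h8 : Q - d * (b * (m * δ))
          ≤ ∫ x, ∑ j, inner ℝ (e j) (fderiv ℝ G x (A x (e j))) ∂ν := by
        have hi1 : ∀ j, Integrable (fun x => inner ℝ (e j) (fderiv ℝ G x (A x (e j)))) ν :=
          fun j => by
          refine Integrable.of_bound (C := b * (b + m * δ)) (by fun_prop)
            (Filter.Eventually.of_forall fun x => ?_)
          refine (norm_inner_le_norm _ _).trans ?_
          rw [hen, one_mul]
          refine ((fderiv ℝ G x).le_opNorm _).trans ?_
          have h6 := (A x).le_opNorm (e j)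
          rw [hen, mul_one] at h6
          exact mul_le_mul (hGb x) (h6.trans (hAb x)) (norm_nonneg _) hb0
        have := integral_mono (hfi.sub (integrable_const (d * (b * (m * δ)))))
          (integrable_finsetSum Finset.univ fun j _ => hi1 j) h1
        change ∫ x, (frobSq (fderiv ℝ G x) - d * (b * (m * δ))) ∂ν ≤ _ at this
        rw [integral_sub hfi (integrable_const _)] at this
        simpa using this
      have h9 : ∫ x, frobSq (A x) ∂ν ≤ Q + d * (2 * b * (m * δ) + (m * δ) ^ 2) := by
        have h10 : ∀ x, frobSq (A x)
            ≤ frobSq (fderiv ℝ G x) + d * (2 * b * (m * δ) + (m * δ) ^ 2) := by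
          intro x
          rw [← frobSq_adjoint (fderiv ℝ G x)]
          exact frobSq_le_add (hAA x) (hA₀b x)
        have h11 : Integrable (fun x => frobSq (A x)) ν := by
          refine Integrable.of_bound (C := d * (b + m * δ) ^ 2)
            (continuous_frobSq.comp hA0).aestronglyMeasurable
            (Filter.Eventually.of_forall fun x => ?_)
          rw [Real.norm_of_nonneg (frobSq_nonneg _)]
          exact (frobSq_le _).trans (by gcongr; exact hAb x)
        have := integral_mono h11 (hfi.add (integrable_const
          (d * (2 * b * (m * δ) + (m * δ) ^ 2)))) h10
        change _ ≤ ∫ x, (frobSq (fderiv ℝ G x) + d * (2 * b * (m * δ) + (m * δ) ^ 2)) ∂ν at this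
        rw [integral_add hfi (integrable_const _)] at this
        simpa using this
      have h12 : 2 * b * (m * δ) + (m * δ) ^ 2 ≤ δ * (2 * b * m + m ^ 2) := by
        nlinarith [mul_nonneg (sq_nonneg m) (mul_nonneg hδ.le (sub_nonneg.2 hδ1))]
      have h13 : (ℓ * ∫ x, frobSq (A x) ∂ν + 5 * (d * m) ^ 2) / c
          ≤ (ℓ * (Q + d * (δ * (2 * b * m + m ^ 2))) + 5 * (d * m) ^ 2) / c := by
        gcongr
        exact h9.trans (by gcongr)
      have h14 : (ℓ * (Q + d * (δ * (2 * b * m + m ^ 2))) + 5 * (d * m) ^ 2) / c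
          = (ℓ * Q + 5 * (d * m) ^ 2) / c + δ * (ℓ * (d * (2 * b * m + m ^ 2)) / c) := by
        field_simp; ring
      nlinarith
    have hK : 0 ≤ d * (b * m) + ℓ * (d * (2 * b * m + m ^ 2)) / c := by positivity
    set K := d * (b * m) + ℓ * (d * (2 * b * m + m ^ 2)) / c
    refine le_of_forall_pos_le_add fun η hη => ?_
    refine (hδ (min 1 (η / (K + 1))) (by positivity) (min_le_left _ _)).trans ?_
    have h1 : min 1 (η / (K + 1)) * (K + 1) ≤ η := by
      rw [← le_div_iff₀ (by positivity)]; exact min_le_right _ _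
    have h2 : 0 < min 1 (η / (K + 1)) := by positivity
    nlinarith
  -- With `c = 2 ℓ + t` the term `ℓ Q / c ≤ Q / 2` is absorbed in the left-hand side.
  have hfin : ∀ t : ℝ, 0 < t → Q - 2 * ℓ * N ≤ t * √N ^ 2 + (√10 * (d * m)) ^ 2 / t := by
    intro t ht
    have h1 := hstep (2 * ℓ + t) (by positivity)
    have hQ0 : 0 ≤ Q := integral_nonneg fun x => frobSq_nonneg _
    have h2 : (ℓ * Q + 5 * (d * m) ^ 2) / (2 * ℓ + t) ≤ Q / 2 + 5 * (d * m) ^ 2 / t := by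
      rw [add_div]
      refine add_le_add ?_ ?_
      · rw [div_le_div_iff₀ (by positivity) two_pos]
        nlinarith
      · gcongr
        linarith
    rw [Real.sq_sqrt hN0, mul_pow, Real.sq_sqrt (by norm_num)]
    have h3 : 10 * (d * m) ^ 2 / t = 2 * (5 * (d * m) ^ 2 / t) := by ring
    rw [h3]
    linarith
  have := le_two_mul_of_forall_le (Real.sqrt_nonneg N) (by positivity) hfin
  have h10 : √10 ≤ 7 / 2 := by
    rw [Real.sqrt_le_left (by norm_num)]; norm_num
  have h11 : 2 * √N * (√10 * (d * m)) ≤ 7 * (d * m) * √N := by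
    have h12 : 0 ≤ √N * (d * m) := by positivity
    nlinarith
  linarith

end IsLogSmoothDensity

/-! ### The relative entropy of a transported measure -/

theorem le_norm_apply_of_hasFDerivAt {E F : Type*} [NormedAddCommGroup E] [NormedSpace ℝ E]
    [NormedAddCommGroup F] [NormedSpace ℝ F] {H : E → F} {A : E →L[ℝ] F} {x : E} {κ : ℝ}
    (hA : HasFDerivAt H A x) (hκ : ∀ x y, κ * ‖x - y‖ ≤ ‖H x - H y‖) (v : E) :
    κ * ‖v‖ ≤ ‖A v‖ := by
  refine ge_of_tendsto (hA.lim_real v).norm ?_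
  filter_upwards [Filter.eventually_gt_atTop 0] with c hc
  have h := hκ (x + c⁻¹ • v) x
  rw [add_sub_cancel_left, norm_smul, Real.norm_of_nonneg (inv_nonneg.2 hc.le)] at h
  rw [norm_smul, Real.norm_of_nonneg hc.le]
  calc κ * ‖v‖ = c * (κ * (c⁻¹ * ‖v‖)) := by field_simp
    _ ≤ _ := by gcongr

namespace IsLogSmoothDensity

variable {d : ℕ} {ν : Measure (Euc d)} {p : Euc d → ℝ} {ℓ : ℝ}

/-- The change of variables formula, as a formula for the density of `ν.map H` relative to `ν`. -/
theorem exists_map_eq_withDensity (h : IsLogSmoothDensity ν p ℓ) {H : Euc d → Euc d}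
    (hH : Differentiable ℝ H) (hHc : Continuous (fderiv ℝ H)) (hinj : Function.Injective H)
    (hdet : ∀ x, (fderiv ℝ H x).det ≠ 0) :
    ∃ f : Euc d → ℝ≥0∞, Measurable f ∧ ν.map H = ν.withDensity f ∧
      ∀ x, f (H x) = ENNReal.ofReal (p x / (|(fderiv ℝ H x).det| * p (H x))) := by
  have hemb : MeasurableEmbedding H := hH.continuous.measurableEmbedding hinj
  have hpc := h.continuous
  have hHc0 := hH.continuous
  have hdetc : Continuous fun x => (fderiv ℝ H x).det := ContinuousLinearMap.continuous_det.comp hHc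
  let g : Euc d → ℝ≥0∞ := fun x => ENNReal.ofReal (p x / (|(fderiv ℝ H x).det| * p (H x)))
  have hg : Measurable g := by
    have h1 : Measurable fun x => p (H x) := (hpc.comp hHc0).measurable
    have h2 : Measurable fun x => |(fderiv ℝ H x).det| := hdetc.abs.measurable
    exact (hpc.measurable.div (h2.mul h1)).ennreal_ofReal
  have hf := hemb.measurable_extend hg (measurable_const (a := (0 : ℝ≥0∞)))
  have hfH : ∀ x, Function.extend H g (fun _ => 0) (H x) = g x := fun x =>
    hinj.extend_apply _ _ _
  refine ⟨Function.extend H g fun _ => 0, hf, ?_, hfH⟩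
  ext S hS
  rw [Measure.map_apply hHc0.measurable hS, withDensity_apply _ hS, ← lintegral_indicator hS,
    h.lintegral_eq]
  have h1 : ∫⁻ x in H '' univ, ENNReal.ofReal (p x) * S.indicator (Function.extend H g fun _ => 0) x
      = ∫⁻ x, ENNReal.ofReal (p x) * S.indicator (Function.extend H g fun _ => 0) x := by
    rw [image_univ]
    refine setLIntegral_eq_of_support_subset ?_
    intro x hx
    by_contra hxr
    refine hx ?_
    have : Function.extend H g (fun _ => 0) x = 0 :=
      Function.extend_apply' _ _ _ fun ⟨a, ha⟩ => hxr ⟨a, ha⟩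
    simp [this]
  rw [← h1, lintegral_image_eq_lintegral_abs_det_fderiv_mul volume MeasurableSet.univ
    (fun x _ => (hH x).hasFDerivAt.hasFDerivWithinAt) hinj.injOn, Measure.restrict_univ,
    ← lintegral_indicator_one (hHc0.measurable hS), h.lintegral_eq]
  refine lintegral_congr fun x => ?_
  by_cases hx : H x ∈ S
  · rw [indicator_of_mem hx, indicator_of_mem (show x ∈ H ⁻¹' S from hx), hfH, Pi.one_apply,
      mul_one, ← ENNReal.ofReal_mul (h.pos _).le, ← ENNReal.ofReal_mul (abs_nonneg _)]
    congr 1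
    have := abs_pos.2 (hdet x)
    have := h.pos (H x)
    field_simp
  · rw [indicator_of_notMem hx, indicator_of_notMem (show x ∉ H ⁻¹' S from hx)]
    simp

/-- The relative entropy of the image of `ν` under `H`, in terms of the displacement `H x - x` and
its Jacobian. The term linear in the displacement is cancelled by the divergence theorem. -/
theorem klDiv_map_le [IsProbabilityMeasure ν] (h : IsLogSmoothDensity ν p ℓ) {H : Euc d → Euc d}
    {a m κ : ℝ} (hH : FourPoint H a m) (ha : 0 ≤ a) (hm : 0 ≤ m) (hκ : 0 < κ) (hκ1 : κ ≤ 1)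
    (hHκ : ∀ x y, κ * ‖x - y‖ ≤ ‖H x - H y‖) (hG2 : MemLp (fun x => H x - x) 2 ν) :
    InformationTheory.klDiv (ν.map H) ν ≤ ENNReal.ofReal
      (2 * ∫ x, frobSq (fderiv ℝ H x - 1) ∂ν
        + -Real.log κ * min (d : ℝ) (4 * ∫ x, frobSq (fderiv ℝ H x - 1) ∂ν)
        + ℓ * ∫ x, ‖H x - x‖ ^ 2 ∂ν) := by
  have hd := hH.differentiable hm
  have hc := hH.continuous_fderiv hm
  have hHc := hH.continuous
  have hpc := h.continuous
  have hsc := h.continuous_score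
  have hdetc : Continuous fun x => (fderiv ℝ H x).det := ContinuousLinearMap.continuous_det.comp hc
  have hlow : ∀ x v, κ * ‖v‖ ≤ ‖fderiv ℝ H x v‖ := fun x =>
    le_norm_apply_of_hasFDerivAt (hd x).hasFDerivAt hHκ
  have hdet : ∀ x, (fderiv ℝ H x).det ≠ 0 := fun x => det_ne_zero_of_le _ hκ (hlow x)
  have hinj : Function.Injective H := fun x y hxy => by
    have h1 := hHκ x y
    rw [hxy, sub_self, norm_zero] at h1
    have h2 : ‖x - y‖ ≤ 0 := by
      by_contra h3
      push Not at h3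
      nlinarith [mul_pos hκ h3]
    exact sub_eq_zero.1 (norm_le_zero_iff.1 h2)
  obtain ⟨f, hf, hνf, hfH⟩ := h.exists_map_eq_withDensity hd hc hinj hdet
  have hHm : Measurable H := hHc.measurable
  have : IsProbabilityMeasure (ν.map H) := Measure.isProbabilityMeasure_map hHm.aemeasurable
  have hac : ν.map H ≪ ν := by rw [hνf]; exact withDensity_absolutelyContinuous _ _
  -- The log-likelihood ratio of `ν.map H` and `ν`, pulled back by `H`.
  set W : Euc d → ℝ := fun x =>
    Real.log (p x) - Real.log (p (H x)) - Real.log |(fderiv ℝ H x).det| with hW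
  have hllr : (fun x => llr (ν.map H) ν (H x)) =ᵐ[ν] W := by
    have h1 : (ν.map H).rnDeriv ν =ᵐ[ν] f := by
      conv_lhs => rw [hνf]
      exact Measure.rnDeriv_withDensity ν hf
    have h2 := ae_of_ae_map hHm.aemeasurable (hac.ae_le h1)
    filter_upwards [h2] with x hx
    have hp := h.pos x
    have hp' := h.pos (H x)
    have hD := abs_pos.2 (hdet x)
    simp only [llr_def, hW]
    rw [hx, hfH, ENNReal.toReal_ofReal (by positivity), Real.log_div hp.ne' (by positivity),
      Real.log_mul hD.ne' hp'.ne']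
    ring
  have hWc : Continuous W := by
    have h1 : Continuous fun x => Real.log (p x) :=
      hpc.log fun x => (h.pos x).ne'
    have h2 : Continuous fun x => Real.log (p (H x)) := h1.comp hHc
    have h3 : Continuous fun x => Real.log |(fderiv ℝ H x).det| :=
      hdetc.abs.log fun x => (abs_pos.2 (hdet x)).ne'
    exact (h1.sub h2).sub h3
  -- the displacement and its derivative
  have hGd : ∀ x, HasFDerivAt (fun x => H x - x) (fderiv ℝ H x - 1) x := fun x =>
    (hd x).hasFDerivAt.sub (hasFDerivAt_id x)
  have hGf : fderiv ℝ (fun x => H x - x) = fun x => fderiv ℝ H x - 1 :=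
    funext fun x => (hGd x).fderiv
  have hnorm : ∀ x, ‖fderiv ℝ H x - 1‖ ≤ a + 1 := fun x =>
    (_root_.norm_sub_le _ _).trans
      (add_le_add (hH.norm_fderiv_le ha x) ContinuousLinearMap.norm_id_le)
  have hG1c : Continuous fun x => fderiv ℝ H x - 1 := hc.sub continuous_const
  have htaylor : ∀ x, |Real.log (p (H x)) - Real.log (p x) - inner ℝ (score p x) (H x - x)|
      ≤ ℓ * ‖H x - x‖ ^ 2 := fun x => by
    have := h.abs_log_sub_le x (H x - x)
    rwa [add_sub_cancel] at this
  set c₀ : ℝ := d * (|Real.log κ| + |Real.log a|) with hc₀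
  have hlogdet : ∀ x, abs (Real.log (abs (fderiv ℝ H x).det)) ≤ c₀ := fun x =>
    abs_log_abs_det_le _ hκ (hlow x) (hH.norm_fderiv_le ha x)
  have hlogc : Continuous fun x => Real.log |(fderiv ℝ H x).det| :=
    hdetc.abs.log fun x => (abs_pos.2 (hdet x)).ne'
  have hsi : Integrable (fun x => inner ℝ (score p x) (H x - x)) ν := by
    have hs2 : MemLp (score p) 2 ν := h.memLp_score 2
    refine (hs2.norm.integrable_mul hG2.norm).mono' (by fun_prop)
      (Filter.Eventually.of_forall fun x => norm_inner_le_norm _ _)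
  have hGsq : Integrable (fun x => ‖H x - x‖ ^ 2) ν := hG2.norm.integrable_sq
  have hlogi : Integrable (fun x => Real.log |(fderiv ℝ H x).det|) ν :=
    Integrable.of_bound hlogc.aestronglyMeasurable c₀ (Filter.Eventually.of_forall hlogdet)
  have hWi : Integrable W ν := by
    refine ((hsi.abs.add (hGsq.const_mul ℓ)).add (integrable_const c₀)).mono'
      hWc.aestronglyMeasurable (Filter.Eventually.of_forall fun x => ?_)
    have h1 := abs_le.1 (htaylor x)
    have h2 := abs_le.1 (hlogdet x)
    have h3 := le_abs_self (inner ℝ (score p x) (H x - x))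
    have h4 := neg_abs_le (inner ℝ (score p x) (H x - x))
    change |W x| ≤ |inner ℝ (score p x) (H x - x)| + ℓ * ‖H x - x‖ ^ 2 + c₀
    rw [abs_le]
    constructor <;> simp only [hW] <;> linarith
  have hllri : Integrable (llr (ν.map H) ν) (ν.map H) := by
    rw [integrable_map_measure (stronglyMeasurable_llr _ _).aestronglyMeasurable hHm.aemeasurable]
    exact hWi.congr hllr.symm
  have hint : ∫ y, llr (ν.map H) ν y ∂(ν.map H) = ∫ x, W x ∂ν := by
    rw [integral_map hHm.aemeasurable (stronglyMeasurable_llr _ _).aestronglyMeasurable]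
    exact integral_congr_ae hllr
  rw [InformationTheory.klDiv_of_ac_of_integrable hac hllri, hint]
  refine ENNReal.ofReal_le_ofReal ?_
  rw [probReal_univ, probReal_univ, add_sub_cancel_right]
  -- the divergence theorem for the displacement
  have hdiv : ∫ x, trc (fderiv ℝ H x - 1) ∂ν = -∫ x, inner ℝ (score p x) (H x - x) ∂ν := by
    have := h.integral_trc_fderiv_eq (fun x => (hGd x).differentiableAt) hG2 (fun i => by
      rw [hGf]
      refine Integrable.of_bound (C := a + 1) (by fun_prop) (Filter.Eventually.of_forall fun x => ?_)
      refine (norm_inner_le_norm _ _).trans ?_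
      have h1 := (fderiv ℝ H x - 1).le_opNorm (EuclideanSpace.basisFun (Fin d) ℝ i)
      rw [norm_basisFun, mul_one] at h1
      rw [norm_basisFun, one_mul]
      exact h1.trans (hnorm x))
    rwa [hGf] at this
  have htri : Integrable (fun x => trc (fderiv ℝ H x - 1)) ν :=
    Integrable.of_bound (continuous_trc.comp hG1c).aestronglyMeasurable (d * (a + 1))
      (Filter.Eventually.of_forall fun x => (abs_trc_le _).trans (by gcongr; exact hnorm x))
  have hfri : Integrable (fun x => frobSq (fderiv ℝ H x - 1)) ν := by
    refine Integrable.of_bound (continuous_frobSq.comp hG1c).aestronglyMeasurable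
      (d * (a + 1) ^ 2) (Filter.Eventually.of_forall fun x => ?_)
    rw [Real.norm_of_nonneg (frobSq_nonneg _)]
    exact (frobSq_le _).trans (by gcongr; exact hnorm x)
  have hmini : Integrable (fun x => min (d : ℝ) (4 * frobSq (fderiv ℝ H x - 1))) ν :=
    (integrable_const _).inf (hfri.const_mul 4)
  have hlκ : 0 ≤ -Real.log κ := by
    have := Real.log_nonpos hκ.le hκ1; linarith
  have hmin : ∫ x, min (d : ℝ) (4 * frobSq (fderiv ℝ H x - 1)) ∂ν
      ≤ min (d : ℝ) (4 * ∫ x, frobSq (fderiv ℝ H x - 1) ∂ν) := by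
    refine le_min ?_ ?_
    · have := integral_mono hmini (integrable_const (d : ℝ)) fun x => min_le_left _ _
      simpa using this
    · rw [← integral_const_mul]
      exact integral_mono hmini (hfri.const_mul 4) fun x => min_le_right _ _
  have hsn : Integrable (fun x => -inner ℝ (score p x) (H x - x)) ν := hsi.neg
  have i1 : Integrable (fun x => -inner ℝ (score p x) (H x - x) + ℓ * ‖H x - x‖ ^ 2) ν :=
    hsn.add (hGsq.const_mul ℓ)
  calc ∫ x, W x ∂ν
      ≤ ∫ x, (-inner ℝ (score p x) (H x - x) + ℓ * ‖H x - x‖ ^ 2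
          - Real.log |(fderiv ℝ H x).det|) ∂ν := by
        refine integral_mono hWi (i1.sub hlogi) fun x => ?_
        have h1 := (abs_le.1 (htaylor x)).1
        simp only [hW]
        linarith
    _ = ∫ x, (trc (fderiv ℝ H x - 1) - Real.log |(fderiv ℝ H x).det|) ∂ν
          + ℓ * ∫ x, ‖H x - x‖ ^ 2 ∂ν := by
        rw [integral_sub i1 hlogi, integral_add hsn (hGsq.const_mul ℓ),
          integral_sub htri hlogi, hdiv, integral_neg, integral_const_mul]
        ring
    _ ≤ ∫ x, (2 * frobSq (fderiv ℝ H x - 1)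
          + -Real.log κ * min (d : ℝ) (4 * frobSq (fderiv ℝ H x - 1))) ∂ν
          + ℓ * ∫ x, ‖H x - x‖ ^ 2 ∂ν := by
        gcongr ?_ + _
        exact integral_mono (htri.sub hlogi) ((hfri.const_mul 2).add (hmini.const_mul _))
          fun x => trc_sub_log_abs_det_le _ hκ hκ1 (hlow x)
    _ = 2 * ∫ x, frobSq (fderiv ℝ H x - 1) ∂ν
          + -Real.log κ * ∫ x, min (d : ℝ) (4 * frobSq (fderiv ℝ H x - 1)) ∂ν
          + ℓ * ∫ x, ‖H x - x‖ ^ 2 ∂ν := by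
        rw [integral_add (hfri.const_mul 2) (hmini.const_mul _), integral_const_mul,
          integral_const_mul]
    _ ≤ _ := by gcongr

end IsLogSmoothDensity

/-! ### The flow of a differential equation with integrable Lipschitz rate -/

/-- Grönwall's inequality for a vector-valued function, forwards and backwards in time. -/
theorem norm_le_exp_mul_of_norm_sub_le {F : Type*} [NormedAddCommGroup F] {φ : ℝ → F}
    {L g : ℝ → ℝ} {T : ℝ} (hL : IntervalIntegrable L volume 0 T)
    (hL0 : ∀ t ∈ Icc 0 T, 0 ≤ L t) (hg : IntervalIntegrable g volume 0 T)
    (hg0 : ∀ t ∈ Icc 0 T, 0 ≤ g t) (hφ : ContinuousOn φ (Icc 0 T))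
    (h : ∀ s ∈ Icc 0 T, ∀ t ∈ Icc 0 T, s ≤ t →
      ‖φ t - φ s‖ ≤ ∫ τ in s..t, (L τ * ‖φ τ‖ + g τ))
    {s t : ℝ} (hs : s ∈ Icc 0 T) (ht : t ∈ Icc 0 T) :
    ‖φ t‖ ≤ Real.exp (∫ τ in (0 : ℝ)..T, L τ) * (‖φ s‖ + ∫ τ in (0 : ℝ)..T, g τ) := by
  have hT : (0 : ℝ) ≤ T := hs.1.trans hs.2
  have hsub : ∀ a b, a ∈ Icc 0 T → b ∈ Icc 0 T → uIcc a b ⊆ uIcc 0 T := fun a b ha hb => by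
    rw [uIcc_of_le hT]; exact uIcc_subset_Icc ha hb
  have hLi : ∀ a b, a ∈ Icc 0 T → b ∈ Icc 0 T → IntervalIntegrable L volume a b :=
    fun a b ha hb => hL.mono_set (hsub a b ha hb)
  have hgi : ∀ a b, a ∈ Icc 0 T → b ∈ Icc 0 T → IntervalIntegrable g volume a b :=
    fun a b ha hb => hg.mono_set (hsub a b ha hb)
  have hLφ : ∀ a b, a ∈ Icc 0 T → b ∈ Icc 0 T →
      IntervalIntegrable (fun τ => L τ * ‖φ τ‖) volume a b := fun a b ha hb =>
    (hLi a b ha hb).mul_continuousOn (hφ.norm.mono (uIcc_subset_Icc ha hb))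
  have hmono : ∀ {f : ℝ → ℝ}, IntervalIntegrable f volume 0 T → (∀ t ∈ Icc 0 T, 0 ≤ f t) →
      ∀ a b, a ∈ Icc 0 T → b ∈ Icc 0 T → a ≤ b → ∫ τ in a..b, f τ ≤ ∫ τ in (0 : ℝ)..T, f τ := by
    intro f hf hf0 a b ha hb hab
    refine intervalIntegral.integral_mono_interval ha.1 hab hb.2 ?_ hf
    filter_upwards [ae_restrict_mem measurableSet_Ioc] with τ hτ
    exact hf0 τ (Ioc_subset_Icc_self hτ)
  set c := ‖φ s‖ + ∫ τ in (0 : ℝ)..T, g τ with hc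
  have hc0 : 0 ≤ c := by
    have := intervalIntegral.integral_nonneg (μ := volume) hT hg0
    positivity
  have hstep : ∀ a ∈ Icc 0 T, ∀ b ∈ Icc 0 T, a ≤ b →
      ‖φ b - φ a‖ ≤ (∫ τ in a..b, L τ * ‖φ τ‖) + ∫ τ in (0 : ℝ)..T, g τ := by
    intro a ha b hb hab
    have h1 := h a ha b hb hab
    rw [intervalIntegral.integral_add (hLφ a b ha hb) (hgi a b ha hb)] at h1
    linarith [hmono hg hg0 a b ha hb hab]
  rcases le_total s t with hst | hst
  · have key := le_mul_exp_of_le_add_integral (φ := fun τ => ‖φ τ‖) (c := c) hst (hLi s t hs ht)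
      (fun τ hτ => hL0 τ ⟨hs.1.trans hτ.1, hτ.2.trans ht.2⟩)
      (hφ.norm.mono (Icc_subset_Icc hs.1 ht.2)) (fun τ hτ => by
        have h1 := hstep s hs τ ⟨hs.1.trans hτ.1, hτ.2.trans ht.2⟩ hτ.1
        have h2 := norm_sub_norm_le (φ τ) (φ s)
        simp only [hc]
        linarith) t (right_mem_Icc.2 hst)
    rw [mul_comm]
    refine key.trans ?_
    gcongr
    exact hmono hL hL0 s t hs ht hst
  · have hmem : ∀ τ ∈ Icc 0 (s - t), s - τ ∈ Icc 0 T := fun τ hτ =>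
      ⟨by linarith [hτ.2, ht.1], by linarith [hτ.1, hs.2]⟩
    have hmaps : MapsTo (fun τ => s - τ) (Icc 0 (s - t)) (Icc 0 T) := hmem
    have hLr : IntervalIntegrable (fun τ => L (s - τ)) volume 0 (s - t) := by
      have := (hLi s t hs ht).comp_sub_left s
      simpa using this
    have key := le_mul_exp_of_le_add_integral (φ := fun τ => ‖φ (s - τ)‖) (c := c)
      (L := fun τ => L (s - τ)) (sub_nonneg.2 hst) hLr (fun τ hτ => hL0 _ (hmem τ hτ))
      ((hφ.comp (by fun_prop) hmaps).norm) (fun τ hτ => by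
        have h1 := hstep (s - τ) (hmem τ hτ) s hs (by linarith [hτ.1])
        have h2 := norm_sub_norm_le (φ (s - τ)) (φ s)
        rw [norm_sub_rev] at h2
        have h3 : ∫ u in (0 : ℝ)..τ, L (s - u) * ‖φ (s - u)‖ = ∫ u in (s - τ)..s, L u * ‖φ u‖ := by
          rw [intervalIntegral.integral_comp_sub_left (fun u => L u * ‖φ u‖), sub_zero]
        rw [h3]
        simp only [hc]
        linarith) (s - t) (right_mem_Icc.2 (sub_nonneg.2 hst))
    simp only [sub_sub_cancel] at key
    rw [mul_comm]
    refine key.trans ?_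
    gcongr
    rw [intervalIntegral.integral_comp_sub_left L, sub_sub_cancel, sub_zero]
    exact hmono hL hL0 t s ht hs hst

/-- `u` solves the equation `du_t = μ_t(u_t) dt` on `[0, T]`, in the integrated sense. -/
def IsSolution {E : Type*} [NormedAddCommGroup E] [NormedSpace ℝ E] (T : ℝ) (μ : ℝ → E → E)
    (u : ℝ → E) : Prop :=
  IntervalIntegrable (fun s => μ s (u s)) volume 0 T ∧
    ∀ t ∈ Icc 0 T, u t = u 0 + ∫ s in (0 : ℝ)..t, μ s (u s)

/-- The drift `μ_t` is `L_t`-Lipschitz with `M`-Lipschitz derivative, in four-point form, and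
`L` is integrable. -/
structure IsRegularDrift {E : Type*} [NormedAddCommGroup E] (T : ℝ) (μ : ℝ → E → E) (L : ℝ → ℝ)
    (M : ℝ) : Prop where
  integrable : IntervalIntegrable L volume 0 T
  nonneg : ∀ t ∈ Icc 0 T, 0 ≤ L t
  nonneg' : 0 ≤ M
  fourPoint : ∀ t ∈ Icc 0 T, FourPoint (μ t) (L t) M

section Flow

variable {E : Type*} [NormedAddCommGroup E] [NormedSpace ℝ E] {T M : ℝ} {μ : ℝ → E → E}
  {L : ℝ → ℝ}

/-- If `u` is an integral of `f` on `[0, T]`, then it is continuous and has increments given by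
the integral. -/
theorem continuousOn_and_sub_eq_integral [CompleteSpace E] {u f : ℝ → E} {T : ℝ} (hT : 0 ≤ T)
    (hf : IntervalIntegrable f volume 0 T)
    (hu : ∀ t ∈ Icc 0 T, u t = u 0 + ∫ s in (0 : ℝ)..t, f s) :
    ContinuousOn u (Icc 0 T) ∧
      ∀ s ∈ Icc 0 T, ∀ t ∈ Icc 0 T, IntervalIntegrable f volume s t ∧
        u t - u s = ∫ τ in s..t, f τ := by
  have hfi : ∀ s ∈ Icc 0 T, ∀ t ∈ Icc 0 T, IntervalIntegrable f volume s t := fun s hs t ht =>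
    hf.mono_set (by rw [uIcc_of_le hT]; exact uIcc_subset_Icc hs ht)
  refine ⟨?_, fun s hs t ht => ⟨hfi s hs t ht, ?_⟩⟩
  · have h1 : ContinuousOn (fun t => u 0 + ∫ s in (0 : ℝ)..t, f s) (Icc 0 T) := by
      have := intervalIntegral.continuousOn_primitive_interval (μ := volume) (a := 0) (b := T)
        (f := f) (by rw [uIcc_of_le hT, integrableOn_Icc_iff_integrableOn_Ioc]
                     exact (intervalIntegrable_iff_integrableOn_Ioc_of_le hT).1 hf)
      rw [uIcc_of_le hT] at this
      exact continuousOn_const.add this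
    exact h1.congr hu
  · have h0 : (0 : ℝ) ∈ Icc 0 T := ⟨le_rfl, hT⟩
    rw [hu t ht, hu s hs, add_sub_add_left_eq_sub,
      intervalIntegral.integral_interval_sub_left (hfi 0 h0 t ht) (hfi 0 h0 s hs)]

variable [CompleteSpace E]

theorem IsRegularDrift.norm_sub_le_of_isSolution (hμ : IsRegularDrift T μ L M) {u v : ℝ → E}
    (hu : IsSolution T μ u) (hv : IsSolution T μ v) {s t : ℝ} (hs : s ∈ Icc 0 T)
    (ht : t ∈ Icc 0 T) :
    ‖u t - v t‖ ≤ Real.exp (∫ τ in (0 : ℝ)..T, L τ) * ‖u s - v s‖ := by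
  have hT : (0 : ℝ) ≤ T := hs.1.trans hs.2
  obtain ⟨huc, hui⟩ := continuousOn_and_sub_eq_integral hT hu.1 hu.2
  obtain ⟨hvc, hvi⟩ := continuousOn_and_sub_eq_integral hT hv.1 hv.2
  have := norm_le_exp_mul_of_norm_sub_le (φ := fun t => u t - v t) (g := fun _ => 0)
    hμ.integrable hμ.nonneg (by simp) (by simp) (huc.sub hvc) (fun a ha b hb hab => by
      have e : u b - v b - (u a - v a) = ∫ τ in a..b, (μ τ (u τ) - μ τ (v τ)) := by
        rw [intervalIntegral.integral_sub (hui a ha b hb).1 (hvi a ha b hb).1,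
          ← (hui a ha b hb).2, ← (hvi a ha b hb).2]
        abel
      rw [e]
      have hLi : IntervalIntegrable L volume a b := hμ.integrable.mono_set (by
        rw [uIcc_of_le hT]; exact uIcc_subset_Icc ha hb)
      refine intervalIntegral.norm_integral_le_of_norm_le hab ?_ ((hLi.mul_continuousOn
        ((huc.sub hvc).norm.mono (uIcc_subset_Icc ha hb))).add (by simp))
      refine Filter.Eventually.of_forall fun τ hτ => ?_
      have hτ' : τ ∈ Icc 0 T := ⟨ha.1.trans hτ.1.le, hτ.2.trans hb.2⟩
      rw [add_zero]
      exact (hμ.fourPoint τ hτ').norm_sub_le _ _) hs ht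
  simpa using this

theorem IsRegularDrift.fourPoint_of_isSolution (hμ : IsRegularDrift T μ L M) {x y z w : ℝ → E}
    (hx : IsSolution T μ x) (hy : IsSolution T μ y) (hz : IsSolution T μ z)
    (hw : IsSolution T μ w) {s t : ℝ} (hs : s ∈ Icc 0 T) (ht : t ∈ Icc 0 T) :
    ‖x t - y t - z t + w t‖
      ≤ Real.exp (∫ τ in (0 : ℝ)..T, L τ) * ‖x s - y s - z s + w s‖
        + M * T * Real.exp (∫ τ in (0 : ℝ)..T, L τ) ^ 3 * ‖y s - w s‖ * ‖z s - w s‖ := by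
  have hT : (0 : ℝ) ≤ T := hs.1.trans hs.2
  have hM := hμ.nonneg'
  set Λ := Real.exp (∫ τ in (0 : ℝ)..T, L τ) with hΛ
  obtain ⟨hxc, hxi⟩ := continuousOn_and_sub_eq_integral hT hx.1 hx.2
  obtain ⟨hyc, hyi⟩ := continuousOn_and_sub_eq_integral hT hy.1 hy.2
  obtain ⟨hzc, hzi⟩ := continuousOn_and_sub_eq_integral hT hz.1 hz.2
  obtain ⟨hwc, hwi⟩ := continuousOn_and_sub_eq_integral hT hw.1 hw.2
  have hc := ((hxc.sub hyc).sub hzc).add hwc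
  have := norm_le_exp_mul_of_norm_sub_le (φ := fun t => x t - y t - z t + w t)
    (g := fun _ => M * (Λ * ‖y s - w s‖) * (Λ * ‖z s - w s‖))
    hμ.integrable hμ.nonneg (by simp) (fun _ _ => by positivity) hc (fun a ha b hb hab => by
      have e : x b - y b - z b + w b - (x a - y a - z a + w a)
          = ∫ τ in a..b, (μ τ (x τ) - μ τ (y τ) - μ τ (z τ) + μ τ (w τ)) := by
        rw [intervalIntegral.integral_add (((hxi a ha b hb).1.sub (hyi a ha b hb).1).sub
            (hzi a ha b hb).1) (hwi a ha b hb).1,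
          intervalIntegral.integral_sub ((hxi a ha b hb).1.sub (hyi a ha b hb).1)
            (hzi a ha b hb).1, intervalIntegral.integral_sub (hxi a ha b hb).1 (hyi a ha b hb).1,
          ← (hxi a ha b hb).2, ← (hyi a ha b hb).2, ← (hzi a ha b hb).2, ← (hwi a ha b hb).2]
        abel
      rw [e]
      have hLi : IntervalIntegrable L volume a b := hμ.integrable.mono_set (by
        rw [uIcc_of_le hT]; exact uIcc_subset_Icc ha hb)
      refine intervalIntegral.norm_integral_le_of_norm_le hab ?_ ((hLi.mul_continuousOn
        (hc.norm.mono (uIcc_subset_Icc ha hb))).add (by simp))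
      refine Filter.Eventually.of_forall fun τ hτ => ?_
      have hτ' : τ ∈ Icc 0 T := ⟨ha.1.trans hτ.1.le, hτ.2.trans hb.2⟩
      refine (hμ.fourPoint τ hτ' _ _ _ _).trans ?_
      have h1 := hμ.norm_sub_le_of_isSolution hy hw hs hτ'
      have h2 := hμ.norm_sub_le_of_isSolution hz hw hs hτ'
      gcongr) hs ht
  refine this.trans (le_of_eq ?_)
  rw [intervalIntegral.integral_const, smul_eq_mul, ← hΛ]
  ring

/-- Stability: a curve with velocity `V` stays close to a solution, as long as `V` is close to
the drift along the curve. -/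
theorem IsRegularDrift.norm_sub_le_of_approx (hμ : IsRegularDrift T μ L M) {u v V : ℝ → E}
    (hu : IsSolution T μ u) (hV : IntervalIntegrable V volume 0 T)
    (hv : ∀ t ∈ Icc 0 T, v t = v 0 + ∫ s in (0 : ℝ)..t, V s)
    (he : IntervalIntegrable (fun t => ‖μ t (v t) - V t‖) volume 0 T) (hT : 0 ≤ T) :
    ‖v T - u T‖ ≤ Real.exp (∫ τ in (0 : ℝ)..T, L τ)
      * (‖v 0 - u 0‖ + ∫ t in (0 : ℝ)..T, ‖μ t (v t) - V t‖) := by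
  obtain ⟨huc, hui⟩ := continuousOn_and_sub_eq_integral hT hu.1 hu.2
  obtain ⟨hvc, hvi⟩ := continuousOn_and_sub_eq_integral hT hV hv
  refine norm_le_exp_mul_of_norm_sub_le (φ := fun t => v t - u t)
    hμ.integrable hμ.nonneg he (fun _ _ => norm_nonneg _) (hvc.sub huc) (fun a ha b hb hab => ?_)
    (left_mem_Icc.2 hT) (right_mem_Icc.2 hT)
  have e : v b - u b - (v a - u a) = ∫ τ in a..b, (V τ - μ τ (u τ)) := by
    rw [intervalIntegral.integral_sub (hvi a ha b hb).1 (hui a ha b hb).1,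
      ← (hui a ha b hb).2, ← (hvi a ha b hb).2]
    abel
  rw [e]
  have hsub : uIcc a b ⊆ uIcc 0 T := by rw [uIcc_of_le hT]; exact uIcc_subset_Icc ha hb
  refine intervalIntegral.norm_integral_le_of_norm_le hab ?_
    (((hμ.integrable.mono_set hsub).mul_continuousOn
    ((hvc.sub huc).norm.mono (uIcc_subset_Icc ha hb))).add (he.mono_set hsub))
  refine Filter.Eventually.of_forall fun τ hτ => ?_
  have hτ' : τ ∈ Icc 0 T := ⟨ha.1.trans hτ.1.le, hτ.2.trans hb.2⟩
  have h1 := (hμ.fourPoint τ hτ').norm_sub_le (v τ) (u τ)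
  have e2 : V τ - μ τ (u τ) = (μ τ (v τ) - μ τ (u τ)) - (μ τ (v τ) - V τ) := by abel
  rw [e2]
  exact (norm_sub_le _ _).trans (by gcongr)

end Flow

theorem denseRange_of_map_isOpenPosMeasure {Ω E : Type*} [MeasurableSpace Ω] {P : Measure Ω}
    [TopologicalSpace E] [MeasurableSpace E] [BorelSpace E] {f : Ω → E} (hf : Measurable f)
    (hpos : (P.map f).IsOpenPosMeasure) {s : Set Ω} (hs : ∀ᵐ ω ∂P, ω ∈ s) :
    DenseRange (fun i : s => f i) := by
  refine dense_iff_inter_open.2 fun U hU hne => ?_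
  by_contra hcon
  refine hU.measure_ne_zero (P.map f) hne ?_
  rw [Measure.map_apply hf hU.measurableSet]
  refine measure_mono_null (t := {ω | ¬ω ∈ s}) (fun ω hω hωs => ?_) (ae_iff.1 hs)
  exact hcon ⟨f ω, hω, ⟨⟨ω, hωs⟩, rfl⟩⟩

/-- The transition maps of the flow of `μ` between two times of `[0, T]`, with the paths they
transport and the estimates they satisfy. -/
structure IsFlow {E ι : Type*} [NormedAddCommGroup E] (T Λ K : ℝ) (y : ι → ℝ → E)
    (Φ : ℝ → ℝ → E → E) : Prop where
  dense : ∀ s ∈ Icc 0 T, DenseRange fun i => y i s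
  apply : ∀ s ∈ Icc 0 T, ∀ t ∈ Icc 0 T, ∀ i, Φ s t (y i s) = y i t
  fourPoint : ∀ s ∈ Icc 0 T, ∀ t ∈ Icc 0 T, FourPoint (Φ s t) Λ K

/-- A family of solutions whose values are dense at every time determines the flow: no solution
has to be constructed. -/
theorem IsRegularDrift.exists_isFlow {E ι : Type*} [NormedAddCommGroup E] [NormedSpace ℝ E]
    [FiniteDimensional ℝ E] {T M : ℝ} {μ : ℝ → E → E} {L : ℝ → ℝ} (hμ : IsRegularDrift T μ L M)
    {y : ι → ℝ → E} (hy : ∀ i, IsSolution T μ (y i))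
    (hd : ∀ s ∈ Icc 0 T, DenseRange fun i => y i s) :
    ∃ Φ, IsFlow T (Real.exp (∫ τ in (0 : ℝ)..T, L τ))
      (M * T * Real.exp (∫ τ in (0 : ℝ)..T, L τ) ^ 3) y Φ := by
  have : CompleteSpace E := FiniteDimensional.complete ℝ E
  have : ∀ s t, ∃ f : E → E, s ∈ Icc 0 T → t ∈ Icc 0 T →
      FourPoint f (Real.exp (∫ τ in (0 : ℝ)..T, L τ))
        (M * T * Real.exp (∫ τ in (0 : ℝ)..T, L τ) ^ 3) ∧ ∀ i, f (y i s) = y i t := by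
    intro s t
    by_cases hs : s ∈ Icc 0 T
    · by_cases ht : t ∈ Icc 0 T
      · obtain ⟨f, hf, hfy⟩ := FourPoint.exists_extension (hd s hs) (z := fun i => y i t)
          fun i j k l => hμ.fourPoint_of_isSolution (hy i) (hy j) (hy k) (hy l) hs ht
        exact ⟨f, fun _ _ => ⟨hf, hfy⟩⟩
      · exact ⟨fun x => x, fun _ h => absurd h ht⟩
    · exact ⟨fun x => x, fun h => absurd h hs⟩
  choose Φ hΦ using this
  exact ⟨Φ, hd, fun s hs t ht i => (hΦ s t hs ht).2 i, fun s hs t ht => (hΦ s t hs ht).1⟩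

theorem IsFlow.comp_apply {E ι : Type*} [NormedAddCommGroup E] {T Λ K : ℝ} {y : ι → ℝ → E}
    {Φ : ℝ → ℝ → E → E} (hΦ : IsFlow T Λ K y Φ) {r s t : ℝ} (hr : r ∈ Icc 0 T) (hs : s ∈ Icc 0 T)
    (ht : t ∈ Icc 0 T) (x : E) : Φ s t (Φ r s x) = Φ r t x := by
  refine congrFun ((hΦ.dense r hr).equalizer (g := fun x => Φ s t (Φ r s x)) ?_ ?_ ?_) x
  · exact (hΦ.fourPoint s hs t ht).continuous.comp (hΦ.fourPoint r hr s hs).continuous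
  · exact (hΦ.fourPoint r hr t ht).continuous
  · funext i
    simp only [Function.comp_apply]
    rw [hΦ.apply r hr s hs, hΦ.apply s hs t ht, hΦ.apply r hr t ht]

theorem IsFlow.self_apply {E ι : Type*} [NormedAddCommGroup E] {T Λ K : ℝ} {y : ι → ℝ → E}
    {Φ : ℝ → ℝ → E → E} (hΦ : IsFlow T Λ K y Φ) {s : ℝ} (hs : s ∈ Icc 0 T) (x : E) :
    Φ s s x = x := by
  refine congrFun ((hΦ.dense s hs).equalizer (g := Φ s s) (h := fun x => x) ?_ continuous_id ?_) x
  · exact (hΦ.fourPoint s hs s hs).continuous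
  · funext i
    simp only [Function.comp_apply]
    rw [hΦ.apply s hs s hs]

/-- The stability estimate, for the flow line through an arbitrary starting point. -/
theorem IsFlow.norm_sub_le_of_approx {E ι : Type*} [NormedAddCommGroup E] [NormedSpace ℝ E]
    [CompleteSpace E] {T M K : ℝ} {μ : ℝ → E → E} {L : ℝ → ℝ} {y : ι → ℝ → E}
    {Φ : ℝ → ℝ → E → E} (hμ : IsRegularDrift T μ L M) (hy : ∀ i, IsSolution T μ (y i))
    (hΦ : IsFlow T (Real.exp (∫ τ in (0 : ℝ)..T, L τ)) K y Φ) (hT : 0 ≤ T) {v V : ℝ → E}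
    (hV : IntervalIntegrable V volume 0 T)
    (hv : ∀ t ∈ Icc 0 T, v t = v 0 + ∫ s in (0 : ℝ)..t, V s)
    (he : IntervalIntegrable (fun t => ‖μ t (v t) - V t‖) volume 0 T) :
    ‖v T - Φ 0 T (v 0)‖ ≤ Real.exp (∫ τ in (0 : ℝ)..T, L τ)
      * ∫ t in (0 : ℝ)..T, ‖μ t (v t) - V t‖ := by
  have h0 : (0 : ℝ) ∈ Icc 0 T := left_mem_Icc.2 hT
  have hT' : T ∈ Icc 0 T := right_mem_Icc.2 hT
  have hc := (hΦ.fourPoint 0 h0 T hT').continuous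
  have key : ∀ z, ‖v T - Φ 0 T z‖ ≤ Real.exp (∫ τ in (0 : ℝ)..T, L τ)
      * (‖v 0 - z‖ + ∫ t in (0 : ℝ)..T, ‖μ t (v t) - V t‖) := by
    intro z
    refine (hΦ.dense 0 h0).induction_on (p := fun z => ‖v T - Φ 0 T z‖
      ≤ Real.exp (∫ τ in (0 : ℝ)..T, L τ)
        * (‖v 0 - z‖ + ∫ t in (0 : ℝ)..T, ‖μ t (v t) - V t‖)) z ?_ fun i => ?_
    · exact isClosed_le (by fun_prop) (by fun_prop)
    · rw [hΦ.apply 0 h0 T hT']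
      exact hμ.norm_sub_le_of_approx (hy i) hV hv he hT
  simpa using key (v 0)

/-! ### The interpolated Euler scheme -/

section Euler

variable {E : Type*} [NormedAddCommGroup E] [NormedSpace ℝ E]

/-- The `k`-th iterate of the Euler scheme with step `h` and drifts `b 0, b 1, …`, as a function
of the starting point. -/
def eulerPoint (h : ℝ) (b : ℕ → E → E) : ℕ → E → E
  | 0 => fun x => x
  | k + 1 => fun x => eulerPoint h b k x + h • b k (eulerPoint h b k x)

/-- The velocity at time `t` of the interpolated Euler scheme started at `x`. -/
noncomputable def eulerVel (h : ℝ) (b : ℕ → E → E) (t : ℝ) (x : E) : E :=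
  b ⌊t / h⌋₊ (eulerPoint h b ⌊t / h⌋₊ x)

/-- The position at time `t` of the interpolated Euler scheme started at `x`. -/
noncomputable def eulerPath (h : ℝ) (b : ℕ → E → E) (t : ℝ) (x : E) : E :=
  eulerPoint h b ⌊t / h⌋₊ x + (t - gridTime h t) • eulerVel h b t x

variable {h : ℝ} {b : ℕ → E → E}

theorem floor_div_eq (hh : 0 < h) {k : ℕ} {t : ℝ} (ht : t ∈ Ico ((k : ℝ) * h) (((k : ℝ) + 1) * h)) :
    ⌊t / h⌋₊ = k := by
  rw [Nat.floor_eq_iff (div_nonneg ((by positivity : (0 : ℝ) ≤ k * h).trans ht.1) hh.le)]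
  exact ⟨(le_div_iff₀ hh).2 ht.1, (div_lt_iff₀ hh).2 ht.2⟩

theorem mem_Ico_floor_div (hh : 0 < h) {t : ℝ} (ht : 0 ≤ t) :
    t ∈ Ico ((⌊t / h⌋₊ : ℝ) * h) (((⌊t / h⌋₊ : ℝ) + 1) * h) :=
  ⟨(le_div_iff₀ hh).1 (Nat.floor_le (div_nonneg ht hh.le)),
    (div_lt_iff₀ hh).1 (Nat.lt_floor_add_one _)⟩

theorem eulerPath_natCast_mul (hh : 0 < h) (k : ℕ) (x : E) :
    eulerPath h b (k * h) x = eulerPoint h b k x := by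
  have : ⌊(k : ℝ) * h / h⌋₊ = k := floor_div_eq hh ⟨le_rfl, by linarith⟩
  simp only [eulerPath, gridTime, this, sub_self, zero_smul, add_zero]

theorem eulerPath_eq_of_mem_Icc (hh : 0 < h) {k : ℕ} {t : ℝ}
    (ht : t ∈ Icc ((k : ℝ) * h) (((k : ℝ) + 1) * h)) (x : E) :
    eulerPath h b t x = eulerPoint h b k x + (t - k * h) • b k (eulerPoint h b k x) := by
  rcases ht.2.eq_or_lt with rfl | hlt
  · have := eulerPath_natCast_mul (b := b) hh (k + 1) x
    push_cast at this
    rw [this, eulerPoint, show ((k : ℝ) + 1) * h - k * h = h by ring]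
  · simp only [eulerPath, eulerVel, gridTime, floor_div_eq hh ⟨ht.1, hlt⟩]

theorem eulerVel_ae_eq (hh : 0 < h) {k : ℕ} {t : ℝ}
    (ht : t ∈ Icc ((k : ℝ) * h) (((k : ℝ) + 1) * h)) (x : E) :
    (fun s => eulerVel h b s x) =ᵐ[volume.restrict (uIoc ((k : ℝ) * h) t)]
      fun _ => b k (eulerPoint h b k x) := by
  rw [uIoc_of_le ht.1, ← restrict_Ioo_eq_restrict_Ioc]
  filter_upwards [ae_restrict_mem measurableSet_Ioo] with s hs
  simp only [eulerVel, floor_div_eq hh ⟨hs.1.le, hs.2.trans_le ht.2⟩]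

theorem eulerVel_integrable_and_integral [CompleteSpace E] (hh : 0 < h) (x : E) {t : ℝ}
    (ht : 0 ≤ t) :
    IntervalIntegrable (fun s => eulerVel h b s x) volume 0 t ∧
      eulerPath h b t x = x + ∫ s in (0 : ℝ)..t, eulerVel h b s x := by
  have step : ∀ (k : ℕ) (t : ℝ), t ∈ Icc ((k : ℝ) * h) (((k : ℝ) + 1) * h) →
      IntervalIntegrable (fun s => eulerVel h b s x) volume 0 (k * h) →
      eulerPoint h b k x = x + ∫ s in (0 : ℝ)..(k * h), eulerVel h b s x →
      IntervalIntegrable (fun s => eulerVel h b s x) volume 0 t ∧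
        eulerPath h b t x = x + ∫ s in (0 : ℝ)..t, eulerVel h b s x := by
    intro k t ht hi he
    have hae := eulerVel_ae_eq (b := b) hh ht x
    have hi2 : IntervalIntegrable (fun s => eulerVel h b s x) volume (k * h) t :=
      (intervalIntegrable_const (c := b k (eulerPoint h b k x))).congr_ae hae.symm
    refine ⟨hi.trans hi2, ?_⟩
    rw [eulerPath_eq_of_mem_Icc hh ht, ← intervalIntegral.integral_add_adjacent_intervals hi hi2,
      intervalIntegral.integral_congr_ae_restrict hae, intervalIntegral.integral_const, ← add_assoc,
      ← he]
  have grid : ∀ k : ℕ, IntervalIntegrable (fun s => eulerVel h b s x) volume 0 (k * h) ∧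
      eulerPoint h b k x = x + ∫ s in (0 : ℝ)..(k * h), eulerVel h b s x := by
    intro k
    induction k with
    | zero => simp [eulerPoint]
    | succ k ih =>
      have := step k ((k + 1 : ℕ) * h) ⟨by push_cast; nlinarith, by push_cast; rfl⟩ ih.1 ih.2
      rwa [eulerPath_natCast_mul hh] at this
  have hmem := mem_Ico_floor_div hh ht
  exact step _ t ⟨hmem.1, hmem.2.le⟩ (grid _).1 (grid _).2

/-- A curve obeying the recursion of the scheme up to time `T` is the interpolated scheme started
at its initial value. -/
theorem eq_eulerPath_of_step (hh : 0 < h) {T : ℝ} {u : ℝ → E}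
    (hu : ∀ k : ℕ, ∀ t ∈ Icc ((k : ℝ) * h) (((k : ℝ) + 1) * h), t ≤ T →
      u t = u (k * h) + (t - k * h) • b k (u (k * h))) {t : ℝ} (ht : t ∈ Icc 0 T) :
    u t = eulerPath h b t (u 0) ∧ u (gridTime h t) = eulerPoint h b ⌊t / h⌋₊ (u 0) := by
  have grid : ∀ k : ℕ, k * h ≤ T → u (k * h) = eulerPoint h b k (u 0) := by
    intro k
    induction k with
    | zero => simp [eulerPoint]
    | succ k ih =>
      intro hk
      push_cast at hk ⊢
      have h1 : (k : ℝ) * h ≤ T := by nlinarith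
      rw [hu k _ ⟨by nlinarith, le_rfl⟩ hk, ih h1, eulerPoint]
      congr 2
      ring
  have hmem := mem_Ico_floor_div hh ht.1
  have hg := grid _ (hmem.1.trans ht.2)
  refine ⟨?_, hg⟩
  rw [hu _ t ⟨hmem.1, hmem.2.le⟩ ht.2, hg]
  rfl

section Regularity

variable {T M : ℝ} {L : ℝ → ℝ}

/-- One step of the scheme distorts distances by a factor between `exp (-2 I)` and `exp I`, where
`I` is the integral of the Lipschitz rate over the step. -/
theorem fourPoint_eulerStep (hh : 0 < h) (hL : IntervalIntegrable L volume 0 T)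
    (hL0 : ∀ t ∈ Icc 0 T, 0 ≤ L t)
    (hb : ∀ t ∈ Icc 0 T, FourPoint (b ⌊t / h⌋₊) (L t) M) (hLh : ∀ t ∈ Icc 0 T, h * L t ≤ 1 / 2)
    {k : ℕ} {t : ℝ} (ht : t ∈ Icc ((k : ℝ) * h) (((k : ℝ) + 1) * h)) (htT : t ≤ T) :
    FourPoint (fun x => x + (t - k * h) • b k x) (Real.exp (∫ s in ((k : ℝ) * h)..t, L s))
        ((t - k * h) * M) ∧
      ∀ x y, Real.exp (-2 * ∫ s in ((k : ℝ) * h)..t, L s) * ‖x - y‖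
        ≤ ‖x + (t - k * h) • b k x - (y + (t - k * h) • b k y)‖ := by
  have hk0 : (0 : ℝ) ≤ k * h := by positivity
  have hτ : 0 ≤ t - k * h := sub_nonneg.2 ht.1
  have hT : 0 ≤ T := hk0.trans (ht.1.trans htT)
  have hmem : ∀ s ∈ Icc ((k : ℝ) * h) t, s ∈ Icc 0 T := fun s hs =>
    ⟨hk0.trans hs.1, hs.2.trans htT⟩
  have hLi : IntervalIntegrable L volume (k * h) t := hL.mono_set (by
    rw [uIcc_of_le ht.1, uIcc_of_le hT]; exact hmem)
  set I := ∫ s in ((k : ℝ) * h)..t, L s with hI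
  have hI0 : 0 ≤ I := intervalIntegral.integral_nonneg ht.1 fun s hs => hL0 s (hmem s hs)
  have hfp : FourPoint (fun x => (t - k * h) • b k x) I ((t - k * h) * M) := by
    intro x y z w
    have h1 : ∫ _ in ((k : ℝ) * h)..t, ‖b k x - b k y - b k z + b k w‖
        ≤ ∫ s in ((k : ℝ) * h)..t, (L s * ‖x - y - z + w‖ + M * ‖y - w‖ * ‖z - w‖) := by
      refine intervalIntegral.integral_mono_on_of_le_Ioo ht.1 (by simp)
        ((hLi.mul_const _).add (by simp)) fun s hs => ?_
      have := hb s (hmem s ⟨hs.1.le, hs.2.le⟩) x y z w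
      rwa [floor_div_eq hh ⟨hs.1.le, hs.2.trans_le ht.2⟩] at this
    rw [intervalIntegral.integral_add (hLi.mul_const _) (by simp),
      intervalIntegral.integral_mul_const, intervalIntegral.integral_const,
      intervalIntegral.integral_const, smul_eq_mul, smul_eq_mul, ← hI] at h1
    rw [← smul_sub, ← smul_sub, ← smul_add, norm_smul, Real.norm_of_nonneg hτ]
    linarith
  have hI1 : I ≤ 1 / 2 := by
    have h1 : ∫ s in ((k : ℝ) * h)..t, h * L s ≤ ∫ _ in ((k : ℝ) * h)..t, (1 / 2 : ℝ) :=
      intervalIntegral.integral_mono_on ht.1 (hLi.const_mul h) (by simp)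
        fun s hs => hLh s (hmem s hs)
    rw [intervalIntegral.integral_const_mul, intervalIntegral.integral_const, smul_eq_mul,
      ← hI] at h1
    have h2 : t - k * h ≤ h := by linarith [ht.2]
    nlinarith
  refine ⟨?_, fun x y => ?_⟩
  · refine (FourPoint.id.add hfp).mono ?_ (by simp)
    linarith [Real.add_one_le_exp I]
  · have h1 := hfp.norm_sub_le x y
    have e : x + (t - k * h) • b k x - (y + (t - k * h) • b k y)
        = (x - y) - ((t - k * h) • b k y - (t - k * h) • b k x) := by abel
    have h2 := norm_sub_norm_le (x - y) ((t - k * h) • b k y - (t - k * h) • b k x)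
    rw [norm_sub_rev ((t - k * h) • b k y), ← e] at h2
    have h3 : Real.exp (-2 * I) ≤ 1 - I := by
      rw [neg_mul, Real.exp_neg]
      refine inv_le_of_inv_le₀ (by linarith) ?_
      refine le_trans ?_ (Real.add_one_le_exp (2 * I))
      rw [inv_le_iff_one_le_mul₀ (by linarith)]
      nlinarith
    nlinarith [norm_nonneg (x - y)]

theorem fourPoint_eulerPath (hh : 0 < h) (hL : IntervalIntegrable L volume 0 T)
    (hL0 : ∀ t ∈ Icc 0 T, 0 ≤ L t) (hM : 0 ≤ M)
    (hb : ∀ t ∈ Icc 0 T, FourPoint (b ⌊t / h⌋₊) (L t) M) (hLh : ∀ t ∈ Icc 0 T, h * L t ≤ 1 / 2)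
    {t : ℝ} (ht : t ∈ Icc 0 T) :
    FourPoint (eulerPath h b t) (Real.exp (∫ s in (0 : ℝ)..t, L s))
        (M * t * Real.exp (∫ s in (0 : ℝ)..t, L s) ^ 2) ∧
      ∀ x y, Real.exp (-2 * ∫ s in (0 : ℝ)..t, L s) * ‖x - y‖
        ≤ ‖eulerPath h b t x - eulerPath h b t y‖ := by
  have hT : 0 ≤ T := ht.1.trans ht.2
  have hLi : ∀ r s, r ∈ Icc 0 T → s ∈ Icc 0 T → IntervalIntegrable L volume r s :=
    fun r s hr hs => hL.mono_set (by rw [uIcc_of_le hT]; exact uIcc_subset_Icc hr hs)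
  have step : ∀ (k : ℕ) (t : ℝ), t ∈ Icc ((k : ℝ) * h) (((k : ℝ) + 1) * h) → t ≤ T →
      (FourPoint (eulerPoint h b k) (Real.exp (∫ s in (0 : ℝ)..(k * h), L s))
          (M * (k * h) * Real.exp (∫ s in (0 : ℝ)..(k * h), L s) ^ 2) ∧
        ∀ x y, Real.exp (-2 * ∫ s in (0 : ℝ)..(k * h), L s) * ‖x - y‖
          ≤ ‖eulerPoint h b k x - eulerPoint h b k y‖) →
      FourPoint (eulerPath h b t) (Real.exp (∫ s in (0 : ℝ)..t, L s))
          (M * t * Real.exp (∫ s in (0 : ℝ)..t, L s) ^ 2) ∧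
        ∀ x y, Real.exp (-2 * ∫ s in (0 : ℝ)..t, L s) * ‖x - y‖
          ≤ ‖eulerPath h b t x - eulerPath h b t y‖ := by
    intro k t ht htT ih
    have hk0 : (0 : ℝ) ≤ k * h := by positivity
    have hkm : (k : ℝ) * h ∈ Icc 0 T := ⟨hk0, ht.1.trans htT⟩
    have hadd := intervalIntegral.integral_add_adjacent_intervals
      (hLi 0 (k * h) ⟨le_rfl, hT⟩ hkm) (hLi (k * h) t hkm ⟨hk0.trans ht.1, htT⟩)
    obtain ⟨hs1, hs2⟩ := fourPoint_eulerStep hh hL hL0 hb hLh ht htT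
    have e : eulerPath h b t = (fun x => x + (t - k * h) • b k x) ∘ eulerPoint h b k :=
      funext fun x => eulerPath_eq_of_mem_Icc hh ht x
    have hI0 : 0 ≤ ∫ s in ((k : ℝ) * h)..t, L s :=
      intervalIntegral.integral_nonneg ht.1 fun s hs => hL0 s ⟨hk0.trans hs.1, hs.2.trans htT⟩
    have hτ : 0 ≤ t - k * h := sub_nonneg.2 ht.1
    rw [← hadd, e]
    generalize (∫ s in (0 : ℝ)..(k * h), L s) = J at *
    generalize (∫ s in ((k : ℝ) * h)..t, L s) = I at *
    refine ⟨(hs1.comp ih.1 (Real.exp_nonneg _) (by positivity)).mono ?_ ?_, fun x y => ?_⟩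
    · rw [Real.exp_add, mul_comm]
    · rw [Real.exp_add]
      have h1 : 1 ≤ Real.exp I := Real.one_le_exp hI0
      have h2 : Real.exp I ≤ Real.exp I ^ 2 := le_self_pow₀ h1 two_ne_zero
      have h3 : (1 : ℝ) ≤ Real.exp I ^ 2 := h1.trans h2
      calc Real.exp I * (M * (k * h) * Real.exp J ^ 2) + (t - k * h) * M * Real.exp J ^ 2
          = (M * (k * h) * Real.exp J ^ 2) * Real.exp I
            + ((t - k * h) * M * Real.exp J ^ 2) * 1 := by ring
        _ ≤ (M * (k * h) * Real.exp J ^ 2) * Real.exp I ^ 2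
            + ((t - k * h) * M * Real.exp J ^ 2) * Real.exp I ^ 2 := by gcongr
        _ = M * t * (Real.exp J * Real.exp I) ^ 2 := by ring
    · refine le_trans ?_ (hs2 _ _)
      rw [mul_add, Real.exp_add, mul_comm (Real.exp _), mul_assoc]
      gcongr
      exact ih.2 x y
  have grid : ∀ k : ℕ, k * h ≤ T →
      FourPoint (eulerPoint h b k) (Real.exp (∫ s in (0 : ℝ)..(k * h), L s))
          (M * (k * h) * Real.exp (∫ s in (0 : ℝ)..(k * h), L s) ^ 2) ∧
        ∀ x y, Real.exp (-2 * ∫ s in (0 : ℝ)..(k * h), L s) * ‖x - y‖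
          ≤ ‖eulerPoint h b k x - eulerPoint h b k y‖ := by
    intro k
    induction k with
    | zero =>
      intro _
      simpa [eulerPoint] using FourPoint.id (E := E)
    | succ k ih =>
      intro hk
      have e : eulerPath h b ((k + 1 : ℕ) * h) = eulerPoint h b (k + 1) :=
        funext fun x => eulerPath_natCast_mul hh (k + 1) x
      have h2 : (k : ℝ) * h ≤ ((k + 1 : ℕ) : ℝ) * h := by push_cast; nlinarith
      rw [← e]
      exact step k _ ⟨h2, by push_cast; rfl⟩ hk (ih (h2.trans hk))
  have hmem := mem_Ico_floor_div hh ht.1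
  exact step _ t ⟨hmem.1, hmem.2.le⟩ ht.2 (grid _ (hmem.1.trans ht.2))

end Regularity

theorem measurable_eulerVel [MeasurableSpace E] [BorelSpace E] (hb : ∀ k, Continuous (b k)) :
    Measurable fun p : ℝ × E => eulerVel h b p.1 p.2 := by
  have hS : ∀ k, Continuous (eulerPoint h b k) := by
    intro k
    induction k with
    | zero => exact continuous_id
    | succ k ih => exact ih.add (((hb k).comp ih).const_smul h)
  have h1 : Measurable fun p : ℕ × E => b p.1 (eulerPoint h b p.1 p.2) :=
    measurable_from_prod_countable_right fun k => ((hb k).comp (hS k)).measurable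
  exact h1.comp ((Nat.measurable_floor.comp (measurable_fst.div_const h)).prodMk measurable_snd)

theorem measurable_eulerPath [MeasurableSpace E] [BorelSpace E] [SecondCountableTopology E]
    (hb : ∀ k, Continuous (b k)) :
    Measurable fun p : ℝ × E => eulerPath h b p.1 p.2 := by
  have hS : ∀ k, Continuous (eulerPoint h b k) := by
    intro k
    induction k with
    | zero => exact continuous_id
    | succ k ih => exact ih.add (((hb k).comp ih).const_smul h)
  have h1 : Measurable fun p : ℕ × E => eulerPoint h b p.1 p.2 :=
    measurable_from_prod_countable_right fun k => (hS k).measurable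
  have hfl : Measurable fun p : ℝ × E => ⌊p.1 / h⌋₊ :=
    Nat.measurable_floor.comp (measurable_fst.div_const h)
  have h2 : Measurable fun p : ℝ × E => p.1 - gridTime h p.1 :=
    measurable_fst.sub ((measurable_from_top.comp hfl).mul_const h)
  exact (h1.comp (hfl.prodMk measurable_snd)).add (h2.smul (measurable_eulerVel hb))

end Euler

/-! ### Stability of the flow in mean square -/

/-- The squared integral over `[0, T]` is at most `T` times the integral of the square. -/
theorem sq_lintegral_Ioc_le {T : ℝ} {f : ℝ → ℝ≥0∞} (hf : Measurable f) :
    (∫⁻ t in Ioc 0 T, f t) ^ 2 ≤ ENNReal.ofReal T * ∫⁻ t in Ioc 0 T, f t ^ 2 := by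
  have h := ENNReal.lintegral_mul_le_Lp_mul_Lq (volume.restrict (Ioc 0 T))
    Real.HolderConjugate.two_two (f := fun _ => 1) aemeasurable_const hf.aemeasurable
  simp only [Pi.mul_apply, one_mul, ENNReal.one_rpow, lintegral_const, Measure.restrict_apply,
    MeasurableSet.univ, univ_inter, Real.volume_Ioc, sub_zero] at h
  calc (∫⁻ t in Ioc 0 T, f t) ^ 2
      ≤ (ENNReal.ofReal T ^ (1 / 2 : ℝ) * (∫⁻ t in Ioc 0 T, f t ^ (2 : ℝ)) ^ (1 / 2 : ℝ)) ^ 2 := by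
        gcongr
    _ = ENNReal.ofReal T * ∫⁻ t in Ioc 0 T, f t ^ 2 := by
        rw [mul_pow, ← ENNReal.rpow_natCast, ← ENNReal.rpow_natCast, ← ENNReal.rpow_mul,
          ← ENNReal.rpow_mul]
        norm_num

/-- If the velocity `V` of the curves `Y` agrees with the drift up to an error of mean square
`g t` at time `t`, the endpoints of the curves are close to those of the flow in mean square. -/
theorem IsFlow.lintegral_enorm_sub_sq_le {E ι : Type*} [NormedAddCommGroup E] [NormedSpace ℝ E]
    [CompleteSpace E] [MeasurableSpace E] [BorelSpace E] [SecondCountableTopology E]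
    {T M K : ℝ} {μ : ℝ → E → E} {L : ℝ → ℝ} {y : ι → ℝ → E}
    {Φ : ℝ → ℝ → E → E} (hμ : IsRegularDrift T μ L M) (hy : ∀ i, IsSolution T μ (y i))
    (hΦ : IsFlow T (Real.exp (∫ τ in (0 : ℝ)..T, L τ)) K y Φ) (hT : 0 ≤ T)
    (hμm : Measurable fun p : ℝ × E => μ p.1 p.2) {Y V : ℝ → E → E}
    (hYm : Measurable fun p : ℝ × E => Y p.1 p.2) (hVm : Measurable fun p : ℝ × E => V p.1 p.2)
    (hV : ∀ x, IntervalIntegrable (fun t => V t x) volume 0 T)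
    (hY : ∀ x, ∀ t ∈ Icc 0 T, Y t x = x + ∫ s in (0 : ℝ)..t, V s x)
    {ρ : Measure E} [SFinite ρ] {g : ℝ → ℝ} (hg : IntervalIntegrable g volume 0 T)
    (hg0 : ∀ t ∈ Icc 0 T, 0 ≤ g t)
    (he : ∀ t ∈ Icc 0 T, ∫⁻ x, ‖μ t (Y t x) - V t x‖ₑ ^ 2 ∂ρ ≤ ENNReal.ofReal (g t)) :
    ∫⁻ x, ‖Y T x - Φ 0 T x‖ₑ ^ 2 ∂ρ ≤ ENNReal.ofReal
      (Real.exp (∫ τ in (0 : ℝ)..T, L τ) ^ 2 * T * ∫ t in (0 : ℝ)..T, g t) := by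
  set Λ := Real.exp (∫ τ in (0 : ℝ)..T, L τ) with hΛ
  have hΛ0 : 0 < Λ := Real.exp_pos _
  have hem : Measurable fun p : ℝ × E => μ p.1 (Y p.1 p.2) - V p.1 p.2 :=
    (hμm.comp (measurable_fst.prodMk hYm)).sub hVm
  have hemx : ∀ x, Measurable fun t => μ t (Y t x) - V t x := fun x =>
    hem.comp measurable_prodMk_right
  have hY0 : ∀ x, Y 0 x = x := fun x => by simpa using hY x 0 ⟨le_rfl, hT⟩
  have hpt : ∀ x, ‖Y T x - Φ 0 T x‖ₑ ^ 2 ≤ ENNReal.ofReal (Λ ^ 2 * T)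
      * ∫⁻ t in Ioc 0 T, ‖μ t (Y t x) - V t x‖ₑ ^ 2 := by
    intro x
    have h1 : ‖Y T x - Φ 0 T x‖ₑ ≤ ENNReal.ofReal Λ
        * ∫⁻ t in Ioc 0 T, ‖μ t (Y t x) - V t x‖ₑ := by
      by_cases hfin : ∫⁻ t in Ioc 0 T, ‖μ t (Y t x) - V t x‖ₑ = ∞
      · rw [hfin, ENNReal.mul_top (by simpa using hΛ0)]
        exact le_top
      · have hint : Integrable (fun t => μ t (Y t x) - V t x) (volume.restrict (Ioc 0 T)) :=
          ⟨(hemx x).aestronglyMeasurable, lt_top_iff_ne_top.2 hfin⟩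
        have h2 := IsFlow.norm_sub_le_of_approx (v := fun t => Y t x) hμ hy hΦ hT (hV x)
          (fun t ht => by rw [hY0]; exact hY x t ht)
          ((intervalIntegrable_iff_integrableOn_Ioc_of_le hT).2 hint.norm)
        rw [hY0, intervalIntegral.integral_of_le hT (f := fun t => ‖μ t (Y t x) - V t x‖)] at h2
        rw [← ofReal_norm, ← ofReal_integral_norm_eq_lintegral_enorm hint,
          ← ENNReal.ofReal_mul hΛ0.le]
        exact ENNReal.ofReal_le_ofReal h2
    calc ‖Y T x - Φ 0 T x‖ₑ ^ 2
        ≤ (ENNReal.ofReal Λ * ∫⁻ t in Ioc 0 T, ‖μ t (Y t x) - V t x‖ₑ) ^ 2 := by gcongr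
      _ ≤ ENNReal.ofReal Λ ^ 2 * (ENNReal.ofReal T
            * ∫⁻ t in Ioc 0 T, ‖μ t (Y t x) - V t x‖ₑ ^ 2) := by
          rw [mul_pow]
          gcongr
          exact sq_lintegral_Ioc_le (hemx x).enorm
      _ = _ := by
          rw [ENNReal.ofReal_mul (by positivity), ENNReal.ofReal_pow hΛ0.le, mul_assoc]
  calc ∫⁻ x, ‖Y T x - Φ 0 T x‖ₑ ^ 2 ∂ρ
      ≤ ∫⁻ x, ENNReal.ofReal (Λ ^ 2 * T)
          * ∫⁻ t in Ioc 0 T, ‖μ t (Y t x) - V t x‖ₑ ^ 2 ∂volume ∂ρ := lintegral_mono hpt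
    _ = ENNReal.ofReal (Λ ^ 2 * T)
          * ∫⁻ t in Ioc 0 T, ∫⁻ x, ‖μ t (Y t x) - V t x‖ₑ ^ 2 ∂ρ := by
        rw [lintegral_const_mul' _ _ ENNReal.ofReal_ne_top, lintegral_lintegral_swap]
        exact ((hem.comp measurable_swap).enorm.pow_const 2).aemeasurable
    _ ≤ ENNReal.ofReal (Λ ^ 2 * T) * ∫⁻ t in Ioc 0 T, ENNReal.ofReal (g t) := by
        refine mul_le_mul_right ?_ _
        exact setLIntegral_mono' measurableSet_Ioc fun t ht => he t (Ioc_subset_Icc_self ht)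
    _ = _ := by
        rw [← ofReal_integral_eq_lintegral_ofReal
          ((intervalIntegrable_iff_integrableOn_Ioc_of_le hT).1 hg)
          ((ae_restrict_mem measurableSet_Ioc).mono fun t ht => hg0 t (Ioc_subset_Icc_self ht)),
          ← ENNReal.ofReal_mul (by positivity), intervalIntegral.integral_of_le hT]

/-! ### Comparison of the scheme with the flow -/

/-- Transport by the flow to time `r`, where the score of the law `ν` is `ℓ`-Lipschitz, compares
the image of the initial law `ρ` under `F` with its image under the flow up to time `T`. -/
theorem IsFlow.exists_klDiv_map_le {ι : Type*} {d : ℕ} {ρ ν : Measure (Euc d)}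
    [IsProbabilityMeasure ν] {p : Euc d → ℝ} {ℓ : ℝ} (hν : IsLogSmoothDensity ν p ℓ)
    {T M a b W : ℝ} (hT : 0 ≤ T) (hM : 0 ≤ M) (ha : 0 ≤ a) (hb : 0 ≤ b) (hW : 0 ≤ W)
    {y : ι → ℝ → Euc d} {Φ : ℝ → ℝ → Euc d → Euc d}
    (hΦ : IsFlow T (Real.exp a) (M * T * Real.exp a ^ 3) y Φ) {r : ℝ} (hr : r ∈ Icc 0 T)
    (hρ : ν.map (Φ r 0) = ρ) {F : Euc d → Euc d}
    (hF : FourPoint F (Real.exp b) (M * T * Real.exp b ^ 2))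
    (hFb : ∀ x y, Real.exp (-2 * b) * ‖x - y‖ ≤ ‖F x - F y‖)
    (hD : ∫⁻ x, ‖F x - Φ 0 T x‖ₑ ^ 2 ∂ρ ≤ ENNReal.ofReal W) :
    ∃ Q m D : ℝ, D ≤ Real.exp a ^ 2 * W ∧ m ≤ 3 * M * T * Real.exp a ^ 5 * Real.exp b ^ 2 ∧
      Q ≤ 2 * ℓ * D + 7 * (d * m) * √D ∧
      InformationTheory.klDiv (ρ.map F) (ν.map (Φ r T))
        ≤ ENNReal.ofReal (2 * Q + (2 * a + 2 * b) * min (d : ℝ) (4 * Q) + ℓ * D) := by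
  have h0 : (0 : ℝ) ∈ Icc 0 T := ⟨le_rfl, hT⟩
  have h1 : T ∈ Icc 0 T := ⟨hT, le_rfl⟩
  set Λ := Real.exp a with hΛ
  set Λ' := Real.exp b with hΛ'
  have hΛ1 : 1 ≤ Λ := Real.one_le_exp ha
  have hΛ'1 : 1 ≤ Λ' := Real.one_le_exp hb
  have hmeas : ∀ s ∈ Icc 0 T, ∀ t ∈ Icc 0 T, Measurable (Φ s t) := fun s hs t ht =>
    (hΦ.fourPoint s hs t ht).continuous.measurable
  set H : Euc d → Euc d := Φ T r ∘ F ∘ Φ r 0 with hH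
  have hH4 := (hΦ.fourPoint T h1 r hr).comp
    (hF.comp (hΦ.fourPoint r hr 0 h0) (by positivity) (by positivity))
    (by positivity) (by positivity)
  set m := Λ * (Λ' * (M * T * Λ ^ 3) + M * T * Λ' ^ 2 * Λ ^ 2) + M * T * Λ ^ 3 * (Λ' * Λ) ^ 2
    with hm
  have hm0 : 0 ≤ m := by positivity
  have hm1 : m ≤ 3 * M * T * Λ ^ 5 * Λ' ^ 2 := by
    have e1 : Λ ^ 4 * Λ' ≤ Λ ^ 5 * Λ' ^ 2 := by
      have := pow_le_pow_right₀ hΛ1 (show 4 ≤ 5 by norm_num)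
      have := le_self_pow₀ hΛ'1 two_ne_zero
      gcongr
    have e2 : Λ ^ 3 * Λ' ^ 2 ≤ Λ ^ 5 * Λ' ^ 2 := by
      have := pow_le_pow_right₀ hΛ1 (show 3 ≤ 5 by norm_num)
      gcongr
    calc m = M * T * (Λ ^ 4 * Λ' + Λ ^ 3 * Λ' ^ 2 + Λ ^ 5 * Λ' ^ 2) := by rw [hm]; ring
      _ ≤ M * T * (Λ ^ 5 * Λ' ^ 2 + Λ ^ 5 * Λ' ^ 2 + Λ ^ 5 * Λ' ^ 2) := by gcongr
      _ = _ := by ring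
  -- The inverse of a transition map is a transition map, so these are expanding up to `Λ`.
  have hlow : ∀ s ∈ Icc 0 T, ∀ t ∈ Icc 0 T, ∀ x z, Real.exp (-a) * ‖x - z‖
      ≤ ‖Φ s t x - Φ s t z‖ := by
    intro s hs t ht x z
    have h2 := (hΦ.fourPoint t ht s hs).norm_sub_le (Φ s t x) (Φ s t z)
    rw [hΦ.comp_apply hs ht hs, hΦ.comp_apply hs ht hs, hΦ.self_apply hs, hΦ.self_apply hs] at h2
    rw [Real.exp_neg, inv_mul_le_iff₀ (by positivity)]
    exact h2
  have hHκ : ∀ x z, Real.exp (-(2 * a + 2 * b)) * ‖x - z‖ ≤ ‖H x - H z‖ := by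
    intro x z
    calc Real.exp (-(2 * a + 2 * b)) * ‖x - z‖
        = Real.exp (-a) * (Real.exp (-2 * b) * (Real.exp (-a) * ‖x - z‖)) := by
          rw [← mul_assoc, ← mul_assoc, ← Real.exp_add, ← Real.exp_add]
          ring_nf
      _ ≤ Real.exp (-a) * (Real.exp (-2 * b) * ‖Φ r 0 x - Φ r 0 z‖) := by
          gcongr
          exact hlow r hr 0 h0 x z
      _ ≤ Real.exp (-a) * ‖F (Φ r 0 x) - F (Φ r 0 z)‖ := by
          gcongr
          exact hFb _ _
      _ ≤ ‖H x - H z‖ := hlow T h1 r hr _ _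
  have hpt : ∀ x, ‖H x - x‖ₑ ≤ ENNReal.ofReal Λ * ‖F (Φ r 0 x) - Φ 0 T (Φ r 0 x)‖ₑ := by
    intro x
    have h2 := (hΦ.fourPoint T h1 r hr).norm_sub_le (F (Φ r 0 x)) (Φ 0 T (Φ r 0 x))
    rw [hΦ.comp_apply hr h0 h1, hΦ.comp_apply hr h1 hr, hΦ.self_apply hr,
      ← hΦ.comp_apply hr h0 h1] at h2
    rw [← ofReal_norm, ← ofReal_norm, ← ENNReal.ofReal_mul (by positivity)]
    exact ENNReal.ofReal_le_ofReal h2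
  have hHc : Continuous H := hH4.continuous
  have hlint : ∫⁻ x, ‖H x - x‖ₑ ^ 2 ∂ν ≤ ENNReal.ofReal (Λ ^ 2 * W) := by
    calc ∫⁻ x, ‖H x - x‖ₑ ^ 2 ∂ν
        ≤ ∫⁻ x, ENNReal.ofReal (Λ ^ 2) * ‖F (Φ r 0 x) - Φ 0 T (Φ r 0 x)‖ₑ ^ 2 ∂ν := by
          refine lintegral_mono fun x => ?_
          rw [ENNReal.ofReal_pow (by positivity), ← mul_pow]
          gcongr
          exact hpt x
      _ = ENNReal.ofReal (Λ ^ 2) * ∫⁻ x, ‖F x - Φ 0 T x‖ₑ ^ 2 ∂ρ := by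
          rw [lintegral_const_mul' _ _ ENNReal.ofReal_ne_top, ← hρ, lintegral_map _ (hmeas r hr 0 h0)]
          exact ((hF.continuous.measurable.sub (hmeas 0 h0 T h1)).enorm.pow_const 2)
      _ ≤ _ := by
          rw [ENNReal.ofReal_mul (by positivity)]
          gcongr
  have hG2 : MemLp (fun x => H x - x) 2 ν := by
    refine ⟨(hHc.sub continuous_id).aestronglyMeasurable, ?_⟩
    rw [eLpNorm_lt_top_iff_lintegral_rpow_enorm_lt_top two_ne_zero ENNReal.ofNat_ne_top]
    simpa using hlint.trans_lt ENNReal.ofReal_lt_top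
  have hDle : ∫ x, ‖H x - x‖ ^ 2 ∂ν ≤ Λ ^ 2 * W := by
    rw [integral_eq_lintegral_of_nonneg_ae (Filter.Eventually.of_forall fun x => by positivity)
      (by fun_prop)]
    refine ENNReal.toReal_le_of_le_ofReal (by positivity) ?_
    simpa only [ENNReal.ofReal_pow (norm_nonneg _), ofReal_norm] using hlint
  have hHd : Differentiable ℝ H := hH4.differentiable hm0
  have hfd : ∀ x, fderiv ℝ (fun x => H x - x) x = fderiv ℝ H x - 1 := fun x => by
    rw [fderiv_fun_sub (hHd x) differentiableAt_fun_id]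
    simp [ContinuousLinearMap.one_def]
  have hQ := hν.integral_frobSq_fderiv_le (G := fun x => H x - x) (b := Λ * (Λ' * Λ) + 1) (m := m)
    (hHd.sub differentiable_id) hG2 (fun x => by
      rw [hfd]
      refine (norm_sub_le _ _).trans ?_
      gcongr
      · exact hH4.norm_fderiv_le (by positivity) x
      · exact ContinuousLinearMap.norm_id_le) hm0 (fun x z => by
      rw [hfd, hfd, sub_sub_sub_cancel_right]
      exact hH4.norm_fderiv_sub_le hm0 x z)
  simp only [hfd] at hQ
  have hκ := hν.klDiv_map_le hH4 (by positivity) hm0 (Real.exp_pos _)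
    (Real.exp_le_one_iff.2 (by linarith)) hHκ hG2
  rw [Real.log_exp, neg_neg] at hκ
  refine ⟨∫ x, frobSq (fderiv ℝ H x - 1) ∂ν, m, ∫ x, ‖H x - x‖ ^ 2 ∂ν,
    hDle, hm1, hQ, ?_⟩
  refine le_trans ?_ hκ
  have e : ρ.map F = (ν.map H).map (Φ r T) := by
    rw [Measure.map_map (hmeas r hr T h1) hHc.measurable, ← hρ,
      Measure.map_map hF.continuous.measurable (hmeas r hr 0 h0)]
    congr 1
    funext x
    simp only [Function.comp_apply, hH]
    rw [hΦ.comp_apply h1 hr h1, hΦ.self_apply h1]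
  rw [e]
  exact InformationTheory.klDiv_map_le _ _ (hmeas r hr T h1)

/-! ### The final estimate -/

theorem pow_mul_pow_le_add {x y : ℝ} (hx : 1 ≤ x) (hy : 1 ≤ y) {m n k : ℕ} (h : m + n ≤ k) :
    x ^ m * y ^ n ≤ x ^ k + y ^ k := by
  have hx0 : 0 ≤ x := by linarith
  have hy0 : 0 ≤ y := by linarith
  rcases le_total x y with hxy | hxy
  · calc x ^ m * y ^ n ≤ y ^ m * y ^ n := by gcongr
      _ = y ^ (m + n) := (pow_add ..).symm
      _ ≤ y ^ k := pow_le_pow_right₀ hy h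
      _ ≤ _ := le_add_of_nonneg_left (by positivity)
  · calc x ^ m * y ^ n ≤ x ^ m * x ^ n := by gcongr
      _ = x ^ (m + n) := (pow_add ..).symm
      _ ≤ x ^ k := pow_le_pow_right₀ hx h
      _ ≤ _ := le_add_of_nonneg_right (by positivity)

/-- If `b ≤ √N`, the minimum is bounded by `q`. Otherwise `b * T ≥ 1`, which pays for bounding
the minimum by the geometric mean. -/
theorem mul_min_le_add {b d q N T : ℝ} (hb : 0 < b) (hd : 0 ≤ d) (hq : 0 ≤ q) (hN : 1 ≤ N)
    (hT : 0 < T) (hbN : b ≤ N * T) :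
    b * min d q ≤ √N * q + b * (√(b * T) * √(d * q)) := by
  by_cases h : b ≤ √N
  · have h1 : b * min d q ≤ √N * q := mul_le_mul h (min_le_right _ _) (le_min hd hq) (by positivity)
    have h2 : 0 ≤ b * (√(b * T) * √(d * q)) := by positivity
    linarith
  · push Not at h
    have hbT : 1 ≤ b * T := by
      have h3 : N ≤ b ^ 2 := by
        rw [← Real.sq_sqrt (show 0 ≤ N by linarith)]
        gcongr
      have h4 : b * 1 ≤ b * (b * T) := by
        calc b * 1 ≤ N * T := by linarith
          _ ≤ b ^ 2 * T := by gcongr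
          _ = _ := by ring
      exact le_of_mul_le_mul_left h4 hb
    have h1 : min d q ≤ √(d * q) := by
      refine Real.le_sqrt_of_sq_le ?_
      rw [sq]
      exact mul_le_mul (min_le_left _ _) (min_le_right _ _) (le_min hd hq) hd
    have h2 : √(d * q) ≤ √(b * T) * √(d * q) :=
      le_mul_of_one_le_left (by positivity) (Real.one_le_sqrt.2 hbT)
    have h3 : b * min d q ≤ b * (√(b * T) * √(d * q)) := by
      gcongr
      exact h1.trans h2
    have h4 : 0 ≤ √N * q := by positivity
    linarith

theorem quadratic_bound_le {d M T a Λ Λ' ζ ℓ Q m D : ℝ} (hd : 0 ≤ d) (hM : 0 ≤ M) (hT : 0 < T)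
    (hTa : T ≤ a) (haΛ : a ≤ Λ) (hΛ : 1 ≤ Λ) (hζ : 0 ≤ ζ)
    (hℓ : 0 ≤ ℓ) (hℓT : ℓ * T ≤ a) (hD : D ≤ Λ ^ 4 * T * ζ ^ 2)
    (hm : m ≤ 3 * M * T * Λ ^ 5 * Λ' ^ 2) (hQ : Q ≤ 2 * ℓ * D + 7 * (d * m) * √D) :
    ℓ * D ≤ Λ ^ 5 * ζ ^ 2 ∧
      Q ≤ 2 * (Λ ^ 5 * ζ ^ 2) + 21 * (Λ ^ 8 * Λ' ^ 2 * (M * d * √T * (ζ * √T))) := by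
  have hτ0 : 0 < √T := Real.sqrt_pos.2 hT
  have hττ : √T ^ 2 = T := Real.sq_sqrt hT.le
  have hτΛ : √T ≤ Λ := Real.sqrt_le_iff.2 ⟨by linarith, by nlinarith⟩
  have hℓD : ℓ * D ≤ Λ ^ 5 * ζ ^ 2 := by
    calc ℓ * D ≤ ℓ * (Λ ^ 4 * T * ζ ^ 2) := by gcongr
      _ = ℓ * T * (Λ ^ 4 * ζ ^ 2) := by ring
      _ ≤ Λ * (Λ ^ 4 * ζ ^ 2) := by gcongr; exact hℓT.trans haΛ
      _ = _ := by ring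
  have hsD : √D ≤ Λ ^ 2 * √T * ζ := by
    refine Real.sqrt_le_iff.2 ⟨by positivity, hD.trans (le_of_eq ?_)⟩
    linear_combination -(Λ ^ 4 * ζ ^ 2) * hττ
  refine ⟨hℓD, hQ.trans ?_⟩
  have h1 : 7 * (d * m) * √D ≤ 21 * (Λ ^ 8 * Λ' ^ 2 * (M * d * √T * (ζ * √T))) := by
    calc 7 * (d * m) * √D ≤ 7 * (d * (3 * M * T * Λ ^ 5 * Λ' ^ 2)) * (Λ ^ 2 * √T * ζ) := by
          gcongr
      _ = 21 * (Λ ^ 7 * √T * Λ' ^ 2 * (M * d * √T * (ζ * √T))) := by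
          linear_combination -(21 * d * M * Λ ^ 7 * Λ' ^ 2 * √T * ζ) * hττ
      _ ≤ 21 * (Λ ^ 7 * Λ * Λ' ^ 2 * (M * d * √T * (ζ * √T))) := by gcongr
      _ = _ := by ring
  linarith

theorem tail_bound_le {d T b Λ Λ' ζ N : ℝ} (hd : 0 ≤ d) (hT : 0 < T) (hb : 0 < b)
    (hbN : b ≤ N * T) (hbΛ : b ≤ Λ') (hΛ : 1 ≤ Λ) (hΛ' : 1 ≤ Λ') (hN : 1 ≤ N) (hζ : 0 ≤ ζ) :
    b * min d (8 * (Λ ^ 5 * ζ ^ 2))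
      ≤ 8 * (√N * (Λ ^ 5 * ζ ^ 2)) + 3 * (Λ ^ 5 * Λ' ^ 2 * (√d * (ζ * √T))) := by
  refine (mul_min_le_add hb hd (by positivity) hN hT hbN).trans ?_
  have h0 : 0 ≤ Λ' := hb.le.trans hbΛ
  have h1 : √(d * (8 * (Λ ^ 5 * ζ ^ 2))) ≤ 3 * Λ ^ 5 * ζ * √d := by
    refine Real.sqrt_le_iff.2 ⟨by positivity, ?_⟩
    have h2 : Λ ^ 5 ≤ Λ ^ 10 := pow_le_pow_right₀ hΛ (by norm_num)
    calc d * (8 * (Λ ^ 5 * ζ ^ 2)) ≤ d * (9 * (Λ ^ 10 * ζ ^ 2)) := by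
          gcongr
          norm_num
      _ = 9 * Λ ^ 10 * ζ ^ 2 * √d ^ 2 := by rw [Real.sq_sqrt hd]; ring
      _ = _ := by ring
  rw [Real.sqrt_mul hb.le]
  have h3 : √b ≤ Λ' := Real.sqrt_le_iff.2 ⟨h0, hbΛ.trans (le_self_pow₀ hΛ' two_ne_zero)⟩
  calc _ ≤ √N * (8 * (Λ ^ 5 * ζ ^ 2)) + Λ' * (Λ' * √T * (3 * Λ ^ 5 * ζ * √d)) := by gcongr
    _ = _ := by ring

/-- Collects the bounds on the three terms of the entropy estimate. -/
theorem entropy_bound_le {d M T a b Λ Λ' ζ N l ℓ Q m D : ℝ} (hd : 0 ≤ d) (hM : 0 ≤ M)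
    (hT : 0 < T) (hTa : T ≤ a) (hb : 0 < b) (hbN : b ≤ N * T) (hN : 1 ≤ N) (hl : 1 ≤ l)
    (haΛ : a ≤ Λ) (hbΛ : b ≤ Λ') (hΛ : 1 ≤ Λ) (hΛ' : 1 ≤ Λ') (hζ : 0 ≤ ζ)
    (hℓ : 0 ≤ ℓ) (hℓT : ℓ * T ≤ a) (hD : D ≤ Λ ^ 4 * T * ζ ^ 2)
    (hm : m ≤ 3 * M * T * Λ ^ 5 * Λ' ^ 2) (hQ : Q ≤ 2 * ℓ * D + 7 * (d * m) * √D) :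
    2 * Q + (2 * a + 2 * b) * min d (4 * Q) + ℓ * D
      ≤ 400 * (Λ ^ 400 * √N * ζ ^ 2
        + (Λ ^ 400 + Λ' ^ 400) * (√l * √d + M * d * √T) * (ζ * √T)) := by
  have ha : 0 < a := hT.trans_le hTa
  obtain ⟨hℓD, hQ'⟩ := quadratic_bound_le hd hM hT hTa haΛ hΛ hζ hℓ hℓT hD hm hQ
  have htail := tail_bound_le hd hT hb hbN hbΛ hΛ hΛ' hN hζ
  have hN1 : 1 ≤ √N := Real.one_le_sqrt.2 hN
  have hl1 : 1 ≤ √l := Real.one_le_sqrt.2 hl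
  have hX : 0 ≤ ζ * √T := by positivity
  have hs : 0 ≤ M * d * √T := by positivity
  have hS2 : √d ≤ √l * √d + M * d * √T := by
    have h1 : √d ≤ √l * √d := le_mul_of_one_le_left (by positivity) hl1
    linarith
  have hS1 : M * d * √T ≤ √l * √d + M * d * √T := le_add_of_nonneg_left (by positivity)
  have hS : 0 ≤ √l * √d + M * d * √T := hs.trans hS1
  have hd' := Real.sqrt_nonneg d
  generalize √l * √d + M * d * √T = S at *
  generalize M * d * √T = s at *
  generalize ζ * √T = X at *
  have hmin : min d (4 * Q)
      ≤ min d (8 * (Λ ^ 5 * ζ ^ 2)) + 84 * (Λ ^ 8 * Λ' ^ 2 * (s * X)) := by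
    have h2 : 0 ≤ Λ ^ 8 * Λ' ^ 2 * (s * X) := by positivity
    rcases le_total d (8 * (Λ ^ 5 * ζ ^ 2)) with h | h
    · rw [min_eq_left h]
      exact (min_le_left _ _).trans (by linarith)
    · rw [min_eq_right h]
      exact (min_le_right _ _).trans (by linarith)
  have hU : ∀ i ≤ 6, Λ ^ i * ζ ^ 2 ≤ Λ ^ 400 * √N * ζ ^ 2 := fun i hi => by
    have h1 : Λ ^ i ≤ Λ ^ 400 := pow_le_pow_right₀ hΛ (by omega)
    have h2 : Λ ^ i ≤ Λ ^ 400 * √N := h1.trans (le_mul_of_one_le_right (by positivity) hN1)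
    gcongr
  have hU5 : √N * (Λ ^ 5 * ζ ^ 2) ≤ Λ ^ 400 * √N * ζ ^ 2 := by
    have h1 : Λ ^ 5 ≤ Λ ^ 400 := pow_le_pow_right₀ hΛ (by norm_num)
    calc √N * (Λ ^ 5 * ζ ^ 2) = Λ ^ 5 * √N * ζ ^ 2 := by ring
      _ ≤ _ := by gcongr
  have hV : ∀ i j u, i + j ≤ 400 → 0 ≤ u → u ≤ S →
      Λ ^ i * Λ' ^ j * (u * X) ≤ (Λ ^ 400 + Λ' ^ 400) * S * X := fun i j u hij hu huS => by
    rw [mul_assoc (_ + _)]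
    have h1 := pow_mul_pow_le_add hΛ hΛ' hij
    gcongr
  have hU1 := hU 5 (by norm_num)
  have hU2 := hU 6 (by norm_num)
  have hV1 := hV 8 2 s (by norm_num) hs hS1
  have hV2 := hV 9 2 s (by norm_num) hs hS1
  have hV3 := hV 8 3 s (by norm_num) hs hS1
  have hV4 := hV 5 2 √d (by norm_num) hd' hS2
  have ha' : a * min d (4 * Q) ≤ 8 * (Λ ^ 6 * ζ ^ 2) + 84 * (Λ ^ 9 * Λ' ^ 2 * (s * X)) := by
    have h1 : 0 ≤ 8 * (Λ ^ 5 * ζ ^ 2) + 84 * (Λ ^ 8 * Λ' ^ 2 * (s * X)) := by positivity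
    calc a * min d (4 * Q)
        ≤ a * (8 * (Λ ^ 5 * ζ ^ 2) + 84 * (Λ ^ 8 * Λ' ^ 2 * (s * X))) := by
          gcongr
          linarith [min_le_right d (8 * (Λ ^ 5 * ζ ^ 2))]
      _ ≤ Λ * (8 * (Λ ^ 5 * ζ ^ 2) + 84 * (Λ ^ 8 * Λ' ^ 2 * (s * X))) := by gcongr
      _ = _ := by ring
  have hb' : b * min d (4 * Q) ≤ b * min d (8 * (Λ ^ 5 * ζ ^ 2))
      + 84 * (Λ ^ 8 * Λ' ^ 3 * (s * X)) := by
    calc b * min d (4 * Q)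
        ≤ b * (min d (8 * (Λ ^ 5 * ζ ^ 2)) + 84 * (Λ ^ 8 * Λ' ^ 2 * (s * X))) := by gcongr
      _ = b * min d (8 * (Λ ^ 5 * ζ ^ 2)) + b * (84 * (Λ ^ 8 * Λ' ^ 2 * (s * X))) := by ring
      _ ≤ b * min d (8 * (Λ ^ 5 * ζ ^ 2)) + Λ' * (84 * (Λ ^ 8 * Λ' ^ 2 * (s * X))) := by gcongr
      _ = _ := by ring
  have hU0 : 0 ≤ Λ ^ 400 * √N * ζ ^ 2 := by positivity
  have hV0 : 0 ≤ (Λ ^ 400 + Λ' ^ 400) * S * X := by positivity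
  rw [show (2 * a + 2 * b) * min d (4 * Q) = 2 * (a * min d (4 * Q)) + 2 * (b * min d (4 * Q)) by
    ring]
  linarith

/-! ### The two processes -/

theorem GenericAssumption.isRegularDrift {Ω : Type*} [MeasurableSpace Ω] {P : Measure Ω} {d : ℕ}
    {T h : ℝ} {μ μ' : ℝ → Euc d → Euc d} {y y' : ℝ → Ω → Euc d} {L L' ζ : ℝ → ℝ} {M : ℝ}
    (H : GenericAssumption P T h μ μ' y y' L L' ζ M) : IsRegularDrift T μ L M where
  integrable := H.integrable_L
  nonneg t ht := zero_le_one.trans (H.one_le_L t ht)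
  nonneg' := zero_le_one.trans H.one_le_M
  fourPoint t ht := by
    have h1 := (H.drift_lipschitz t ht).norm_sub_le
    have h2 := (H.drift_jacobian t ht).2.norm_sub_le
    rw [Real.coe_toNNReal _ (zero_le_one.trans (H.one_le_L t ht))] at h1
    rw [Real.coe_toNNReal _ (zero_le_one.trans H.one_le_M)] at h2
    exact FourPoint.of_lipschitz_fderiv h1 (H.drift_jacobian t ht).1 h2

theorem GenericAssumption.fourPoint' {Ω : Type*} [MeasurableSpace Ω] {P : Measure Ω} {d : ℕ}
    {T h : ℝ} {μ μ' : ℝ → Euc d → Euc d} {y y' : ℝ → Ω → Euc d} {L L' ζ : ℝ → ℝ} {M : ℝ}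
    (H : GenericAssumption P T h μ μ' y y' L L' ζ M) {t : ℝ} (ht : t ∈ Icc 0 T) :
    FourPoint (μ' (gridTime h t)) (L' t) M := by
  have h1 := (H.drift'_lipschitz t ht).norm_sub_le
  have h2 := (H.drift'_jacobian t ht).2.norm_sub_le
  rw [Real.coe_toNNReal _ (zero_le_one.trans (H.one_le_L' t ht))] at h1
  rw [Real.coe_toNNReal _ (zero_le_one.trans H.one_le_M)] at h2
  exact FourPoint.of_lipschitz_fderiv h1 (H.drift'_jacobian t ht).1 h2

theorem mainTheorem2 :
    ∃ C : ℝ, 0 < C ∧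
      ∀ (d : ℕ) (Ω : Type*) [MeasurableSpace Ω] (P : Measure Ω) [IsProbabilityMeasure P]
        (π₀ : Measure (Euc d)) (T h : ℝ) (μ μ' : ℝ → Euc d → Euc d) (y y' : ℝ → Ω → Euc d)
        (L L' ζ : ℝ → ℝ) (M : ℝ),
        0 < T → 0 < h →
        Measurable (fun p : ℝ × Euc d => μ p.1 p.2) →
        IsODEProcess P π₀ T μ y →
        IsInterpolatedScheme P π₀ T h μ' y' →
        GenericAssumption P T h μ μ' y y' L L' ζ M →
        InformationTheory.klDiv (P.map (y' T)) (P.map (y T)) ≤ ENNReal.ofReal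
          (C * (expIntegral T L ^ C * √(sSup (L' '' Icc 0 T)) * totalError T ζ ^ 2
            + (expIntegral T L ^ C + expIntegral T L' ^ C)
              * (√(L' 0) * √(d : ℝ) + M * d * √T) * (totalError T ζ * √T))) := by
  refine ⟨400, by norm_num, ?_⟩
  intro d Ω _ P _ π₀ T h μ μ' y y' L L' ζ M hT hh hμm hy hy' H
  have h0 : (0 : ℝ) ∈ Icc 0 T := ⟨le_rfl, hT.le⟩
  have hTm : T ∈ Icc 0 T := ⟨hT.le, le_rfl⟩
  have hreg := H.isRegularDrift
  -- The paths of `y` that solve the equation; their values at each time are dense.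
  set s : Set Ω := {ω | IsSolution T μ fun t => y t ω} with hs
  have hsP : ∀ᵐ ω ∂P, ω ∈ s := by
    filter_upwards [hy.integrable, hy.solves] with ω h1 h2 using ⟨h1, h2⟩
  have hdens : ∀ t ∈ Icc 0 T, DenseRange fun i : s => y t i := fun t ht => by
    obtain ⟨p, hp⟩ :=
      (H.score_lipschitz t ht).exists_isLogSmoothDensity (zero_le_one.trans (H.one_le_L t ht))
    exact denseRange_of_map_isOpenPosMeasure (hy.measurable t ht) hp.isOpenPosMeasure hsP
  have hsol : ∀ i : s, IsSolution T μ fun t => y t i := fun i => i.2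
  obtain ⟨Φ, hΦ⟩ := hreg.exists_isFlow hsol hdens
  set a := ∫ τ in (0 : ℝ)..T, L τ with ha
  set b := ∫ τ in (0 : ℝ)..T, L' τ with hb
  have hTle : ∀ f : ℝ → ℝ, IntervalIntegrable f volume 0 T → (∀ t ∈ Icc 0 T, 1 ≤ f t) →
      T ≤ ∫ τ in (0 : ℝ)..T, f τ := fun f hf hf1 => by
    simpa using intervalIntegral.integral_mono_on hT.le (by simp) hf hf1
  have hTa : T ≤ a := hTle L H.integrable_L H.one_le_L
  have hTb : T ≤ b := hTle L' H.integrable_L' H.one_le_L'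
  -- A time at which the Lipschitz constant of the score does not exceed its mean.
  obtain ⟨r, hr, hrL⟩ : ∃ r ∈ Icc 0 T, L r * T ≤ a := by
    obtain ⟨r, hr, h1⟩ := exists_le_setAverage (μ := volume) (s := Ioc 0 T) (f := L) (by simpa)
      (by simp) ((intervalIntegrable_iff_integrableOn_Ioc_of_le hT.le).1 H.integrable_L)
    refine ⟨r, Ioc_subset_Icc_self hr, ?_⟩
    rw [setAverage_eq, ← intervalIntegral.integral_of_le hT.le] at h1
    simp only [Real.volume_real_Ioc_of_le hT.le, sub_zero, smul_eq_mul] at h1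
    rw [← le_div_iff₀ hT, div_eq_inv_mul]
    exact h1
  have hLr : 0 ≤ L r := zero_le_one.trans (H.one_le_L r hr)
  obtain ⟨p, hp⟩ := (H.score_lipschitz r hr).exists_isLogSmoothDensity hLr
  have hprob : IsProbabilityMeasure (P.map (y r)) :=
    Measure.isProbabilityMeasure_map (hy.measurable r hr).aemeasurable
  have hΦm : ∀ u ∈ Icc 0 T, ∀ t ∈ Icc 0 T, Measurable (Φ u t) := fun u hu t ht =>
    (hΦ.fourPoint u hu t ht).continuous.measurable
  have hmapΦ : ∀ t ∈ Icc 0 T, (P.map (y r)).map (Φ r t) = P.map (y t) := fun t ht => by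
    rw [Measure.map_map (hΦm r hr t ht) (hy.measurable r hr)]
    refine Measure.map_congr ?_
    filter_upwards [hsP] with ω hω
    exact hΦ.apply r hr t ht ⟨ω, hω⟩
  -- Beyond the horizon the drifts of the scheme are unconstrained, and irrelevant.
  set β : ℕ → Euc d → Euc d := fun k => if k * h ≤ T then μ' (k * h) else fun _ => 0 with hβ
  have hβe : ∀ k : ℕ, k * h ≤ T → β k = μ' (k * h) := fun k hk => if_pos hk
  have hβt : ∀ t ∈ Icc 0 T, β ⌊t / h⌋₊ = μ' (gridTime h t) := fun t ht =>
    hβe _ ((mem_Ico_floor_div hh ht.1).1.trans ht.2)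
  have hβ4 : ∀ t ∈ Icc 0 T, FourPoint (β ⌊t / h⌋₊) (L' t) M := fun t ht => by
    rw [hβt t ht]
    exact H.fourPoint' ht
  have hβc : ∀ k, Continuous (β k) := fun k => by
    by_cases hk : (k : ℝ) * h ≤ T
    · have := (hβ4 (k * h) ⟨by positivity, hk⟩).continuous
      rwa [floor_div_eq hh ⟨le_rfl, by linarith⟩] at this
    · simp only [hβ, if_neg hk]
      exact continuous_const
  have hsmall : ∀ t ∈ Icc 0 T, h * L' t ≤ 1 / 2 := fun t ht => by
    have h1 := H.small_step t ht
    have h2 := H.one_le_L' t ht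
    rw [le_div_iff₀ (by linarith)] at h1
    linarith
  obtain ⟨hF, hFb⟩ := fourPoint_eulerPath hh H.integrable_L'
    (fun t ht => zero_le_one.trans (H.one_le_L' t ht)) hreg.nonneg' hβ4 hsmall hTm
  have hpath : ∀ᵐ ω ∂P, ∀ t ∈ Icc 0 T, y' t ω = eulerPath h β t (y' 0 ω) ∧
      μ' (gridTime h t) (y' (gridTime h t) ω) = eulerVel h β t (y' 0 ω) := by
    filter_upwards [hy'.step] with ω hω t ht
    have h1 := eq_eulerPath_of_step (b := β) (u := fun t => y' t ω) hh (fun k t ht htT => by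
      rw [hβe k (ht.1.trans htT)]
      exact hω k t ht htT) ht
    refine ⟨h1.1, ?_⟩
    rw [h1.2, ← hβt t ht]
    rfl
  have hY := measurable_eulerPath (h := h) hβc
  have hV := measurable_eulerVel (h := h) hβc
  have hprob0 : IsProbabilityMeasure π₀ := by
    rw [← hy.init]
    exact Measure.isProbabilityMeasure_map (hy.measurable 0 h0).aemeasurable
  set Z := ∫ t in (0 : ℝ)..T, ζ t ^ 2 with hZ
  have hZ0 : 0 ≤ Z := intervalIntegral.integral_nonneg hT.le fun t _ => sq_nonneg _
  have hD := hΦ.lintegral_enorm_sub_sq_le hreg hsol hT.le hμm hY hV (ρ := π₀)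
    (fun x => (eulerVel_integrable_and_integral hh x hT.le).1)
    (fun x t ht => (eulerVel_integrable_and_integral hh x ht.1).2) H.integrable_zeta_sq
    (fun t _ => sq_nonneg _) (fun t ht => by
      rw [← hy'.init, lintegral_map _ (hy'.measurable 0 h0)]
      · refine le_trans (le_of_eq (lintegral_congr_ae ?_)) (H.drift_error t ht)
        filter_upwards [hpath] with ω hω
        rw [(hω t ht).2, ← (hω t ht).1]
      · exact (((hμm.comp (measurable_fst.prodMk hY)).sub hV).comp
          measurable_prodMk_left).enorm.pow_const 2)
  obtain ⟨Q, m, D, hD1, hm1, hQ, hkl⟩ := hΦ.exists_klDiv_map_le hp hT.le hreg.nonneg'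
    (hT.le.trans hTa) (hT.le.trans hTb) (by positivity) hr
    ((hmapΦ 0 h0).trans hy.init) hF hFb hD
  have hlaw : P.map (y' T) = π₀.map (eulerPath h β T) := by
    rw [← hy'.init, Measure.map_map hF.continuous.measurable (hy'.measurable 0 h0)]
    refine Measure.map_congr ?_
    filter_upwards [hpath] with ω hω
    exact (hω T hTm).1
  rw [hmapΦ T hTm, ← hlaw] at hkl
  refine hkl.trans (ENNReal.ofReal_le_ofReal ?_)
  have hbdd : BddAbove (L' '' Icc 0 T) := by
    refine ⟨1 / 2 / h, ?_⟩
    rintro _ ⟨t, ht, rfl⟩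
    rw [le_div_iff₀ hh, mul_comm]
    exact hsmall t ht
  have hN : ∀ t ∈ Icc 0 T, L' t ≤ sSup (L' '' Icc 0 T) := fun t ht =>
    le_csSup hbdd (mem_image_of_mem _ ht)
  have hbN : b ≤ sSup (L' '' Icc 0 T) * T := by
    have := intervalIntegral.integral_mono_on hT.le H.integrable_L' (by simp) hN
    simpa [mul_comm] using this
  have hfin := entropy_bound_le (d := d) (ζ := totalError T ζ) (Λ := Real.exp a)
    (Λ' := Real.exp b) (Nat.cast_nonneg d) hreg.nonneg' hT hTa (hT.trans_le hTb) hbN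
    ((H.one_le_L' 0 h0).trans (hN 0 h0)) (H.one_le_L' 0 h0)
    (by linarith [Real.add_one_le_exp a]) (by linarith [Real.add_one_le_exp b])
    (Real.one_le_exp (hT.le.trans hTa)) (Real.one_le_exp (hT.le.trans hTb))
    (Real.sqrt_nonneg _) hLr hrL (hD1.trans (le_of_eq (by
      rw [totalError, Real.sq_sqrt hZ0, ← hZ]
      ring))) hm1 hQ
  have hpow : ∀ x : ℝ, x ^ (400 : ℝ) = x ^ 400 := fun x => by
    exact_mod_cast Real.rpow_natCast x 400
  rw [hpow, hpow]
  exact hfin
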